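/- Let $H\neq\{0\}$ be a separable complex Hilbert space, let $A:\mathfrak D(A)\subset H\to H$ be a selfadjoint operator that is strictly positive, i.e. $\langle Au,u\rangle\ge c\|u\|^2$ for all $u\in\mathfrak D(A)$ and some $c>0$, and let $f:\sigma(A)\to[0,\infty)$ be continuous on the spectrum $\sigma(A)\subset(0,\infty)$. Let $E_A$ be the spectral measure of $A$; for continuous $\phi$ on $\sigma(A)$ put $\phi(A)=\int_{\sigma(A)}\phi\,dE_A$, with domain $\{u\in H:\int_{\sigma(A)}|\phi(s)|^2\,d\langle E_A(s)u,u\rangle<\infty\}$. Let $\mathcal H=\mathfrak D(A^{1/2})\times H$ with norm $\|(u,v)\|_{\mathcal H}^2=\|A^{1/2}u\|^2+\|v\|^2$, and let $\mathbb A$ be the operator on $\mathcal H$ $$\mathbb A(u,v)=(v,\,-Au-f(A)v),\qquad \mathfrak D(\mathbb A)=\{(u,v)\in\mathcal H:\ v\in\mathfrak D(A^{1/2}),\ Au+f(A)v\in H\},$$ where $Au+f(A)v\in H$ means that there is $h\in H$ (then $h=Au+f(A)v$) such that $\langle Aw,u\rangle+\langle f(A)w,v\rangle=\langle w,h\rangle$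 for all $w\in\mathfrak D(A)\cap\mathfrak D(f(A))$. Then $\mathbb A$ is the infinitesimal generator of a strongly continuous contraction semigroup $S(t)=e^{t\mathbb A}$ on $\mathcal H$ (the solution semigroup of $\ddot u+Au+f(A)\dot u=0$), and $S(t)$ is exponentially stable, i.e. there exist $\varkappa>0$ and $M\ge1$ with $\|S(t)z\|_{\mathcal H}\le Me^{-\varkappa t}\|z\|_{\mathcal H}$ for all $t\ge0$ and $z\in\mathcal H$, if and only if $$\inf_{s\in\sigma(A)}f(s)>0\qquad\text{and}\qquad\sup_{s\in\sigma(A)}\frac{f(s)}{s}<\infty.$$ -/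

import Mathlib

open MeasureTheory Filter Topology
open scoped NNReal ENNReal InnerProductSpace

noncomputable section

namespace DampedEvolution

universe u

/-! ### Spectral measures and operator-valued integrals -/

/-- A spectral measure on a measurable space `α`: an assignment of selfadjoint projections of `H`
to measurable sets (with the junk value `0` at non-measurable sets). -/
structure SpectralMeasure (α : Type*) [MeasurableSpace α]
    (H : Type*) [NormedAddCommGroup H] [InnerProductSpace ℂ H] [CompleteSpace H] where
  toFun : Set α → H →L[ℂ] H
  not_measurable : ∀ ω, ¬ MeasurableSet ω → toFun ω = 0
  isStarProjection : ∀ ω, MeasurableSet ω → IsStarProjection (toFun ω)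
  empty : toFun ∅ = 0
  univ : toFun Set.univ = 1
  inter : ∀ ω₁ ω₂, MeasurableSet ω₁ → MeasurableSet ω₂ →
    toFun (ω₁ ∩ ω₂) = toFun ω₁ * toFun ω₂
  /-- Each `ω ↦ ⟨E(ω)u, v⟩` is countably additive, i.e. a complex measure. -/
  iUnion : ∀ ω : ℕ → Set α, (∀ i, MeasurableSet (ω i)) → Pairwise (Function.onFun Disjoint ω) →
    ∀ u v : H, HasSum (fun i => ⟪v, toFun (ω i) u⟫_ℂ) ⟪v, toFun (⋃ i, ω i) u⟫_ℂ

namespace SpectralMeasure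

variable {α : Type*} [MeasurableSpace α]
  {H : Type*} [NormedAddCommGroup H] [InnerProductSpace ℂ H] [CompleteSpace H]

theorem re_inner_nonneg (E : SpectralMeasure α H) (u : H) {ω : Set α} (hω : MeasurableSet ω) :
    0 ≤ (⟪u, E.toFun ω u⟫_ℂ).re := by
  have h := E.isStarProjection ω hω
  have h1 : E.toFun ω u = E.toFun ω (E.toFun ω u) := by
    conv_lhs => rw [← h.isIdempotentElem.eq]
    rfl
  have h2 : ⟪u, E.toFun ω u⟫_ℂ = ⟪E.toFun ω u, E.toFun ω u⟫_ℂ := by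
    conv_lhs => rw [h1]
    rw [← ContinuousLinearMap.adjoint_inner_left,
      ← ContinuousLinearMap.star_eq_adjoint, h.isSelfAdjoint.star_eq]
  rw [h2]
  exact inner_self_nonneg (𝕜 := ℂ)

/-- The positive finite measure `ω ↦ ⟨E(ω)u, u⟩`. -/
def diag (E : SpectralMeasure α H) (u : H) : Measure α :=
  Measure.ofMeasurable (fun ω _ => ENNReal.ofReal (⟪u, E.toFun ω u⟫_ℂ).re)
    (by simp [E.empty])
    (by
      intro ω hω hd
      have hs := Complex.hasSum_re (E.iUnion ω hω hd u u)
      rw [← hs.tsum_eq]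
      exact ENNReal.ofReal_tsum_of_nonneg (fun i => E.re_inner_nonneg u (hω i)) hs.summable)

/-- `T = ∫ φ dE`: the domain of `T` is `{u : ∫ |φ|² d⟨E u, u⟩ < ∞}`, and there
`⟨T u, u⟩ = ∫ φ d⟨E u, u⟩`. By polarization the values `⟨T u, v⟩` on the (dense) domain, hence
`T` itself, are determined by `E` and `φ`. -/
def IsIntegral (E : SpectralMeasure α H) (φ : α → ℂ) (T : H →ₗ.[ℂ] H) : Prop :=
  (∀ u : H, u ∈ T.domain ↔ ∫⁻ s, ‖φ s‖ₑ ^ 2 ∂(E.diag u) < ∞) ∧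
    ∀ u : T.domain, ⟪(u : H), T u⟫_ℂ = ∫ s, φ s ∂(E.diag (u : H))

/-- The operator `∫ φ dE`. -/
def integral (E : SpectralMeasure α H) (φ : α → ℂ) : H →ₗ.[ℂ] H :=
  Classical.epsilon (E.IsIntegral φ)

end SpectralMeasure

/-! ### Unbounded selfadjoint operators -/

section Operators

variable {H : Type u} [NormedAddCommGroup H] [InnerProductSpace ℂ H] [CompleteSpace H]

/-- Strict positivity: `⟨A u, u⟩ ≥ c ‖u‖²` on the domain, for some `c > 0`. -/
def StrictlyPositive (A : H →ₗ.[ℂ] H) : Prop :=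
  ∃ c : ℝ, 0 < c ∧ ∀ u : A.domain, c * ‖(u : H)‖ ^ 2 ≤ (⟪(u : H), A u⟫_ℂ).re

/-- `ξ` is in the resolvent set of `A` if `A - ξ : D(A) → H` is a bijection with bounded
inverse. -/
def resolventSet (A : H →ₗ.[ℂ] H) : Set ℂ :=
  {ξ | Function.Bijective (fun u : A.domain => A u - ξ • (u : H)) ∧
    ∃ C : ℝ, ∀ u : A.domain, ‖(u : H)‖ ≤ C * ‖A u - ξ • (u : H)‖}

/-- The spectrum `σ(A)`, as a set of reals (for selfadjoint `A` there is no other spectrum). -/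
def spec (A : H →ₗ.[ℂ] H) : Set ℝ :=
  {s | (s : ℂ) ∉ resolventSet A}

/-- `E` is the spectral measure of `A`: it lives on `σ(A)` and `A = ∫ s dE(s)`. -/
def IsSpectralMeasureOf (A : H →ₗ.[ℂ] H) (E : SpectralMeasure (spec A) H) : Prop :=
  E.IsIntegral (fun s => ((s : ℝ) : ℂ)) A

open Classical in
/-- The functional calculus `φ(A) = ∫ φ dE_A`, where `E_A` is the spectral measure of `A`
(the value is junk if `A` has no spectral measure, which does not occur for selfadjoint `A`). -/
def funCalc (A : H →ₗ.[ℂ] H) (φ : spec A → ℂ) : H →ₗ.[ℂ] H :=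
  if h : ∃ E : SpectralMeasure (spec A) H, IsSpectralMeasureOf A E then
    h.choose.integral φ
  else ⊥

/-- The square root `A^{1/2}`. -/
def sqrtOp (A : H →ₗ.[ℂ] H) : H →ₗ.[ℂ] H :=
  funCalc A (fun s => ((Real.sqrt (s : ℝ) : ℝ) : ℂ))

/-! ### The phase space -/

/-- `H¹ = D(A^{1/2})`, with norm `‖u‖₁ = ‖A^{1/2} u‖`. -/
def HOne (A : H →ₗ.[ℂ] H) : Type u := (sqrtOp A).domain

instance (A : H →ₗ.[ℂ] H) : AddCommGroup (HOne A) :=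
  inferInstanceAs (AddCommGroup (sqrtOp A).domain)

instance (A : H →ₗ.[ℂ] H) : Module ℂ (HOne A) :=
  inferInstanceAs (Module ℂ (sqrtOp A).domain)

/-- `A^{1/2}` as a linear map on `H¹`. -/
def HOne.sqrtMap (A : H →ₗ.[ℂ] H) : HOne A →ₗ[ℂ] H := (sqrtOp A).toFun

/-- The inclusion of `H¹` into `H`. -/
def HOne.incl (A : H →ₗ.[ℂ] H) : HOne A →ₗ[ℂ] H := (sqrtOp A).domain.subtype

/-- The norm `‖u‖₁ = ‖A^{1/2} u‖` (a genuine norm when `A` is selfadjoint and strictly positive). -/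
instance (A : H →ₗ.[ℂ] H) : SeminormedAddCommGroup (HOne A) :=
  SeminormedAddCommGroup.induced (HOne A) H (HOne.sqrtMap A)

instance (A : H →ₗ.[ℂ] H) : NormedSpace ℂ (HOne A) :=
  NormedSpace.induced ℂ (HOne A) H (HOne.sqrtMap A)

/-- The phase space `H¹ × H` with `‖(u, v)‖² = ‖u‖₁² + ‖v‖²`. -/
abbrev Phase (A : H →ₗ.[ℂ] H) : Type u := WithLp 2 (HOne A × H)

theorem HOne.norm_def (A : H →ₗ.[ℂ] H) (u : HOne A) : ‖u‖ = ‖HOne.sqrtMap A u‖ := rfl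

theorem Phase.norm_sq (A : H →ₗ.[ℂ] H) (z : Phase A) :
    ‖z‖ ^ 2 = ‖HOne.sqrtMap A z.fst‖ ^ 2 + ‖z.snd‖ ^ 2 :=
  WithLp.prod_norm_sq_eq_of_L2 z

/-- The graph of the operator `𝔸 (u, v) = (v, - A u - f(A) v)`, with domain all `(u, v)` in the
phase space such that `v ∈ H¹` and `A u + f(A) v ∈ H`. Here `A u + f(A) v` is the functional
`w ↦ ⟨A w, u⟩ + ⟨f(A) w, v⟩` on `D(A) ∩ D(f(A))`, and it belongs to `H` if it is represented
there by a vector of `H`. -/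
def evolutionGraph (A : H →ₗ.[ℂ] H) (f : spec A → ℝ) : Set (Phase A × Phase A) :=
  {p | HOne.incl A p.2.fst = p.1.snd ∧
    ∀ (w : H) (hw : w ∈ A.domain) (hw' : w ∈ (funCalc A (fun s => (f s : ℂ))).domain),
      ⟪A ⟨w, hw⟩, HOne.incl A p.1.fst⟫_ℂ +
        ⟪funCalc A (fun s => (f s : ℂ)) ⟨w, hw'⟩, p.1.snd⟫_ℂ = ⟪w, -p.2.snd⟫_ℂ}

end Operators

/-! ### Strongly continuous semigroups -/

section Semigroups

variable {X : Type*} [SeminormedAddCommGroup X] [NormedSpace ℂ X]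

/-- Strongly continuous semigroups of bounded linear operators. -/
structure IsC0Semigroup (S : ℝ≥0 → X →L[ℂ] X) : Prop where
  zero : S 0 = ContinuousLinearMap.id ℂ X
  add : ∀ s t, S (s + t) = (S s).comp (S t)
  tendsto : ∀ z, Tendsto (fun t => S t z) (𝓝 0) (𝓝 z)

/-- The graph of the infinitesimal generator: all `(z, z')` with `(S(t) z - z) / t → z'` as
`t → 0⁺`. -/
def generatorGraph (S : ℝ≥0 → X →L[ℂ] X) : Set (X × X) :=
  {p | Tendsto (fun t : ℝ≥0 => ((t : ℝ) : ℂ)⁻¹ • (S t p.1 - p.1)) (𝓝[≠] 0) (𝓝 p.2)}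

/-- `S` is exponentially stable: `‖S(t) z‖ ≤ M e^{-ϰ t} ‖z‖` with `ϰ > 0`, `M ≥ 1`. -/
def ExponentiallyStable (S : ℝ≥0 → X →L[ℂ] X) : Prop :=
  ∃ κ : ℝ, 0 < κ ∧ ∃ M : ℝ, 1 ≤ M ∧
    ∀ (t : ℝ≥0) (z : X), ‖S t z‖ ≤ M * Real.exp (-κ * (t : ℝ)) * ‖z‖

end Semigroups

end DampedEvolution

end

/-!
The bounded inverse of `A` is selfadjoint, and Riesz–Markov applied to its continuous functional
calculus gives it a spectral measure, which is pushed forward to a spectral measure of `A`. The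
isometry `(u, v) ↦ (A^{1/2} u, v)` turns `𝔸` into the operator matrix
`[[0, A^{1/2}], [-A^{1/2}, -f(A)]]` on `H × H`. Cut off by the spectral projections of the sets
`{s ≤ n, f s ≤ n}` it becomes bounded and dissipative, and the contraction semigroups of the
cut-offs are compatible and converge to the semigroup.

If `f ≥ m > 0` and `f s ≤ C s`, the functional `½ ‖(x, y)‖² + ε Re ⟨A^{-1/2} x, y⟩` decays
exponentially for small `ε`, at a rate independent of the cut-off. Conversely, each root `μ` of
`μ² + f(s) μ + s` with `s ∈ σ(A)` is an approximate eigenvalue, so exponential decay at rate `κ`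
forces `Re μ ≤ -κ`. The two roots have sum `-f(s)` and product `s`, whence `2κ ≤ f(s)` and
`κ f(s) ≤ 2s`.
-/

noncomputable section

namespace DampedEvolution

/-! ### Bounded measurable functions and bounded pointwise limits -/

section BddMeas

theorem norm_indicator_one_le {X : Type*} (ω : Set X) (x : X) :
    ‖ω.indicator (1 : X → ℂ) x‖ ≤ 1 :=
  (norm_indicator_le_norm_self _ _).trans (by simp)

variable {X : Type*} [MeasurableSpace X]

/-- Bounded measurable complex functions: the multipliers `φ` for which `∫ φ dE` is a bounded
operator. -/
def BddMeas (φ : X → ℂ) : Prop := Measurable φ ∧ ∃ C : ℝ, ∀ x, ‖φ x‖ ≤ C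

namespace BddMeas

variable {φ ψ : X → ℂ}

theorem integrable (hφ : BddMeas φ) (μ : Measure X) [IsFiniteMeasure μ] : Integrable φ μ :=
  let ⟨C, hC⟩ := hφ.2
  Integrable.of_bound hφ.1.aestronglyMeasurable C (Eventually.of_forall hC)

theorem indicator_one {ω : Set X} (hω : MeasurableSet ω) : BddMeas (ω.indicator (1 : X → ℂ)) :=
  ⟨measurable_one.indicator hω, 1, norm_indicator_one_le ω⟩

theorem indicator (hφ : Measurable φ) {ω : Set X} (hω : MeasurableSet ω) {C : ℝ}
    (hC : ∀ x ∈ ω, ‖φ x‖ ≤ C) : BddMeas (ω.indicator φ) := by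
  refine ⟨hφ.indicator hω, max C 0, fun x => ?_⟩
  by_cases hx : x ∈ ω
  · simp [hx, hC x hx]
  · simp [hx]

theorem add (hφ : BddMeas φ) (hψ : BddMeas ψ) : BddMeas (φ + ψ) := by
  obtain ⟨hφm, C, hC⟩ := hφ
  obtain ⟨hψm, D, hD⟩ := hψ
  exact ⟨hφm.add hψm, C + D, fun x => (norm_add_le _ _).trans (add_le_add (hC x) (hD x))⟩

theorem mul (hφ : BddMeas φ) (hψ : BddMeas ψ) : BddMeas (φ * ψ) := by
  obtain ⟨hφm, C, hC⟩ := hφ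
  obtain ⟨hψm, D, hD⟩ := hψ
  exact ⟨hφm.mul hψm, C * D, fun x => norm_mul_le_of_le (hC x) (hD x)⟩

theorem const (c : ℂ) : BddMeas (fun _ : X => c) :=
  ⟨measurable_const, ‖c‖, fun _ => le_rfl⟩

theorem smul (c : ℂ) (hφ : BddMeas φ) : BddMeas (c • φ) :=
  (const c).mul hφ

theorem sub (hφ : BddMeas φ) (hψ : BddMeas ψ) : BddMeas (φ - ψ) := by
  simpa only [neg_one_smul, ← sub_eq_add_neg] using hφ.add (hψ.smul (-1))

theorem star (hφ : BddMeas φ) : BddMeas (star φ) := by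
  obtain ⟨hφm, C, hC⟩ := hφ
  exact ⟨Complex.continuous_conj.measurable.comp hφm, C, fun x => by simpa using hC x⟩

theorem comp {Y : Type*} [MeasurableSpace Y] (hφ : BddMeas φ) {g : Y → X} (hg : Measurable g) :
    BddMeas (φ ∘ g) :=
  ⟨hφ.1.comp hg, hφ.2.imp fun _ h y => h (g y)⟩

end BddMeas

theorem tendsto_integral_of_bounded {ν : Measure X} [IsFiniteMeasure ν] {φ : ℕ → X → ℂ} {ψ : X → ℂ}
    {C : ℝ} (hφ : ∀ n, Measurable (φ n)) (hC : ∀ n x, ‖φ n x‖ ≤ C)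
    (hlim : ∀ x, Tendsto (fun n => φ n x) atTop (𝓝 (ψ x))) :
    Tendsto (fun n => ∫ x, φ n x ∂ν) atTop (𝓝 (∫ x, ψ x ∂ν)) :=
  tendsto_integral_of_dominated_convergence (fun _ => C) (fun n => (hφ n).aestronglyMeasurable)
    (integrable_const C) (fun n => Eventually.of_forall (hC n)) (Eventually.of_forall hlim)

/-- The class of functions described by `P` is closed under linear combinations of bounded
measurable functions and under bounded pointwise limits of sequences; these are the closure
properties of the functional monotone class theorem. -/
structure IsBoundedlyClosed (P : (X → ℂ) → Prop) : Prop where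
  add : ∀ {φ ψ}, BddMeas φ → BddMeas ψ → P φ → P ψ → P (φ + ψ)
  smul : ∀ (c : ℂ) {φ}, BddMeas φ → P φ → P (c • φ)
  tendsto : ∀ {φ : ℕ → X → ℂ} {ψ : X → ℂ} {C : ℝ}, (∀ n, Measurable (φ n)) →
    (∀ n x, ‖φ n x‖ ≤ C) → (∀ x, Tendsto (fun n => φ n x) atTop (𝓝 (ψ x))) →
    (∀ n, P (φ n)) → P ψ

/-- Every boundedly closed class that contains `𝒢` contains all bounded measurable functions. -/
def GeneratesBddMeas (𝒢 : Set (X → ℂ)) : Prop :=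
  ∀ P : (X → ℂ) → Prop, IsBoundedlyClosed P → (∀ φ ∈ 𝒢, P φ) → ∀ φ, BddMeas φ → P φ

theorem IsBoundedlyClosed.simpleFunc {P : (X → ℂ) → Prop} (hP : IsBoundedlyClosed P)
    (hind : ∀ ω, MeasurableSet ω → P (ω.indicator 1)) (g : SimpleFunc X ℂ) : P g := by
  suffices BddMeas g ∧ P g from this.2
  induction g using SimpleFunc.induction with
  | @const c ω hω =>
    have heq : ⇑(SimpleFunc.piecewise ω hω (SimpleFunc.const _ c) (SimpleFunc.const _ (0 : ℂ)))
        = c • ω.indicator (1 : X → ℂ) := by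
      ext x
      by_cases hx : x ∈ ω <;> simp [hx]
    rw [heq]
    exact ⟨(BddMeas.indicator_one hω).smul c, hP.smul c (BddMeas.indicator_one hω) (hind ω hω)⟩
  | add _ hf hg => exact ⟨hf.1.add hg.1, hP.add hf.1 hg.1 hf.2 hg.2⟩

theorem generatesBddMeas_indicator :
    GeneratesBddMeas {φ : X → ℂ | ∃ ω, MeasurableSet ω ∧ φ = ω.indicator 1} := by
  rintro P hP hind φ ⟨hφm, C, hC⟩
  have hφ : StronglyMeasurable φ := hφm.stronglyMeasurable
  have hC' : ∀ x, ‖φ x‖ ≤ max C 0 := fun x => (hC x).trans (le_max_left _ _)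
  exact hP.tendsto (fun n => (hφ.approxBounded (max C 0) n).measurable)
    (fun n x => hφ.norm_approxBounded_le (le_max_right _ _) n x)
    (fun x => hφ.tendsto_approxBounded_of_norm_le (hC' x))
    (fun n => hP.simpleFunc (fun ω hω => hind _ ⟨ω, hω, rfl⟩) _)

theorem IsBoundedlyClosed.indicator_iUnion {P : (X → ℂ) → Prop} (hP : IsBoundedlyClosed P)
    {ω : ℕ → Set X} (hω : ∀ i, MeasurableSet (ω i)) (hd : Pairwise (Function.onFun Disjoint ω))
    (hind : ∀ i, P ((ω i).indicator 1)) : P ((⋃ i, ω i).indicator 1) := by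
  have hsum : ∀ n, BddMeas (∑ i ∈ Finset.range n, (ω i).indicator (1 : X → ℂ)) ∧
      P (∑ i ∈ Finset.range n, (ω i).indicator (1 : X → ℂ)) := by
    intro n
    induction n with
    | zero =>
      exact ⟨.const 0, by simpa using hP.smul 0 (BddMeas.indicator_one (hω 0)) (hind 0)⟩
    | succ n ih =>
      rw [Finset.sum_range_succ]
      have hn := BddMeas.indicator_one (hω n)
      exact ⟨ih.1.add hn, hP.add ih.1 hn ih.2 (hind n)⟩
  have hunion : ∀ n, (⋃ i ∈ Finset.range n, ω i).indicator (1 : X → ℂ) =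
      ∑ i ∈ Finset.range n, (ω i).indicator (1 : X → ℂ) := fun n =>
    (Finset.indicator_biUnion _ _ fun i _ j _ hij => hd hij).trans (by ext x; simp)
  refine hP.tendsto (φ := fun n => (⋃ i ∈ Finset.range n, ω i).indicator 1)
    (fun n => measurable_one.indicator (Finset.measurableSet_biUnion _ fun i _ => hω i))
    (fun n => norm_indicator_one_le _) (fun x => ?_) (fun n => hunion n ▸ (hsum n).2)
  exact ((tendsto_indicator_biUnion_finset ω (1 : X → ℂ) x).comp tendsto_finset_range).mono_right
    (pure_le_nhds _)

theorem IsBoundedlyClosed.indicator_compl {P : (X → ℂ) → Prop} (hP : IsBoundedlyClosed P)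
    {ω : Set X} (hω : MeasurableSet ω) (h1 : P 1) (hind : P (ω.indicator 1)) :
    P (ωᶜ.indicator 1) := by
  have h := hP.add (BddMeas.const 1) ((BddMeas.indicator_one hω).smul (-1)) h1
    (hP.smul (-1) (BddMeas.indicator_one hω) hind)
  convert h using 1
  ext x
  by_cases hx : x ∈ ω <;> simp [hx]

section Continuous

variable [TopologicalSpace X] [BorelSpace X] [HasOuterApproxClosed X]

/-- Continuous functions with values in `[0, 1]`, as complex functions. -/
def unitContinuous (X : Type*) [TopologicalSpace X] : Set (X → ℂ) :=
  {φ | ∃ g : C(X, ℝ), (∀ x, g x ∈ Set.Icc 0 1) ∧ φ = fun x => (g x : ℂ)}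

theorem IsBoundedlyClosed.indicator_of_isClosed {P : (X → ℂ) → Prop} (hP : IsBoundedlyClosed P)
    (hcont : ∀ φ ∈ unitContinuous X, P φ) {F : Set X} (hF : IsClosed F) :
    P (F.indicator 1) := by
  have hle := HasOuterApproxClosed.apprSeq_apply_le_one hF
  refine hP.tendsto (φ := fun n x => ((hF.apprSeq n x : ℝ) : ℂ)) (C := 1)
    (fun n => Continuous.measurable (by fun_prop)) (fun n x => by simpa using! hle n x)
    (fun x => ?_) (fun n => hcont _
      ⟨⟨fun x => (hF.apprSeq n x : ℝ), by fun_prop⟩, fun x => ⟨NNReal.coe_nonneg _, hle n x⟩, rfl⟩)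
  have hlim := (tendsto_pi_nhds.1 (HasOuterApproxClosed.tendsto_apprSeq hF)) x
  have hcoe : Continuous fun r : ℝ≥0 => ((r : ℝ) : ℂ) := by fun_prop
  have hind : F.indicator (1 : X → ℂ) x = (((F.indicator (fun _ => 1) x : ℝ≥0) : ℝ) : ℂ) := by
    by_cases hx : x ∈ F <;> simp [hx]
  rw [hind]
  exact (hcoe.tendsto _).comp hlim

theorem generatesBddMeas_unitContinuous : GeneratesBddMeas (unitContinuous X) := by
  intro P hP hcont
  refine generatesBddMeas_indicator P hP ?_
  rintro _ ⟨ω, hω, rfl⟩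
  induction ω, hω using MeasurableSpace.induction_on_inter
    (BorelSpace.measurable_eq.trans (borel_eq_generateFrom_isClosed (α := X)))
    isPiSystem_isClosed with
  | empty => exact hP.indicator_of_isClosed hcont isClosed_empty
  | basic F hF => exact hP.indicator_of_isClosed hcont hF
  | compl ω hω ih =>
    have h1 := hP.indicator_of_isClosed hcont isClosed_univ
    rw [Set.indicator_univ] at h1
    exact hP.indicator_compl hω h1 ih
  | iUnion ω hd hω ih => exact hP.indicator_iUnion hω hd ih

end Continuous

end BddMeas

/-! ### Weak limits and representation of functions by operators -/

section WeakLimits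

variable {H : Type*} [NormedAddCommGroup H] [InnerProductSpace ℂ H]

theorem inner_polarization (T : H →L[ℂ] H) (u v : H) :
    ⟪v, T u⟫_ℂ = (⟪u + v, T (u + v)⟫_ℂ - ⟪u - v, T (u - v)⟫_ℂ
      + Complex.I * ⟪u + Complex.I • v, T (u + Complex.I • v)⟫_ℂ
      - Complex.I * ⟪u - Complex.I • v, T (u - Complex.I • v)⟫_ℂ) / 4 := by
  have h := congrArg (starRingEnd ℂ) (inner_map_polarization' (T : H →ₗ[ℂ] H) u v)
  simp only [map_div₀, map_sub (starRingEnd ℂ), map_add (starRingEnd ℂ), map_mul, inner_conj_symm,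
    Complex.conj_I, Complex.conj_ofNat, ContinuousLinearMap.coe_coe] at h
  rw [h]
  ring

theorem ext_of_inner_self {S T : H →L[ℂ] H} (h : ∀ u, ⟪u, S u⟫_ℂ = ⟪u, T u⟫_ℂ) : S = T := by
  ext u
  refine ext_inner_left ℂ fun v => ?_
  rw [inner_polarization S, inner_polarization T]
  simp only [h]

theorem inner_eq_zero_of_inner_self_eq_zero {D : Submodule ℂ H} {L : D →ₗ[ℂ] H}
    (h : ∀ u : D, ⟪(u : H), L u⟫_ℂ = 0) (u v : D) : ⟪(v : H), L u⟫_ℂ = 0 := by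
  have hadd := h (u + v)
  have hI := h (u + Complex.I • v)
  simp only [Submodule.coe_add, Submodule.coe_smul, map_add, map_smul, inner_add_left,
    inner_add_right, inner_smul_left, inner_smul_right, Complex.conj_I, h u, h v] at hadd hI
  linear_combination hadd / 2 + Complex.I * hI / 2
    + (⟪(v : H), L u⟫_ℂ - ⟪(u : H), L v⟫_ℂ) / 2 * Complex.I_sq

theorem tendsto_inner_of_tendsto_inner_self {T : ℕ → H →L[ℂ] H} {S : H →L[ℂ] H}
    (h : ∀ u, Tendsto (fun n => ⟪u, T n u⟫_ℂ) atTop (𝓝 ⟪u, S u⟫_ℂ)) (u v : H) :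
    Tendsto (fun n => ⟪v, T n u⟫_ℂ) atTop (𝓝 ⟪v, S u⟫_ℂ) := by
  rw [inner_polarization S]
  simp only [fun n => inner_polarization (T n) u v]
  exact ((((h _).sub (h _)).add ((h _).const_mul _)).sub ((h _).const_mul _)).div_const _

variable [CompleteSpace H]

-- The uniform boundedness principle is applied twice: to `v ↦ ⟪T n u, v⟫`, then to `T n`.
theorem exists_norm_le_of_tendsto_inner {T : ℕ → H →L[ℂ] H} {p : H → H → ℂ}
    (h : ∀ v u, Tendsto (fun n => ⟪v, T n u⟫_ℂ) atTop (𝓝 (p v u))) : ∃ C, ∀ n, ‖T n‖ ≤ C := by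
  refine banach_steinhaus fun u => ?_
  obtain ⟨C, hC⟩ := banach_steinhaus (g := fun n => innerSL ℂ (T n u)) fun v => by
    obtain ⟨C, hC⟩ := (h v u).norm.bddAbove_range
    exact ⟨C, fun n => by simpa [norm_inner_symm] using hC ⟨n, rfl⟩⟩
  exact ⟨C, fun n => by simpa using hC n⟩

theorem exists_weak_limit {T : ℕ → H →L[ℂ] H} {q : H → ℂ}
    (hq : ∀ u, Tendsto (fun n => ⟪u, T n u⟫_ℂ) atTop (𝓝 (q u))) :
    ∃ S : H →L[ℂ] H, ∀ u, ⟪u, S u⟫_ℂ = q u := by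
  have hp : ∀ v u, ∃ a, Tendsto (fun n => ⟪v, T n u⟫_ℂ) atTop (𝓝 a) := by
    intro v u
    simp only [fun n => inner_polarization (T n) u v]
    exact ⟨_, ((((hq _).sub (hq _)).add ((hq _).const_mul _)).sub ((hq _).const_mul _)).div_const _⟩
  choose p hp using hp
  obtain ⟨C, hC⟩ := exists_norm_le_of_tendsto_inner hp
  have hpC : ∀ v u, ‖p v u‖ ≤ C * ‖v‖ * ‖u‖ := fun v u =>
    le_of_tendsto (hp v u).norm (Eventually.of_forall fun n => calc
      ‖⟪v, T n u⟫_ℂ‖ ≤ ‖v‖ * ‖T n u‖ := norm_inner_le_norm _ _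
      _ ≤ ‖v‖ * (C * ‖u‖) := by gcongr; exact (T n).le_of_opNorm_le (hC n) u
      _ = C * ‖v‖ * ‖u‖ := by ring)
  let B : H →ₗ⋆[ℂ] H →ₗ[ℂ] ℂ := LinearMap.mk₂'ₛₗ (starRingEnd ℂ) (RingHom.id ℂ) p
    (fun v v' u => tendsto_nhds_unique (hp _ _)
      (((hp v u).add (hp v' u)).congr fun n => (inner_add_left _ _ _).symm))
    (fun c v u => tendsto_nhds_unique (hp _ _)
      (((hp v u).const_mul _).congr fun n => (inner_smul_left _ _ _).symm))
    (fun v u u' => tendsto_nhds_unique (hp _ _)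
      (((hp v u).add (hp v u')).congr fun n => by rw [map_add, inner_add_right]))
    (fun c v u => tendsto_nhds_unique (hp _ _)
      (((hp v u).const_mul c).congr fun n => by rw [map_smul, inner_smul_right]))
  refine ⟨ContinuousLinearMap.adjoint (InnerProductSpace.continuousLinearMapOfBilin
    (B.mkContinuous₂ C hpC)), fun u => ?_⟩
  rw [ContinuousLinearMap.adjoint_inner_right,
    InnerProductSpace.continuousLinearMapOfBilin_apply]
  exact tendsto_nhds_unique (hp u u) (hq u)

end WeakLimits

section Represents

variable {X : Type*} [MeasurableSpace X] {H : Type*} [NormedAddCommGroup H]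
  [InnerProductSpace ℂ H]

/-- `T` represents `φ` with respect to the family of measures `μ`, i.e. `⟨T u, u⟩ = ∫ φ dμ_u` for
all `u`. Both `∫ φ dE` for a spectral measure `E` and `φ(B)` for a bounded selfadjoint operator `B`
are operators that represent `φ`. -/
def Represents (μ : H → Measure X) (φ : X → ℂ) (T : H →L[ℂ] H) : Prop :=
  ∀ u, ⟪u, T u⟫_ℂ = ∫ x, φ x ∂(μ u)

variable {μ : H → Measure X} {φ ψ : X → ℂ} {S T : H →L[ℂ] H}

namespace Represents

theorem unique (hS : Represents μ φ S) (hT : Represents μ φ T) : S = T :=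
  ext_of_inner_self fun u => (hS u).trans (hT u).symm

theorem add [∀ u, IsFiniteMeasure (μ u)] (hφ : BddMeas φ) (hψ : BddMeas ψ)
    (hS : Represents μ φ S) (hT : Represents μ ψ T) : Represents μ (φ + ψ) (S + T) := by
  intro u
  simp only [_root_.add_apply, inner_add_right, Pi.add_apply]
  rw [integral_add (hφ.integrable _) (hψ.integrable _), hS u, hT u]

theorem smul (c : ℂ) (hS : Represents μ φ S) : Represents μ (c • φ) (c • S) := by
  intro u
  simp only [_root_.smul_apply, inner_smul_right, Pi.smul_apply]
  rw [integral_smul, hS u, smul_eq_mul]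

theorem star [CompleteSpace H] (hS : Represents μ φ S) : Represents μ (star φ) (star S) := by
  intro u
  rw [ContinuousLinearMap.star_eq_adjoint, ContinuousLinearMap.adjoint_inner_right,
    ← inner_conj_symm, hS u, ← integral_conj]
  rfl

variable [∀ u, IsFiniteMeasure (μ u)]

theorem tendsto_inner {φ : ℕ → X → ℂ} {C : ℝ} (hφ : ∀ n, Measurable (φ n))
    (hC : ∀ n x, ‖φ n x‖ ≤ C) (hlim : ∀ x, Tendsto (fun n => φ n x) atTop (𝓝 (ψ x)))
    {T : ℕ → H →L[ℂ] H} (hT : ∀ n, Represents μ (φ n) (T n)) (hS : Represents μ ψ S) (u v : H) :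
    Tendsto (fun n => ⟪v, T n u⟫_ℂ) atTop (𝓝 ⟪v, S u⟫_ℂ) := by
  refine tendsto_inner_of_tendsto_inner_self (fun u => ?_) u v
  simp only [hT _ u, hS u]
  exact tendsto_integral_of_bounded hφ hC hlim

variable [CompleteSpace H]

theorem exists_of_tendsto {φ : ℕ → X → ℂ} {C : ℝ} (hφ : ∀ n, Measurable (φ n))
    (hC : ∀ n x, ‖φ n x‖ ≤ C) (hlim : ∀ x, Tendsto (fun n => φ n x) atTop (𝓝 (ψ x)))
    {T : ℕ → H →L[ℂ] H} (hT : ∀ n, Represents μ (φ n) (T n)) : ∃ S, Represents μ ψ S :=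
  exists_weak_limit (T := T) fun u => by
    simp only [hT _ u]
    exact tendsto_integral_of_bounded hφ hC hlim

theorem isBoundedlyClosed_exists : IsBoundedlyClosed fun φ => ∃ T, Represents μ φ T where
  add := fun hφ hψ ⟨_, hS⟩ ⟨_, hT⟩ => ⟨_, hS.add hφ hψ hT⟩
  smul := fun c _ _ ⟨_, hS⟩ => ⟨_, hS.smul c⟩
  tendsto := fun hφ hC hlim h => by
    choose T hT using h
    exact exists_of_tendsto hφ hC hlim hT

theorem isBoundedlyClosed_exists_mul (hψ : BddMeas ψ) (T : H →L[ℂ] H) :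
    IsBoundedlyClosed fun φ => ∃ S, Represents μ φ S ∧ Represents μ (φ * ψ) (S * T) where
  add := by
    rintro φ₁ φ₂ h₁ h₂ ⟨S₁, hS₁, hST₁⟩ ⟨S₂, hS₂, hST₂⟩
    refine ⟨S₁ + S₂, hS₁.add h₁ h₂ hS₂, ?_⟩
    rw [add_mul, add_mul]
    exact hST₁.add (h₁.mul hψ) (h₂.mul hψ) hST₂
  smul := by
    rintro c φ - ⟨S, hS, hST⟩
    refine ⟨c • S, hS.smul c, ?_⟩
    rw [smul_mul_assoc, smul_mul_assoc]
    exact hST.smul c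
  tendsto := by
    intro φ φ' C hφ hC hlim h
    choose S hS hST using h
    obtain ⟨S', hS'⟩ := exists_of_tendsto hφ hC hlim hS
    obtain ⟨hψm, D, hD⟩ := hψ
    refine ⟨S', hS', fun u => ?_⟩
    have hint := tendsto_integral_of_bounded (ν := μ u) (fun n => (hφ n).mul hψm)
      (fun n x => norm_mul_le_of_le (hC n x) (hD x)) (fun x => (hlim x).mul_const (ψ x))
    have hinner := tendsto_inner hφ hC hlim hS hS' (T u) u
    exact tendsto_nhds_unique hinner (hint.congr fun n => (hST n u).symm)

variable {𝒢 : Set (X → ℂ)}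

theorem mul_of_generatesBddMeas_left (h𝒢 : GeneratesBddMeas 𝒢) (hψ : BddMeas ψ)
    (hmul : ∀ φ ∈ 𝒢, ∃ S, Represents μ φ S ∧ Represents μ (φ * ψ) (S * T)) (hφ : BddMeas φ)
    (hS : Represents μ φ S) : Represents μ (φ * ψ) (S * T) := by
  obtain ⟨S', hS', hST⟩ := h𝒢 _ (isBoundedlyClosed_exists_mul hψ T) hmul φ hφ
  rwa [hS.unique hS']

-- First `ψ` stays in `𝒢` and `φ` becomes arbitrary; taking adjoints then exchanges the two.
theorem mul_of_generatesBddMeas (h𝒢 : GeneratesBddMeas 𝒢) (hbdd : ∀ φ ∈ 𝒢, BddMeas φ)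
    (hreal : ∀ φ ∈ 𝒢, Star.star φ = φ)
    (hmul : ∀ φ ∈ 𝒢, ∀ ψ ∈ 𝒢, ∃ S T, Represents μ φ S ∧ Represents μ ψ T ∧
      Represents μ (φ * ψ) (S * T)) (hφ : BddMeas φ) (hψ : BddMeas ψ) (hS : Represents μ φ S)
    (hT : Represents μ ψ T) : Represents μ (φ * ψ) (S * T) := by
  refine mul_of_generatesBddMeas_left h𝒢 hψ (fun χ hχ => ?_) hφ hS
  obtain ⟨R, -, hR, -⟩ := hmul χ hχ χ hχ
  have hTR : Represents μ (Star.star ψ * χ) (Star.star T * R) := by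
    refine mul_of_generatesBddMeas_left h𝒢 (hbdd χ hχ) (fun χ' hχ' => ?_) hψ.star hT.star
    obtain ⟨S', R', hS', hR', hSR⟩ := hmul χ' hχ' χ hχ
    exact ⟨S', hS', hR.unique hR' ▸ hSR⟩
  have hRstar : Star.star R = R := by
    have h := hR.star
    rw [hreal χ hχ] at h
    exact h.unique hR
  have h := hTR.star
  rw [star_mul, star_mul, star_star, star_star, hreal χ hχ, hRstar] at h
  exact ⟨R, hR, h⟩

end Represents

end Represents

/-! ### Integration of bounded functions against a spectral measure -/

namespace SpectralMeasure

variable {α : Type*} [MeasurableSpace α]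
  {H : Type*} [NormedAddCommGroup H] [InnerProductSpace ℂ H] [CompleteSpace H]
  (E : SpectralMeasure α H)

theorem inner_toFun_left {ω : Set α} (hω : MeasurableSet ω) (u v : H) :
    ⟪E.toFun ω u, v⟫_ℂ = ⟪u, E.toFun ω v⟫_ℂ :=
  (E.isStarProjection ω hω).isSelfAdjoint.isSymmetric u v

theorem toFun_toFun {ω : Set α} (hω : MeasurableSet ω) (u : H) :
    E.toFun ω (E.toFun ω u) = E.toFun ω u :=
  congrArg (fun T : H →L[ℂ] H => T u) (E.isStarProjection ω hω).isIdempotentElem.eq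

theorem toFun_toFun_of_subset {ω₁ ω₂ : Set α} (h₁ : MeasurableSet ω₁) (h₂ : MeasurableSet ω₂)
    (h : ω₁ ⊆ ω₂) (u : H) : E.toFun ω₂ (E.toFun ω₁ u) = E.toFun ω₁ u := by
  have hmul := E.inter ω₂ ω₁ h₂ h₁
  rw [Set.inter_eq_right.2 h] at hmul
  exact congrArg (fun T : H →L[ℂ] H => T u) hmul.symm

theorem inner_toFun_self {ω : Set α} (hω : MeasurableSet ω) (u : H) :
    ⟪u, E.toFun ω u⟫_ℂ = ((‖E.toFun ω u‖ ^ 2 : ℝ) : ℂ) := by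
  rw [← E.toFun_toFun hω, ← E.inner_toFun_left hω, inner_self_eq_norm_sq_to_K,
    E.toFun_toFun hω]
  norm_cast

theorem diag_apply (u : H) {ω : Set α} (hω : MeasurableSet ω) :
    E.diag u ω = ENNReal.ofReal (‖E.toFun ω u‖ ^ 2) := by
  rw [diag, Measure.ofMeasurable_apply _ hω, E.inner_toFun_self hω, Complex.ofReal_re]

theorem diag_real (u : H) {ω : Set α} (hω : MeasurableSet ω) :
    (E.diag u).real ω = ‖E.toFun ω u‖ ^ 2 := by
  rw [Measure.real, E.diag_apply u hω, ENNReal.toReal_ofReal (by positivity)]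

instance (u : H) : IsFiniteMeasure (E.diag u) :=
  ⟨by rw [E.diag_apply u .univ]; exact ENNReal.ofReal_lt_top⟩

theorem diag_real_univ (u : H) : (E.diag u).real Set.univ = ‖u‖ ^ 2 := by
  rw [E.diag_real u .univ, E.univ, one_apply_eq_self]

theorem represents_indicator {ω : Set α} (hω : MeasurableSet ω) :
    Represents E.diag (ω.indicator 1) (E.toFun ω) := by
  intro u
  rw [integral_indicator hω, E.inner_toFun_self hω, ← E.diag_real u hω]
  simp

theorem exists_represents {φ : α → ℂ} (hφ : BddMeas φ) : ∃ T, Represents E.diag φ T := by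
  refine generatesBddMeas_indicator _ Represents.isBoundedlyClosed_exists ?_ φ hφ
  rintro _ ⟨ω, hω, rfl⟩
  exact ⟨_, E.represents_indicator hω⟩

open Classical in
/-- The bounded operator `∫ φ dE` for bounded measurable `φ` (and `0` for other `φ`). -/
def bcalc (φ : α → ℂ) : H →L[ℂ] H :=
  if h : BddMeas φ then (E.exists_represents h).choose else 0

theorem represents_bcalc {φ : α → ℂ} (hφ : BddMeas φ) : Represents E.diag φ (E.bcalc φ) := by
  rw [bcalc, dif_pos hφ]
  exact (E.exists_represents hφ).choose_spec

variable {E}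

theorem inner_bcalc_self {φ : α → ℂ} (hφ : BddMeas φ) (u : H) :
    ⟪u, E.bcalc φ u⟫_ℂ = ∫ s, φ s ∂(E.diag u) := E.represents_bcalc hφ u

theorem bcalc_eq {φ : α → ℂ} (hφ : BddMeas φ) {T : H →L[ℂ] H} (hT : Represents E.diag φ T) :
    E.bcalc φ = T := (E.represents_bcalc hφ).unique hT

theorem bcalc_indicator_one {ω : Set α} (hω : MeasurableSet ω) :
    E.bcalc (ω.indicator 1) = E.toFun ω :=
  bcalc_eq (BddMeas.indicator_one hω) (E.represents_indicator hω)

theorem bcalc_add {φ ψ : α → ℂ} (hφ : BddMeas φ) (hψ : BddMeas ψ) :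
    E.bcalc (φ + ψ) = E.bcalc φ + E.bcalc ψ :=
  bcalc_eq (hφ.add hψ) ((E.represents_bcalc hφ).add hφ hψ (E.represents_bcalc hψ))

theorem bcalc_smul (c : ℂ) {φ : α → ℂ} (hφ : BddMeas φ) : E.bcalc (c • φ) = c • E.bcalc φ :=
  bcalc_eq (hφ.smul c) ((E.represents_bcalc hφ).smul c)

theorem bcalc_sub {φ ψ : α → ℂ} (hφ : BddMeas φ) (hψ : BddMeas ψ) :
    E.bcalc (φ - ψ) = E.bcalc φ - E.bcalc ψ := by
  have h : φ - ψ = φ + (-1 : ℂ) • ψ := by rw [neg_one_smul, sub_eq_add_neg]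
  rw [h, bcalc_add hφ (hψ.smul _), bcalc_smul _ hψ, neg_one_smul, sub_eq_add_neg]

theorem inner_bcalc_left {φ : α → ℂ} (hφ : BddMeas φ) (u v : H) :
    ⟪E.bcalc φ u, v⟫_ℂ = ⟪u, E.bcalc (star φ) v⟫_ℂ := by
  rw [bcalc_eq hφ.star (E.represents_bcalc hφ).star, ContinuousLinearMap.star_eq_adjoint,
    ContinuousLinearMap.adjoint_inner_right]

theorem inner_bcalc_left_of_real {φ : α → ℂ} (hφ : BddMeas φ) (hr : star φ = φ) (u v : H) :
    ⟪E.bcalc φ u, v⟫_ℂ = ⟪u, E.bcalc φ v⟫_ℂ := by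
  rw [inner_bcalc_left hφ, hr]

theorem bcalc_mul {φ ψ : α → ℂ} (hφ : BddMeas φ) (hψ : BddMeas ψ) :
    E.bcalc (φ * ψ) = E.bcalc φ * E.bcalc ψ := by
  refine bcalc_eq (hφ.mul hψ) (Represents.mul_of_generatesBddMeas generatesBddMeas_indicator
    ?_ ?_ ?_ hφ hψ (E.represents_bcalc hφ) (E.represents_bcalc hψ))
  · rintro _ ⟨ω, hω, rfl⟩
    exact BddMeas.indicator_one hω
  · rintro _ ⟨ω, -, rfl⟩
    ext x
    by_cases hx : x ∈ ω <;> simp [hx]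
  · rintro _ ⟨ω₁, h₁, rfl⟩ _ ⟨ω₂, h₂, rfl⟩
    refine ⟨_, _, E.represents_indicator h₁, E.represents_indicator h₂, ?_⟩
    rw [← Set.inter_indicator_one, ← E.inter _ _ h₁ h₂]
    exact E.represents_indicator (h₁.inter h₂)

theorem bcalc_bcalc {φ ψ : α → ℂ} (hφ : BddMeas φ) (hψ : BddMeas ψ) (u : H) :
    E.bcalc φ (E.bcalc ψ u) = E.bcalc (φ * ψ) u := by
  rw [bcalc_mul hφ hψ, mul_apply_eq_comp]

theorem norm_sq_bcalc {φ : α → ℂ} (hφ : BddMeas φ) (u : H) :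
    ‖E.bcalc φ u‖ ^ 2 = ∫ s, ‖φ s‖ ^ 2 ∂(E.diag u) := by
  have hnorm : ∀ s, (star φ * φ) s = ((‖φ s‖ ^ 2 : ℝ) : ℂ) := fun s => by
    simp [Complex.conj_mul']
  have h : ⟪E.bcalc φ u, E.bcalc φ u⟫_ℂ = ∫ s, (star φ * φ) s ∂(E.diag u) := by
    rw [inner_bcalc_left hφ, bcalc_bcalc hφ.star hφ, inner_bcalc_self (hφ.star.mul hφ)]
  simp only [hnorm] at h
  rw [inner_self_eq_norm_sq_to_K, integral_complex_ofReal] at h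
  exact Complex.ofReal_injective (by simpa using h)

theorem norm_bcalc_le_norm_bcalc {φ ψ : α → ℂ} (hφ : BddMeas φ) (hψ : BddMeas ψ) (u : H)
    (h : ∀ᵐ s ∂(E.diag u), ‖φ s‖ ≤ ‖ψ s‖) : ‖E.bcalc φ u‖ ≤ ‖E.bcalc ψ u‖ := by
  have hint : Integrable (fun s => ‖ψ s‖ ^ 2) (E.diag u) := by
    obtain ⟨hψm, C, hC⟩ := hψ
    refine Integrable.of_bound (by fun_prop) (C ^ 2) (Eventually.of_forall fun s => ?_)
    rw [norm_pow, norm_norm]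
    exact pow_le_pow_left₀ (norm_nonneg _) (hC s) 2
  refine le_of_sq_le_sq ?_ (norm_nonneg _)
  rw [norm_sq_bcalc hφ, norm_sq_bcalc hψ]
  refine integral_mono_of_nonneg (Eventually.of_forall fun s => by positivity) hint ?_
  filter_upwards [h] with s hs using pow_le_pow_left₀ (norm_nonneg _) hs 2

theorem norm_bcalc_le {φ : α → ℂ} (hφ : Measurable φ) {C : ℝ} (hC0 : 0 ≤ C)
    (hC : ∀ s, ‖φ s‖ ≤ C) (u : H) : ‖E.bcalc φ u‖ ≤ C * ‖u‖ := by
  have hconst : E.bcalc (fun _ => (C : ℂ)) = (C : ℂ) • 1 := by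
    refine bcalc_eq (BddMeas.const _) fun w => ?_
    simp [E.diag_real_univ, inner_self_eq_norm_sq_to_K, mul_comm]
  have h := norm_bcalc_le_norm_bcalc (E := E) ⟨hφ, C, hC⟩ (BddMeas.const (C : ℂ)) u
    (Eventually.of_forall fun s => by simpa [abs_of_nonneg hC0] using hC s)
  simpa [hconst, norm_smul, abs_of_nonneg hC0] using h

theorem bcalc_congr_ae {φ ψ : α → ℂ} (hφ : BddMeas φ) (hψ : BddMeas ψ)
    (h : ∀ u, φ =ᵐ[E.diag u] ψ) : E.bcalc φ = E.bcalc ψ :=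
  bcalc_eq hφ fun u => by rw [inner_bcalc_self hψ, integral_congr_ae (h u)]

theorem norm_toFun_le (ω : Set α) (u : H) : ‖E.toFun ω u‖ ≤ ‖u‖ := by
  by_cases hω : MeasurableSet ω
  · rw [← bcalc_indicator_one hω]
    simpa using norm_bcalc_le (E := E) (BddMeas.indicator_one hω).1 zero_le_one
      (norm_indicator_one_le ω) u
  · simp [E.not_measurable ω hω]

theorem toFun_comm_bcalc {ω : Set α} (hω : MeasurableSet ω) {φ : α → ℂ} (hφ : BddMeas φ) (u : H) :
    E.toFun ω (E.bcalc φ u) = E.bcalc φ (E.toFun ω u) := by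
  rw [← bcalc_indicator_one hω, bcalc_bcalc (BddMeas.indicator_one hω) hφ,
    bcalc_bcalc hφ (BddMeas.indicator_one hω), mul_comm]

theorem toFun_bcalc_indicator {φ : α → ℂ} {ω₁ ω₂ : Set α} (h₁ : MeasurableSet ω₁)
    (h₂ : BddMeas (ω₂.indicator φ)) (h : ω₁ ⊆ ω₂) (u : H) :
    E.toFun ω₁ (E.bcalc (ω₂.indicator φ) u) = E.bcalc (ω₁.indicator φ) u := by
  rw [← bcalc_indicator_one h₁, bcalc_bcalc (BddMeas.indicator_one h₁) h₂]
  congr 2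
  ext x
  by_cases hx : x ∈ ω₁
  · simp [hx, h hx]
  · simp [hx]

theorem bcalc_indicator_toFun {φ : α → ℂ} {ω₁ ω₂ : Set α} (h₁ : MeasurableSet ω₁)
    (h₂ : BddMeas (ω₂.indicator φ)) (h : ω₁ ⊆ ω₂) (u : H) :
    E.bcalc (ω₂.indicator φ) (E.toFun ω₁ u) = E.bcalc (ω₁.indicator φ) u := by
  rw [← toFun_comm_bcalc h₁ h₂, toFun_bcalc_indicator h₁ h₂ h]

theorem toFun_bcalc_indicator_comm {φ : α → ℂ} {ω₁ ω₂ : Set α} (hω₁ : MeasurableSet ω₁)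
    (hω₂ : MeasurableSet ω₂) (h₁ : BddMeas (ω₁.indicator φ)) (h₂ : BddMeas (ω₂.indicator φ))
    (u : H) :
    E.toFun ω₁ (E.bcalc (ω₂.indicator φ) u) = E.bcalc (ω₁.indicator φ) (E.toFun ω₂ u) := by
  rw [← bcalc_indicator_one hω₁, ← bcalc_indicator_one hω₂,
    bcalc_bcalc (BddMeas.indicator_one hω₁) h₂, bcalc_bcalc h₁ (BddMeas.indicator_one hω₂)]
  congr 2
  ext x
  by_cases hx : x ∈ ω₁ <;> by_cases hx' : x ∈ ω₂ <;> simp [hx, hx']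

theorem norm_sub_toFun_sq {ω : Set α} (hω : MeasurableSet ω) (u : H) :
    ‖u - E.toFun ω u‖ ^ 2 = ‖u‖ ^ 2 - ‖E.toFun ω u‖ ^ 2 := by
  rw [@norm_sub_sq ℂ, E.inner_toFun_self hω, RCLike.re_to_complex, Complex.ofReal_re]
  ring

theorem ofReal_norm_sq_bcalc {ψ : α → ℂ} (hψ : BddMeas ψ) (u : H) :
    ENNReal.ofReal (‖E.bcalc ψ u‖ ^ 2) = ∫⁻ s, ‖ψ s‖ₑ ^ 2 ∂(E.diag u) := by
  have hint : Integrable (fun s => ‖ψ s‖ ^ 2) (E.diag u) :=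
    ((hψ.mul hψ).integrable _).norm.congr (Eventually.of_forall fun s => by simp [sq])
  rw [norm_sq_bcalc hψ, ofReal_integral_eq_lintegral_ofReal hint
    (Eventually.of_forall fun s => by positivity)]
  refine lintegral_congr fun s => ?_
  rw [ENNReal.ofReal_pow (norm_nonneg _), ofReal_norm]

end SpectralMeasure

/-! ### Integration of unbounded functions against a spectral measure -/

section Exhaustion

variable {α : Type*} [MeasurableSpace α] {ω : ℕ → Set α}

/-- An increasing sequence of measurable sets that exhausts the space. -/
structure IsExhaustion (ω : ℕ → Set α) : Prop where
  measurableSet : ∀ n, MeasurableSet (ω n)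
  mono : Monotone ω
  iUnion : ⋃ n, ω n = Set.univ

/-- An exhaustion by sets on each of which the measurable function `φ` is bounded. It serves to
approximate `∫ φ dE` by the bounded operators `∫ 1_{ω n} φ dE`. -/
structure BddExhaustion (φ : α → ℂ) (ω : ℕ → Set α) : Prop extends IsExhaustion ω where
  measurable : Measurable φ
  bdd : ∀ n, ∃ C : ℝ, ∀ x ∈ ω n, ‖φ x‖ ≤ C

theorem BddExhaustion.bddMeas {φ : α → ℂ} (h : BddExhaustion φ ω) (n : ℕ) :
    BddMeas ((ω n).indicator φ) :=
  BddMeas.indicator h.measurable (h.measurableSet n) (h.bdd n).choose_spec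

theorem isExhaustion_sublevel {g : α → ℝ} (hg : Measurable g) :
    IsExhaustion fun n : ℕ => {x | g x ≤ n} where
  measurableSet _ := measurableSet_le hg measurable_const
  mono _ _ hnm _ hx := le_trans (Set.mem_ofPred.1 hx) (Nat.cast_le.2 hnm)
  iUnion := Set.eq_univ_of_forall fun x => Set.mem_iUnion.2 (exists_nat_ge (g x))

theorem IsExhaustion.inter {ω' : ℕ → Set α} (h : IsExhaustion ω) (h' : IsExhaustion ω') :
    IsExhaustion fun n => ω n ∩ ω' n where
  measurableSet n := (h.measurableSet n).inter (h'.measurableSet n)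
  mono := h.mono.inter h'.mono
  iUnion := by
    rw [Set.iUnion_inter_of_monotone h.mono h'.mono, h.iUnion, h'.iUnion, Set.inter_univ]

theorem bddExhaustion_norm_le {φ : α → ℂ} (hφ : Measurable φ) :
    BddExhaustion φ fun n : ℕ => {x | ‖φ x‖ ≤ n} where
  toIsExhaustion := isExhaustion_sublevel hφ.norm
  measurable := hφ
  bdd n := ⟨n, fun _ h => h⟩

theorem IsExhaustion.tendsto_indicator (h : IsExhaustion ω) (φ : α → ℂ) (s : α) :
    Tendsto (fun n => (ω n).indicator φ s) atTop (𝓝 (φ s)) := by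
  have hlim := h.mono.tendsto_indicator ω φ s
  rw [h.iUnion, Set.indicator_univ] at hlim
  exact hlim.mono_right (pure_le_nhds _)

theorem integrable_of_lintegral_sq {φ : α → ℂ} {μ : Measure α} [IsFiniteMeasure μ]
    (hφ : Measurable φ) (h : ∫⁻ s, ‖φ s‖ₑ ^ 2 ∂μ < ∞) : Integrable φ μ := by
  have hL2 : MemLp φ 2 μ := ⟨hφ.aestronglyMeasurable,
    (eLpNorm_lt_top_iff_lintegral_rpow_enorm_lt_top two_ne_zero ENNReal.ofNat_ne_top).2 (by
      simpa using h)⟩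
  exact hL2.integrable one_le_two

end Exhaustion

namespace SpectralMeasure

variable {α : Type*} [MeasurableSpace α]
  {H : Type*} [NormedAddCommGroup H] [InnerProductSpace ℂ H] [CompleteSpace H]
  {E : SpectralMeasure α H} {φ : α → ℂ} {ω : ℕ → Set α}

theorem tendsto_toFun (h : IsExhaustion ω) (u : H) :
    Tendsto (fun n => E.toFun (ω n) u) atTop (𝓝 u) := by
  have hmeas : Tendsto (fun n => (E.diag u).real (ω n)) atTop (𝓝 ((E.diag u).real Set.univ)) := by
    rw [← h.iUnion]
    exact (ENNReal.tendsto_toReal (measure_ne_top _ _)).comp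
      (tendsto_measure_iUnion_atTop h.mono)
  rw [tendsto_iff_norm_sub_tendsto_zero]
  have hsq : Tendsto (fun n => ‖E.toFun (ω n) u - u‖ ^ 2) atTop (𝓝 0) := by
    rw [← sub_self (‖u‖ ^ 2)]
    simpa only [norm_sub_rev _ u, norm_sub_toFun_sq (h.measurableSet _), E.diag_real_univ,
      E.diag_real u (h.measurableSet _)] using hmeas.const_sub (‖u‖ ^ 2)
  simpa using hsq.sqrt

theorem eq_of_toFun_eq (h : IsExhaustion ω) {u v : H}
    (huv : ∀ n, E.toFun (ω n) u = E.toFun (ω n) v) : u = v :=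
  tendsto_nhds_unique (tendsto_toFun h u) ((tendsto_toFun h v).congr fun n => (huv n).symm)

theorem setLIntegral_eq_bcalc (h : BddExhaustion φ ω) (n : ℕ) (u : H) :
    ∫⁻ s in ω n, ‖φ s‖ₑ ^ 2 ∂(E.diag u) = ENNReal.ofReal (‖E.bcalc ((ω n).indicator φ) u‖ ^ 2) := by
  rw [ofReal_norm_sq_bcalc (h.bddMeas n), ← lintegral_indicator (h.measurableSet n)]
  refine lintegral_congr fun s => ?_
  by_cases hs : s ∈ ω n <;> simp [hs]

theorem lintegral_eq_iSup (h : BddExhaustion φ ω) (u : H) :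
    ∫⁻ s, ‖φ s‖ₑ ^ 2 ∂(E.diag u) =
      ⨆ n, ENNReal.ofReal (‖E.bcalc ((ω n).indicator φ) u‖ ^ 2) := by
  rw [← setLIntegral_univ, ← h.iUnion, setLIntegral_iUnion_of_directed _ h.mono.directed_le]
  simp only [setLIntegral_eq_bcalc h]

-- By Pythagoras, `‖y m - y n‖² = ‖y m‖² - ‖y n‖²`, so the sequence is Cauchy.
theorem exists_forall_toFun_eq_of_bounded (hω : ∀ n, MeasurableSet (ω n)) {y : ℕ → H}
    (hy : ∀ n m, n ≤ m → E.toFun (ω n) (y m) = y n)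
    (hbdd : BddAbove (Set.range fun n => ‖y n‖ ^ 2)) : ∃ z, ∀ n, E.toFun (ω n) z = y n := by
  have hsub : ∀ n m, n ≤ m → ‖y m - y n‖ ^ 2 = ‖y m‖ ^ 2 - ‖y n‖ ^ 2 := fun n m hnm => by
    rw [← hy n m hnm, norm_sub_toFun_sq (hω n)]
  have hmono : Monotone fun n => ‖y n‖ ^ 2 := fun n m hnm =>
    sub_nonneg.1 (hsub n m hnm ▸ sq_nonneg _)
  have hcauchy : CauchySeq y := by
    have hc := (tendsto_atTop_ciSup hmono hbdd).cauchySeq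
    rw [Metric.cauchySeq_iff'] at hc ⊢
    intro ε hε
    obtain ⟨N, hN⟩ := hc (ε ^ 2) (by positivity)
    refine ⟨N, fun n hn => lt_of_pow_lt_pow_left₀ 2 hε.le ?_⟩
    have hdist := hN n hn
    rwa [Real.dist_eq, ← hsub N n hn, abs_of_nonneg (by positivity), ← dist_eq_norm] at hdist
  obtain ⟨z, hz⟩ := cauchySeq_tendsto_of_complete hcauchy
  refine ⟨z, fun n => tendsto_nhds_unique (((E.toFun (ω n)).continuous.tendsto z).comp hz)
    (tendsto_const_nhds.congr' ?_)⟩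
  filter_upwards [eventually_ge_atTop n] with m hm using (hy n m hm).symm

theorem exists_forall_toFun_eq_iff (h : BddExhaustion φ ω) (u : H) :
    (∃ y, ∀ n, E.toFun (ω n) y = E.bcalc ((ω n).indicator φ) u) ↔
      ∫⁻ s, ‖φ s‖ₑ ^ 2 ∂(E.diag u) < ∞ := by
  rw [lintegral_eq_iSup h]
  constructor
  · rintro ⟨y, hy⟩
    refine lt_of_le_of_lt (iSup_le fun n => ?_) (ENNReal.ofReal_lt_top (r := ‖y‖ ^ 2))
    rw [← hy n]
    exact ENNReal.ofReal_le_ofReal (pow_le_pow_left₀ (norm_nonneg _) (norm_toFun_le _ _) 2)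
  · intro hlt
    refine exists_forall_toFun_eq_of_bounded h.measurableSet (fun n m hnm =>
      toFun_bcalc_indicator (h.measurableSet n) (h.bddMeas m) (h.mono hnm) u)
      ⟨(⨆ n, ENNReal.ofReal (‖E.bcalc ((ω n).indicator φ) u‖ ^ 2)).toReal, ?_⟩
    rintro _ ⟨n, rfl⟩
    exact (ENNReal.ofReal_le_iff_le_toReal hlt.ne).1
      (le_iSup (fun n => ENNReal.ofReal (‖E.bcalc ((ω n).indicator φ) u‖ ^ 2)) n)

/-- The graph of `∫ φ dE`, described through the truncations of `φ` to an exhaustion. -/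
def integralGraph (E : SpectralMeasure α H) (φ : α → ℂ) (ω : ℕ → Set α) :
    Submodule ℂ (H × H) where
  carrier := {p | ∀ n, E.toFun (ω n) p.2 = E.bcalc ((ω n).indicator φ) p.1}
  add_mem' := by
    intro a b ha hb n
    simp [ha n, hb n]
  zero_mem' := by simp
  smul_mem' := by
    intro c a ha n
    simp [ha n]

theorem inner_eq_integral_of_mem_integralGraph (h : BddExhaustion φ ω) {u y : H}
    (hy : (u, y) ∈ E.integralGraph φ ω) : ⟪u, y⟫_ℂ = ∫ s, φ s ∂(E.diag u) := by
  have hint : Integrable φ (E.diag u) :=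
    integrable_of_lintegral_sq h.measurable ((exists_forall_toFun_eq_iff h u).1 ⟨y, hy⟩)
  have hinner : Tendsto (fun n => ⟪u, E.toFun (ω n) y⟫_ℂ) atTop (𝓝 ⟪u, y⟫_ℂ) :=
    tendsto_const_nhds.inner (tendsto_toFun h.toIsExhaustion y)
  refine tendsto_nhds_unique hinner ?_
  have htrunc : ∀ n, ⟪u, E.toFun (ω n) y⟫_ℂ = ∫ s, (ω n).indicator φ s ∂(E.diag u) := fun n => by
    rw [← inner_bcalc_self (h.bddMeas n), hy n]
  simp only [htrunc]
  exact tendsto_integral_of_dominated_convergence (fun s => ‖φ s‖)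
    (fun n => (h.bddMeas n).1.aestronglyMeasurable) hint.norm
    (fun n => Eventually.of_forall fun s => norm_indicator_le_norm_self _ _)
    (Eventually.of_forall (h.tendsto_indicator φ))

theorem exists_isIntegral_graph (h : BddExhaustion φ ω) :
    ∃ T, E.IsIntegral φ T ∧ T.graph = E.integralGraph φ ω := by
  have hsingle : ∀ x ∈ E.integralGraph φ ω, x.1 = 0 → x.2 = 0 := by
    intro x hx h0
    refine eq_of_toFun_eq (E := E) h.toIsExhaustion fun n => ?_
    rw [hx n, h0, map_zero, map_zero]
  have hgraph := Submodule.toLinearPMap_graph_eq _ hsingle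
  refine ⟨(E.integralGraph φ ω).toLinearPMap, ⟨fun u => ?_, fun u => ?_⟩, hgraph⟩
  · rw [← exists_forall_toFun_eq_iff h, LinearPMap.mem_domain_iff, hgraph]
    rfl
  · exact inner_eq_integral_of_mem_integralGraph h (hgraph.le (LinearPMap.mem_graph _ u))

theorem isIntegral_integral (hφ : Measurable φ) : E.IsIntegral φ (E.integral φ) :=
  Classical.epsilon_spec
    ((exists_isIntegral_graph (E := E) (bddExhaustion_norm_le hφ)).imp fun _ h => h.1)

namespace IsIntegral

variable {T : H →ₗ.[ℂ] H}

theorem toFun_mem_domain (h : BddExhaustion φ ω) (hT : E.IsIntegral φ T) (n : ℕ) (u : H) :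
    E.toFun (ω n) u ∈ T.domain := by
  rw [hT.1, ← exists_forall_toFun_eq_iff h]
  exact ⟨E.bcalc ((ω n).indicator φ) u, fun m => toFun_bcalc_indicator_comm (h.measurableSet m)
    (h.measurableSet n) (h.bddMeas m) (h.bddMeas n) u⟩

theorem dense_domain (h : BddExhaustion φ ω) (hT : E.IsIntegral φ T) :
    Dense (T.domain : Set H) := fun u =>
  mem_closure_of_tendsto (tendsto_toFun (E := E) h.toIsExhaustion u)
    (Eventually.of_forall fun n => hT.toFun_mem_domain h n u)

theorem unique (hφ : Measurable φ) {S : H →ₗ.[ℂ] H} (hS : E.IsIntegral φ S)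
    (hT : E.IsIntegral φ T) : S = T := by
  have hdense := hS.dense_domain (bddExhaustion_norm_le hφ)
  obtain ⟨D, S⟩ := S
  obtain ⟨D', T⟩ := T
  obtain rfl : D = D' := Submodule.ext fun u => (hS.1 u).trans (hT.1 u).symm
  have hdiag : ∀ u : D, ⟪(u : H), (S - T) u⟫_ℂ = 0 := fun u => by
    rw [LinearMap.sub_apply, inner_sub_right, sub_eq_zero]
    exact (hS.2 u).trans (hT.2 u).symm
  congr
  ext u
  exact sub_eq_zero.1 (hdense.eq_zero_of_inner_right ℂ fun v hv =>
    inner_eq_zero_of_inner_self_eq_zero hdiag u ⟨v, hv⟩)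

theorem mem_graph_iff (h : BddExhaustion φ ω) (hT : E.IsIntegral φ T) {u y : H} :
    (u, y) ∈ T.graph ↔ ∀ n, E.toFun (ω n) y = E.bcalc ((ω n).indicator φ) u := by
  obtain ⟨S, hS, hg⟩ := exists_isIntegral_graph (E := E) h
  rw [hT.unique h.measurable hS, hg]
  rfl

theorem mem_graph_iff_of_inv (hφ : Measurable φ) (hT : E.IsIntegral φ T) {ψ : α → ℂ}
    (hψ : BddMeas ψ) (hinv : ∀ s, ψ s * φ s = 1) {u y : H} :
    (u, y) ∈ T.graph ↔ E.bcalc ψ y = u := by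
  have h := bddExhaustion_norm_le hφ
  have hmul : ∀ n : ℕ, ψ * {x | ‖φ x‖ ≤ n}.indicator φ = {x | ‖φ x‖ ≤ n}.indicator 1 := by
    intro n
    ext s
    by_cases hs : ‖φ s‖ ≤ n <;> simp [hs, hinv]
  rw [hT.mem_graph_iff h]
  constructor
  · intro hy
    refine eq_of_toFun_eq (E := E) h.toIsExhaustion fun n => ?_
    rw [toFun_comm_bcalc (h.measurableSet n) hψ, hy n, bcalc_bcalc hψ (h.bddMeas n), hmul,
      bcalc_indicator_one (h.measurableSet n)]
  · rintro rfl n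
    rw [bcalc_bcalc (h.bddMeas n) hψ, mul_comm, hmul, bcalc_indicator_one (h.measurableSet n)]

theorem toFun_apply (h : BddExhaustion φ ω) (hT : E.IsIntegral φ T) (u : T.domain) (n : ℕ) :
    E.toFun (ω n) (T u) = E.bcalc ((ω n).indicator φ) u :=
  (hT.mem_graph_iff h).1 (T.mem_graph u) n

theorem apply_toFun (h : BddExhaustion φ ω) (hT : E.IsIntegral φ T) (n : ℕ) (u : H) :
    T ⟨E.toFun (ω n) u, hT.toFun_mem_domain h n u⟩ = E.bcalc ((ω n).indicator φ) u :=
  T.mem_graph_snd_inj (T.mem_graph _) ((hT.mem_graph_iff h).2 fun m =>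
    toFun_bcalc_indicator_comm (h.measurableSet m) (h.measurableSet n) (h.bddMeas m)
      (h.bddMeas n) u) rfl

end IsIntegral

end SpectralMeasure

/-! ### Resolvent set of a selfadjoint operator -/

section Resolvent

variable {H : Type*} [NormedAddCommGroup H] [InnerProductSpace ℂ H]
  {A : H →ₗ.[ℂ] H}

/-- The operator `A - ξ` as a linear map on the domain of `A`. -/
def subSMul (A : H →ₗ.[ℂ] H) (ξ : ℂ) : A.domain →ₗ[ℂ] H := A.toFun - ξ • A.domain.subtype

theorem subSMul_apply (ξ : ℂ) (u : A.domain) : subSMul A ξ u = A u - ξ • (u : H) := rfl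

theorem mul_norm_le_norm_subSMul {c : ℝ}
    (hc : ∀ u : A.domain, c * ‖(u : H)‖ ^ 2 ≤ (⟪(u : H), A u⟫_ℂ).re) (s : ℝ) (u : A.domain) :
    (c - s) * ‖(u : H)‖ ≤ ‖subSMul A s u‖ := by
  rcases eq_or_ne (u : H) 0 with h0 | h0
  · simp [h0]
  refine le_of_mul_le_mul_left ?_ (norm_pos_iff.2 h0)
  have hre : (⟪(u : H), subSMul A s u⟫_ℂ).re = (⟪(u : H), A u⟫_ℂ).re - s * ‖(u : H)‖ ^ 2 := by
    rw [subSMul_apply, inner_sub_right, inner_smul_right, inner_self_eq_norm_sq_to_K,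
      Complex.sub_re, Complex.re_ofReal_mul]
    norm_cast
  calc ‖(u : H)‖ * ((c - s) * ‖(u : H)‖) = c * ‖(u : H)‖ ^ 2 - s * ‖(u : H)‖ ^ 2 := by ring
    _ ≤ (⟪(u : H), subSMul A s u⟫_ℂ).re := by linarith [hc u]
    _ ≤ ‖(u : H)‖ * ‖subSMul A s u‖ := re_inner_le_norm (𝕜 := ℂ) _ _

/-- `B` is the everywhere defined inverse of `A`. -/
def IsBoundedInverse (A : H →ₗ.[ℂ] H) (B : H →L[ℂ] H) : Prop :=
  ∀ u y, (u, y) ∈ A.graph ↔ B y = u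

theorem IsBoundedInverse.exists_apply_eq {B : H →L[ℂ] H} (hB : IsBoundedInverse A B) (y : H) :
    ∃ u : A.domain, (u : H) = B y ∧ A u = y :=
  A.mem_graph_iff.1 ((hB (B y) y).2 rfl)

theorem IsBoundedInverse.apply_apply {B : H →L[ℂ] H} (hB : IsBoundedInverse A B) (u : A.domain) :
    B (A u) = u :=
  (hB u (A u)).1 (A.mem_graph u)

variable [CompleteSpace H]

theorem inner_apply_left (hA : IsSelfAdjoint A) (u v : A.domain) :
    ⟪A u, (v : H)⟫_ℂ = ⟪(u : H), A v⟫_ℂ := by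
  have h := LinearPMap.adjoint_isFormalAdjoint hA.dense_domain
  rw [LinearPMap.isSelfAdjoint_def.1 hA] at h
  exact h u v

theorem mem_graph_of_forall_inner (hA : IsSelfAdjoint A) {y z : H}
    (h : ∀ u : A.domain, ⟪z, (u : H)⟫_ℂ = ⟪y, A u⟫_ℂ) : (y, z) ∈ A.graph := by
  have hy : y ∈ A.adjoint.domain := LinearPMap.mem_adjoint_domain_of_exists y ⟨z, h⟩
  have he := LinearPMap.adjoint_apply_eq hA.dense_domain ⟨y, hy⟩ h
  have hm : (y, z) ∈ A.adjoint.graph := he ▸ A.adjoint.mem_graph ⟨y, hy⟩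
  rwa [LinearPMap.isSelfAdjoint_def.1 hA] at hm

theorem isClosed_range_subSMul (hA : A.IsClosed) {ξ : ℂ} {δ : ℝ} (hδ : 0 < δ)
    (hbelow : ∀ u : A.domain, δ * ‖(u : H)‖ ≤ ‖subSMul A ξ u‖) :
    IsClosed (LinearMap.range (subSMul A ξ) : Set H) := by
  refine IsSeqClosed.isClosed fun y z hy hz => ?_
  choose u hu using fun n => LinearMap.mem_range.1 (hy n)
  have hcauchy : CauchySeq fun n => (u n : H) := by
    have hcy := hz.cauchySeq
    rw [Metric.cauchySeq_iff'] at hcy ⊢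
    intro ε hε
    obtain ⟨N, hN⟩ := hcy (δ * ε) (by positivity)
    refine ⟨N, fun n hn => lt_of_mul_lt_mul_left ?_ hδ.le⟩
    have h := hbelow (u n - u N)
    rw [map_sub, hu, hu, ← dist_eq_norm] at h
    rw [dist_eq_norm]
    exact h.trans_lt (hN n hn)
  obtain ⟨w, hw⟩ := cauchySeq_tendsto_of_complete hcauchy
  have hAu : Tendsto (fun n => A (u n)) atTop (𝓝 (z + ξ • w)) :=
    (hz.add (hw.const_smul ξ)).congr fun n => by rw [← hu n, subSMul_apply, sub_add_cancel]
  have hgraph : (w, z + ξ • w) ∈ A.graph :=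
    hA.mem_of_tendsto (hw.prodMk_nhds hAu) (Eventually.of_forall fun n => A.mem_graph (u n))
  obtain ⟨x, hx, hAx⟩ := A.mem_graph_iff.1 hgraph
  exact ⟨x, by rw [subSMul_apply, hAx, hx, add_sub_cancel_right]⟩

theorem range_subSMul_eq_top (hA : IsSelfAdjoint A) {s δ : ℝ} (hδ : 0 < δ)
    (hbelow : ∀ u : A.domain, δ * ‖(u : H)‖ ≤ ‖subSMul A s u‖) :
    LinearMap.range (subSMul A s) = ⊤ := by
  have : CompleteSpace (LinearMap.range (subSMul A s)) :=
    (isClosed_range_subSMul hA.isClosed hδ hbelow).completeSpace_coe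
  rw [← Submodule.orthogonal_eq_bot_iff, Submodule.eq_bot_iff]
  intro y hy
  have heigen : ∀ u : A.domain, ⟪(s : ℂ) • y, (u : H)⟫_ℂ = ⟪y, A u⟫_ℂ := by
    intro u
    have h := (Submodule.mem_orthogonal' _ _).1 hy (subSMul A s u) ⟨u, rfl⟩
    rw [subSMul_apply, inner_sub_right, inner_smul_right, sub_eq_zero] at h
    rw [h, inner_smul_left, Complex.conj_ofReal]
  obtain ⟨x, hx, hAx⟩ := A.mem_graph_iff.1 (mem_graph_of_forall_inner hA heigen)
  have h := hbelow x
  rw [subSMul_apply, hAx, hx, sub_self, norm_zero] at h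
  exact norm_le_zero_iff.1 (nonpos_of_mul_nonpos_right h hδ)

theorem mem_resolventSet_of_mul_norm_le (hA : IsSelfAdjoint A) {s δ : ℝ} (hδ : 0 < δ)
    (hbelow : ∀ u : A.domain, δ * ‖(u : H)‖ ≤ ‖subSMul A s u‖) : (s : ℂ) ∈ resolventSet A := by
  have hnorm : ∀ u : A.domain, ‖(u : H)‖ ≤ δ⁻¹ * ‖subSMul A s u‖ := fun u => by
    rw [inv_mul_eq_div, le_div_iff₀' hδ]
    exact hbelow u
  refine ⟨⟨?_, LinearMap.range_eq_top.1 (range_subSMul_eq_top hA hδ hbelow)⟩, δ⁻¹, hnorm⟩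
  refine (injective_iff_map_eq_zero (subSMul A s)).2 fun u hu => Subtype.ext ?_
  simpa [hu] using hnorm u

theorem mem_resolventSet_of_lt (hA : IsSelfAdjoint A) {c : ℝ}
    (hc : ∀ u : A.domain, c * ‖(u : H)‖ ^ 2 ≤ (⟪(u : H), A u⟫_ℂ).re) {s : ℝ} (hs : s < c) :
    (s : ℂ) ∈ resolventSet A :=
  mem_resolventSet_of_mul_norm_le hA (sub_pos.2 hs) (mul_norm_le_norm_subSMul hc s)

theorem le_of_mem_spec (hA : IsSelfAdjoint A) {c : ℝ}
    (hc : ∀ u : A.domain, c * ‖(u : H)‖ ^ 2 ≤ (⟪(u : H), A u⟫_ℂ).re) (s : spec A) :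
    c ≤ s := by
  by_contra! h
  exact s.2 (mem_resolventSet_of_lt hA hc h)

theorem exists_isBoundedInverse (hA : IsSelfAdjoint A) (h0 : (0 : ℂ) ∈ resolventSet A) :
    ∃ B : H →L[ℂ] H, IsSelfAdjoint B ∧ IsBoundedInverse A B := by
  obtain ⟨hbij, C, hC⟩ := h0
  simp only [zero_smul, sub_zero] at hbij hC
  let e : A.domain ≃ₗ[ℂ] H := LinearEquiv.ofBijective A.toFun hbij
  have he : ∀ y, A (e.symm y) = y := e.apply_symm_apply
  let B : H →L[ℂ] H := (A.domain.subtype ∘ₗ (e.symm : H →ₗ[ℂ] A.domain)).mkContinuous C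
    fun y => by simpa only [he] using! hC (e.symm y)
  refine ⟨B, ?_, fun u y => ?_⟩
  · rw [ContinuousLinearMap.isSelfAdjoint_iff_isSymmetric]
    intro x y
    have h := inner_apply_left hA (e.symm x) (e.symm y)
    rw [he, he] at h
    exact h.symm
  · rw [A.mem_graph_iff]
    constructor
    · rintro ⟨x, rfl, rfl⟩
      exact congrArg Subtype.val (e.symm_apply_apply x)
    · exact fun h => ⟨e.symm y, h, he y⟩

-- `r - B = r (A - r⁻¹) B`, so `r - B` is bijective as soon as `A - r⁻¹` is.
theorem IsBoundedInverse.inv_mem_spec {B : H →L[ℂ] H} (hB : IsBoundedInverse A B) {r : ℝ}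
    (hr : r ∈ spectrum ℝ B) (hr0 : r ≠ 0) : r⁻¹ ∈ spec A := by
  rintro ⟨hbij, -⟩
  refine hr ?_
  rw [spectrum.mem_resolventSet_iff, ContinuousLinearMap.isUnit_iff_bijective]
  have hr' : (r : ℂ) ≠ 0 := by exact_mod_cast hr0
  have hfactor : ∀ u : A.domain, (algebraMap ℝ (H →L[ℂ] H) r - B) (A u) =
      (r : ℂ) • (A u - ((r⁻¹ : ℝ) : ℂ) • (u : H)) := by
    intro u
    rw [smul_sub, smul_smul, Complex.ofReal_inv, mul_inv_cancel₀ hr', one_smul]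
    simp [Algebra.algebraMap_eq_smul_one, hB.apply_apply]
  constructor
  · refine (injective_iff_map_eq_zero _).2 fun y hy => ?_
    obtain ⟨u, -, rfl⟩ := hB.exists_apply_eq y
    rw [hfactor, smul_eq_zero, or_iff_right hr'] at hy
    rw [hbij.1 (a₁ := u) (a₂ := 0) (hy.trans (by simp)), A.map_zero]
  · intro z
    obtain ⟨u, hu⟩ := hbij.2 ((r : ℂ)⁻¹ • z)
    simp only at hu
    exact ⟨A u, by rw [hfactor, hu, smul_inv_smul₀ hr']⟩

end Resolvent

/-! ### The spectral theorem for bounded selfadjoint operators -/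

section SpectralFamily

variable {X : Type*} [MeasurableSpace X]
  {H : Type*} [NormedAddCommGroup H] [InnerProductSpace ℂ H]

/-- A family `u ↦ μ_u` of measures for which integration of bounded functions is a unital
multiplicative functional calculus. Such families are the diagonals `u ↦ ⟨E u, u⟩` of spectral
measures. -/
structure IsSpectralFamily (μ : H → Measure X) : Prop where
  exists_represents : ∀ {φ}, BddMeas φ → ∃ T, Represents μ φ T
  one : Represents μ 1 1
  mul : ∀ {φ ψ S T}, BddMeas φ → BddMeas ψ → Represents μ φ S → Represents μ ψ T →
    Represents μ (φ * ψ) (S * T)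

namespace IsSpectralFamily

variable {μ : H → Measure X} (hμ : IsSpectralFamily μ)

open Classical in
/-- The operator that represents the indicator function of `ω` (`0` if `ω` is not measurable). -/
def projection (ω : Set X) : H →L[ℂ] H :=
  if h : MeasurableSet ω then (hμ.exists_represents (BddMeas.indicator_one h)).choose else 0

theorem represents_projection {ω : Set X} (hω : MeasurableSet ω) :
    Represents μ (ω.indicator 1) (hμ.projection ω) := by
  rw [projection, dif_pos hω]
  exact (hμ.exists_represents (BddMeas.indicator_one hω)).choose_spec

theorem projection_eq {ω : Set X} (hω : MeasurableSet ω) {T : H →L[ℂ] H}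
    (hT : Represents μ (ω.indicator 1) T) : hμ.projection ω = T :=
  (hμ.represents_projection hω).unique hT

theorem projection_inter {ω₁ ω₂ : Set X} (h₁ : MeasurableSet ω₁) (h₂ : MeasurableSet ω₂) :
    hμ.projection (ω₁ ∩ ω₂) = hμ.projection ω₁ * hμ.projection ω₂ := by
  refine hμ.projection_eq (h₁.inter h₂) ?_
  rw [Set.inter_indicator_one]
  exact hμ.mul (BddMeas.indicator_one h₁) (BddMeas.indicator_one h₂)
    (hμ.represents_projection h₁) (hμ.represents_projection h₂)

theorem hasSum_inner_projection [∀ u, IsFiniteMeasure (μ u)] {ω : ℕ → Set X}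
    (hω : ∀ i, MeasurableSet (ω i)) (hd : Pairwise (Function.onFun Disjoint ω)) (u v : H) :
    HasSum (fun i => ⟪v, hμ.projection (ω i) u⟫_ℂ) ⟪v, hμ.projection (⋃ i, ω i) u⟫_ℂ := by
  have hdiag : ∀ w : H, HasSum (fun i => ⟪w, hμ.projection (ω i) w⟫_ℂ)
      ⟪w, hμ.projection (⋃ i, ω i) w⟫_ℂ := by
    intro w
    simp only [hμ.represents_projection (hω _) w,
      hμ.represents_projection (MeasurableSet.iUnion hω) w, integral_indicator (hω _),
      integral_indicator (MeasurableSet.iUnion hω)]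
    exact hasSum_integral_iUnion hω hd (integrable_const (1 : ℂ)).integrableOn
  rw [inner_polarization (hμ.projection (⋃ i, ω i))]
  simp only [fun i => inner_polarization (hμ.projection (ω i)) u v]
  exact ((((hdiag _).sub (hdiag _)).add ((hdiag _).mul_left _)).sub
    ((hdiag _).mul_left _)).div_const _

variable [CompleteSpace H]

theorem isStarProjection_projection {ω : Set X} (hω : MeasurableSet ω) :
    IsStarProjection (hμ.projection ω) where
  isIdempotentElem := by
    have h := hμ.projection_inter hω hω
    rw [Set.inter_self] at h
    exact h.symm
  isSelfAdjoint := by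
    have hstar : star (ω.indicator (1 : X → ℂ)) = ω.indicator 1 := by
      ext x
      by_cases hx : x ∈ ω <;> simp [hx]
    have h := (hμ.represents_projection hω).star
    rw [hstar] at h
    exact (hμ.projection_eq hω h).symm

/-- The spectral measure with diagonal `μ`. -/
def spectralMeasure [∀ u, IsFiniteMeasure (μ u)] : SpectralMeasure X H where
  toFun := hμ.projection
  not_measurable _ h := dif_neg h
  isStarProjection _ := hμ.isStarProjection_projection
  empty := hμ.projection_eq .empty fun u => by simp
  univ := hμ.projection_eq .univ <| by
    rw [Set.indicator_univ]
    exact hμ.one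
  inter _ _ := hμ.projection_inter
  iUnion _ := hμ.hasSum_inner_projection

theorem diag_spectralMeasure [∀ u, IsFiniteMeasure (μ u)] : hμ.spectralMeasure.diag = μ := by
  ext u ω hω
  rw [SpectralMeasure.diag, Measure.ofMeasurable_apply _ hω]
  simp [spectralMeasure, hμ.represents_projection hω u, integral_indicator hω]

end IsSpectralFamily

end SpectralFamily

section BoundedSelfAdjoint

variable {H : Type*} [NormedAddCommGroup H] [InnerProductSpace ℂ H] [CompleteSpace H]
  {B : H →L[ℂ] H} (hB : IsSelfAdjoint B)

theorem re_inner_cfcHom_nonneg {g : C(spectrum ℝ B, ℝ)} (hg : 0 ≤ g) (u : H) :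
    0 ≤ (⟪u, cfcHom hB g u⟫_ℂ).re :=
  ((ContinuousLinearMap.nonneg_iff_isPositive _).1
    ((cfcHom_nonneg_iff hB).2 hg)).re_inner_nonneg_right u

/-- The positive functional `g ↦ ⟨u, g(B) u⟩` on the continuous functions on `σ(B)`. -/
def cfcFunctional (u : H) : CompactlySupportedContinuousMap (spectrum ℝ B) ℝ →ₚ[ℝ] ℝ :=
  PositiveLinearMap.mk₀
    { toFun := fun g => (⟪u, cfcHom hB (g : C(spectrum ℝ B, ℝ)) u⟫_ℂ).re
      map_add' := fun g g' => by
        change (⟪u, cfcHom hB ((g : C(spectrum ℝ B, ℝ)) + (g' : C(spectrum ℝ B, ℝ))) u⟫_ℂ).re = _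
        simp
      map_smul' := fun c g => by
        change (⟪u, cfcHom hB (c • (g : C(spectrum ℝ B, ℝ))) u⟫_ℂ).re = _
        simp [inner_smul_right_eq_smul] }
    fun _ hg => re_inner_cfcHom_nonneg hB hg u

/-- The measure `⟨E_B u, u⟩`, obtained from the Riesz–Markov theorem. -/
def scalarMeasure (u : H) : Measure (spectrum ℝ B) :=
  RealRMK.rieszMeasure (cfcFunctional hB u)

instance (u : H) : IsFiniteMeasure (scalarMeasure hB u) := by
  unfold scalarMeasure
  infer_instance

theorem represents_cfcHom (g : C(spectrum ℝ B, ℝ)) :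
    Represents (scalarMeasure hB) (fun x => (g x : ℂ)) (cfcHom hB g) := by
  intro u
  have hreal := (cfcHom_predicate hB g).isSymmetric.coe_re_inner_self_apply u
  rw [integral_complex_ofReal]
  refine hreal.symm.trans (congrArg _ ?_)
  exact (RealRMK.integral_rieszMeasure (cfcFunctional hB u)
    (CompactlySupportedContinuousMap.continuousMapEquiv g)).symm

theorem isSpectralFamily_scalarMeasure : IsSpectralFamily (scalarMeasure hB) where
  exists_represents hφ := by
    refine generatesBddMeas_unitContinuous _ Represents.isBoundedlyClosed_exists ?_ _ hφ
    rintro _ ⟨g, -, rfl⟩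
    exact ⟨_, represents_cfcHom hB g⟩
  one := by
    convert represents_cfcHom hB 1 using 1
    · simp [Pi.one_def]
    · rw [map_one]
  mul := by
    refine Represents.mul_of_generatesBddMeas generatesBddMeas_unitContinuous ?_ ?_ ?_
    · rintro _ ⟨g, hg, rfl⟩
      refine ⟨by fun_prop, 1, fun x => ?_⟩
      rw [Complex.norm_real, Real.norm_of_nonneg (hg x).1]
      exact (hg x).2
    · rintro _ ⟨g, -, rfl⟩
      ext x
      simp
    · rintro _ ⟨g, -, rfl⟩ _ ⟨h, -, rfl⟩
      refine ⟨_, _, represents_cfcHom hB g, represents_cfcHom hB h, ?_⟩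
      rw [← map_mul]
      convert represents_cfcHom hB (g * h) using 1
      ext x
      simp

/-- The spectral measure of a bounded selfadjoint operator. -/
def boundedSpectralMeasure : SpectralMeasure (spectrum ℝ B) H :=
  (isSpectralFamily_scalarMeasure hB).spectralMeasure

theorem bddMeas_coe_spectrum (B : H →L[ℂ] H) :
    BddMeas fun r : spectrum ℝ B => ((r : ℝ) : ℂ) := by
  refine ⟨by fun_prop, ‖B‖ * ‖(1 : H →L[ℂ] H)‖, fun r => ?_⟩
  rw [Complex.norm_real]
  exact spectrum.norm_le_norm_mul_of_mem r.2

theorem boundedSpectralMeasure_bcalc_coe :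
    (boundedSpectralMeasure hB).bcalc (fun r => ((r : ℝ) : ℂ)) = B := by
  refine SpectralMeasure.bcalc_eq (bddMeas_coe_spectrum B) ?_
  have h := represents_cfcHom hB ((ContinuousMap.id ℝ).restrict (spectrum ℝ B))
  rw [cfcHom_id] at h
  rw [boundedSpectralMeasure, IsSpectralFamily.diag_spectralMeasure]
  exact h

end BoundedSelfAdjoint

/-! ### The spectral measure of a strictly positive operator -/

namespace SpectralMeasure

variable {α β : Type*} [MeasurableSpace α] [MeasurableSpace β]
  {H : Type*} [NormedAddCommGroup H] [InnerProductSpace ℂ H] [CompleteSpace H]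

open Classical in
/-- The image of a spectral measure under a measurable map. -/
def map (E : SpectralMeasure α H) {g : α → β} (hg : Measurable g) : SpectralMeasure β H where
  toFun ω := if MeasurableSet ω then E.toFun (g ⁻¹' ω) else 0
  not_measurable ω h := if_neg h
  isStarProjection ω h := by
    rw [if_pos h]
    exact E.isStarProjection _ (hg h)
  empty := by simp [E.empty]
  univ := by simp [E.univ]
  inter ω₁ ω₂ h₁ h₂ := by
    rw [if_pos h₁, if_pos h₂, if_pos (h₁.inter h₂), Set.preimage_inter, E.inter _ _ (hg h₁) (hg h₂)]
  iUnion ω hω hd u v := by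
    simp only [if_pos (hω _), if_pos (MeasurableSet.iUnion hω), Set.preimage_iUnion]
    exact E.iUnion _ (fun i => hg (hω i)) (fun i j hij => (hd hij).preimage g) u v

theorem map_toFun (E : SpectralMeasure α H) {g : α → β} (hg : Measurable g) {ω : Set β}
    (hω : MeasurableSet ω) : (E.map hg).toFun ω = E.toFun (g ⁻¹' ω) := if_pos hω

theorem map_diag (E : SpectralMeasure α H) {g : α → β} (hg : Measurable g) (u : H) :
    (E.map hg).diag u = (E.diag u).map g := by
  ext ω hω
  rw [Measure.map_apply hg hω, diag_apply _ _ hω, diag_apply _ _ (hg hω), map_toFun E hg hω]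

theorem map_bcalc (E : SpectralMeasure α H) {g : α → β} (hg : Measurable g) {φ : β → ℂ}
    (hφ : BddMeas φ) : (E.map hg).bcalc φ = E.bcalc (φ ∘ g) := by
  refine bcalc_eq hφ fun u => ?_
  rw [map_diag, integral_map hg.aemeasurable hφ.1.aestronglyMeasurable,
    inner_bcalc_self (hφ.comp hg)]
  rfl

theorem ae_notMem_of_toFun_eq_zero {E : SpectralMeasure α H} {ω : Set α} (hω : MeasurableSet ω)
    {u : H} (h : E.toFun ω u = 0) : ∀ᵐ s ∂(E.diag u), s ∉ ω := by
  rw [← measure_eq_zero_iff_ae_notMem, E.diag_apply u hω, h]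
  simp

theorem ae_ne_zero_of_injective_bcalc {E : SpectralMeasure α H} {φ : α → ℂ} (hφ : BddMeas φ)
    (hinj : Function.Injective (E.bcalc φ)) (u : H) : ∀ᵐ s ∂(E.diag u), φ s ≠ 0 := by
  have hzero : MeasurableSet {s | φ s = 0} := hφ.1 (measurableSet_singleton 0)
  refine ae_notMem_of_toFun_eq_zero hzero (hinj ?_)
  have hmul : φ * {s | φ s = 0}.indicator 1 = (0 : ℂ) • 1 := by
    ext s
    by_cases hs : φ s = 0 <;> simp [hs]
  rw [map_zero, ← bcalc_indicator_one hzero, bcalc_bcalc hφ (BddMeas.indicator_one hzero), hmul,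
    bcalc_smul 0 (φ := 1) (BddMeas.const 1), zero_smul, _root_.zero_apply]

theorem IsIntegral.mul_norm_le_norm_subSMul {E : SpectralMeasure α H} {φ : α → ℂ}
    {T : H →ₗ.[ℂ] H} (hφ : Measurable φ) (hT : E.IsIntegral φ T) {ξ : ℂ} {δ : ℝ} (hδ : 0 ≤ δ)
    (u : T.domain) (h : ∀ᵐ s ∂(E.diag u), δ ≤ ‖φ s - ξ‖) :
    δ * ‖(u : H)‖ ≤ ‖subSMul T ξ u‖ := by
  have hex := bddExhaustion_norm_le hφ
  refine le_of_tendsto_of_tendsto' ((tendsto_toFun (E := E) hex.toIsExhaustion u).norm.const_mul δ)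
    (tendsto_toFun (E := E) hex.toIsExhaustion (subSMul T ξ u)).norm fun n => ?_
  set ω : Set α := {s | ‖φ s‖ ≤ n}
  have hone : BddMeas (ω.indicator 1) := BddMeas.indicator_one (hex.measurableSet n)
  have hφω : BddMeas (ω.indicator φ) := hex.bddMeas n
  have hcut : E.toFun ω (subSMul T ξ u) = E.bcalc (ω.indicator φ - ξ • ω.indicator 1) (u : H) := by
    rw [subSMul_apply, map_sub, hT.toFun_apply hex, map_smul, bcalc_sub hφω
      (hone.smul ξ), bcalc_smul ξ hone, bcalc_indicator_one (hex.measurableSet n)]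
    rfl
  calc δ * ‖E.toFun ω (u : H)‖ = ‖E.bcalc ((δ : ℂ) • ω.indicator 1) (u : H)‖ := by
        rw [bcalc_smul _ hone, bcalc_indicator_one (hex.measurableSet n), _root_.smul_apply,
          norm_smul, Complex.norm_of_nonneg hδ]
    _ ≤ ‖E.bcalc (ω.indicator φ - ξ • ω.indicator 1) (u : H)‖ := by
        refine norm_bcalc_le_norm_bcalc (hone.smul _) (hφω.sub (hone.smul ξ)) (u : H) ?_
        filter_upwards [h] with s hs
        by_cases hsω : s ∈ ω <;> simp [hsω, abs_of_nonneg hδ, hs]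
    _ = ‖E.toFun ω (subSMul T ξ u)‖ := by rw [hcut]

end SpectralMeasure

open SpectralMeasure

theorem bddMeas_inv {σ : Set ℝ} {c : ℝ} (hc0 : 0 < c) (hc : ∀ s : σ, c ≤ s) :
    BddMeas fun s : σ => ((s : ℝ) : ℂ)⁻¹ := by
  refine ⟨by fun_prop, c⁻¹, fun s => ?_⟩
  rw [norm_inv, Complex.norm_of_nonneg (hc0.le.trans (hc s))]
  exact inv_anti₀ hc0 (hc s)

section Existence

variable {H : Type*} [NormedAddCommGroup H] [InnerProductSpace ℂ H]
  {A : H →ₗ.[ℂ] H} {B : H →L[ℂ] H}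

theorem IsBoundedInverse.injective (hAB : IsBoundedInverse A B) : Function.Injective B :=
  (injective_iff_map_eq_zero B).2 fun y hy => A.graph_fst_eq_zero_snd ((hAB 0 y).2 hy) rfl

variable [CompleteSpace H]

theorem IsBoundedInverse.isIntegral {α : Type*} [MeasurableSpace α] {E : SpectralMeasure α H}
    {φ ψ : α → ℂ} (hφ : Measurable φ) (hψ : BddMeas ψ) (hinv : ∀ s, ψ s * φ s = 1)
    (hA : IsBoundedInverse A (E.bcalc ψ)) : E.IsIntegral φ A := by
  have hT := isIntegral_integral (E := E) hφ
  have hTA : E.integral φ = A := by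
    refine LinearPMap.eq_of_eq_graph ?_
    ext ⟨u, y⟩
    rw [hA u y]
    exact hT.mem_graph_iff_of_inv hφ hψ hinv
  rwa [hTA] at hT

theorem exists_mem_spectrum_ne_zero [Nontrivial H] (hB : IsSelfAdjoint B)
    (hinj : Function.Injective B) : ∃ r ∈ spectrum ℝ B, r ≠ 0 := by
  by_contra! h
  have hid : (ContinuousMap.id ℝ).restrict (spectrum ℝ B) = 0 := by
    ext r
    exact h r r.2
  have hB0 : B = 0 := by rw [← cfcHom_id (R := ℝ) hB, hid, map_zero]
  obtain ⟨x, hx⟩ := exists_ne (0 : H)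
  exact hx (hinj (by simp [hB0]))

-- `0 ∈ σ(B)` may occur; it is sent to an arbitrary point of `σ(A)`.
theorem IsBoundedInverse.exists_measurable_inv [Nontrivial H] (hAB : IsBoundedInverse A B)
    (hB : IsSelfAdjoint B) :
    ∃ g : spectrum ℝ B → spec A, Measurable g ∧
      ∀ r : spectrum ℝ B, (r : ℝ) ≠ 0 → (g r : ℝ) = (r : ℝ)⁻¹ := by
  classical
  obtain ⟨r₀, hr₀, hr₀'⟩ := exists_mem_spectrum_ne_zero hB hAB.injective
  have hmem : ∀ r : spectrum ℝ B, (if (r : ℝ) = 0 then r₀⁻¹ else (r : ℝ)⁻¹) ∈ spec A := by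
    intro r
    split_ifs with h
    · exact hAB.inv_mem_spec hr₀ hr₀'
    · exact hAB.inv_mem_spec r.2 h
  refine ⟨fun r => ⟨_, hmem r⟩, Measurable.subtype_mk ?_, fun r hr => if_neg hr⟩
  exact Measurable.ite (measurable_subtype_coe (measurableSet_singleton 0)) measurable_const
    measurable_subtype_coe.inv

theorem exists_isSpectralMeasureOf [Nontrivial H] (hA : IsSelfAdjoint A)
    (hpos : StrictlyPositive A) : ∃ E : SpectralMeasure (spec A) H, IsSpectralMeasureOf A E := by
  obtain ⟨c, hc0, hc⟩ := hpos
  have hspec := le_of_mem_spec hA hc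
  have hres : (0 : ℂ) ∈ resolventSet A := by exact_mod_cast mem_resolventSet_of_lt hA hc hc0
  obtain ⟨B, hB, hAB⟩ := exists_isBoundedInverse hA hres
  obtain ⟨g, hg, hgr⟩ := hAB.exists_measurable_inv hB
  have hFB := boundedSpectralMeasure_bcalc_coe hB
  have hinv := bddMeas_inv hc0 hspec
  have hEB : ((boundedSpectralMeasure hB).map hg).bcalc (fun s => ((s : ℝ) : ℂ)⁻¹) = B := by
    rw [map_bcalc _ hg hinv]
    refine (bcalc_congr_ae (hinv.comp hg) (bddMeas_coe_spectrum B) fun u => ?_).trans hFB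
    filter_upwards [ae_ne_zero_of_injective_bcalc (bddMeas_coe_spectrum B)
      (hFB.symm ▸ hAB.injective) u] with r hr
    simp [hgr r (Complex.ofReal_ne_zero.1 hr)]
  refine ⟨(boundedSpectralMeasure hB).map hg,
    IsBoundedInverse.isIntegral (by fun_prop) hinv (fun s => ?_) (hEB.symm ▸ hAB)⟩
  exact inv_mul_cancel₀ (Complex.ofReal_ne_zero.2 (hc0.trans_le (hspec s)).ne')

theorem exists_toFun_ne_zero (hA : IsSelfAdjoint A) {E : SpectralMeasure (spec A) H}
    (hE : IsSpectralMeasureOf A E) (s₀ : spec A) {U : Set (spec A)} (hU : MeasurableSet U)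
    (hs₀ : U ∈ 𝓝 s₀) : ∃ w, E.toFun U w ≠ 0 := by
  by_contra! h0
  obtain ⟨δ, hδ, hball⟩ := Metric.mem_nhds_iff.1 hs₀
  refine s₀.2 (mem_resolventSet_of_mul_norm_le hA hδ fun u => ?_)
  refine hE.mul_norm_le_norm_subSMul (by fun_prop) hδ.le u ?_
  filter_upwards [ae_notMem_of_toFun_eq_zero hU (h0 u)] with s hs
  have hdist : δ ≤ dist s s₀ := not_lt.1 fun hlt => hs (hball hlt)
  rwa [Subtype.dist_eq, Real.dist_eq, ← Real.norm_eq_abs, ← Complex.norm_real,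
    Complex.ofReal_sub] at hdist

end Existence

/-! ### Exponentials of bounded operators -/

section Exponentials

variable {K : Type*} [NormedAddCommGroup K] [NormedSpace ℂ K]

theorem exp_zero_apply (G : K →L[ℂ] K) (z : K) : NormedSpace.exp ((0 : ℝ) • G) z = z := by
  rw [zero_smul, NormedSpace.exp_zero, one_apply_eq_self]

variable [CompleteSpace K]

theorem hasDerivAt_exp_apply (G : K →L[ℂ] K) (z : K) (t : ℝ) :
    HasDerivAt (fun t : ℝ => NormedSpace.exp (t • G) z) (NormedSpace.exp (t • G) (G z)) t :=
  ((ContinuousLinearMap.apply ℂ K z).restrictScalars ℝ).hasFDerivAt.comp_hasDerivAt t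
    (hasDerivAt_exp_smul_const G t)

theorem continuous_exp_apply (G : K →L[ℂ] K) (z : K) :
    Continuous fun t : ℝ => NormedSpace.exp (t • G) z :=
  continuous_iff_continuousAt.2 fun t => (hasDerivAt_exp_apply G z t).continuousAt

theorem exp_apply_of_semiconj {P G G' : K →L[ℂ] K} (h : P * G = G' * P) (t : ℝ) (z : K) :
    P (NormedSpace.exp (t • G) z) = NormedSpace.exp (t • G') (P z) := by
  have hs : SemiconjBy P (t • G) (t • G') := by
    rw [SemiconjBy, mul_smul_comm, smul_mul_assoc, h]
  let _ : NormedAlgebra ℚ (K →L[ℂ] K) := .restrictScalars ℚ ℂ _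
  exact congr($(hs.exp_right.eq) z)

theorem exp_apply_comm (G : K →L[ℂ] K) (z : K) (t : ℝ) :
    NormedSpace.exp (t • G) (G z) = G (NormedSpace.exp (t • G) z) :=
  (exp_apply_of_semiconj rfl t z).symm

theorem exp_add_apply (G : K →L[ℂ] K) (z : K) (s t : ℝ) :
    NormedSpace.exp ((s + t) • G) z = NormedSpace.exp (s • G) (NormedSpace.exp (t • G) z) := by
  let _ : NormedAlgebra ℚ (K →L[ℂ] K) := .restrictScalars ℚ ℂ _
  rw [add_smul, NormedSpace.exp_add_of_commute (((Commute.refl G).smul_left s).smul_right t)]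
  rfl

theorem norm_exp_apply_sub_sub_le {G : K →L[ℂ] K} {z : K} {ε t : ℝ} (ht : 0 ≤ t)
    (h : ∀ τ ∈ Set.Ico 0 t, ‖NormedSpace.exp (τ • G) (G z) - G z‖ ≤ ε) :
    ‖NormedSpace.exp (t • G) z - z - t • G z‖ ≤ ε * t := by
  have hderiv : ∀ τ ∈ Set.Icc 0 t, HasDerivWithinAt
      (fun τ : ℝ => NormedSpace.exp (τ • G) z - τ • G z)
      (NormedSpace.exp (τ • G) (G z) - (1 : ℝ) • G z) (Set.Icc 0 t) τ := fun τ _ =>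
    ((hasDerivAt_exp_apply G z τ).sub ((hasDerivAt_id τ).smul_const (G z))).hasDerivWithinAt
  simpa only [zero_smul, NormedSpace.exp_zero, one_apply_eq_self, sub_zero, sub_right_comm] using
    norm_image_sub_le_of_norm_deriv_le_segment' hderiv (by simpa only [one_smul] using h) t
      (Set.right_mem_Icc.2 ht)

end Exponentials

section Dissipative

variable {K : Type*} [NormedAddCommGroup K] [InnerProductSpace ℂ K]

theorem hasDerivAt_norm_sq {z : ℝ → K} {z' : K} {t : ℝ} (h : HasDerivAt z z' t) :
    HasDerivAt (fun t => ‖z t‖ ^ 2) (2 * (⟪z t, z'⟫_ℂ).re) t := by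
  let _ : InnerProductSpace ℝ K := .rclikeToReal ℂ K
  exact h.norm_sq

theorem norm_exp_apply_le [CompleteSpace K] {G : K →L[ℂ] K} (hG : ∀ z, (⟪z, G z⟫_ℂ).re ≤ 0)
    {t : ℝ} (ht : 0 ≤ t) (z : K) : ‖NormedSpace.exp (t • G) z‖ ≤ ‖z‖ := by
  have hanti : Antitone fun s : ℝ => ‖NormedSpace.exp (s • G) z‖ ^ 2 := by
    refine antitone_of_hasDerivAt_nonpos (fun s => hasDerivAt_norm_sq (hasDerivAt_exp_apply G z s))
      fun s => ?_
    rw [exp_apply_comm]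
    exact mul_nonpos_of_nonneg_of_nonpos zero_le_two (hG _)
  have h := hanti ht
  simp only [exp_zero_apply] at h
  exact le_of_sq_le_sq h (norm_nonneg _)

end Dissipative

/-! ### Strongly continuous semigroups and their generators -/

section Semigroup

variable {K : Type*} [NormedAddCommGroup K] [NormedSpace ℂ K] {S : ℝ≥0 → K →L[ℂ] K}

theorem map_mem_generatorGraph {X Y : Type*} [SeminormedAddCommGroup X] [NormedSpace ℂ X]
    [SeminormedAddCommGroup Y] [NormedSpace ℂ Y] {S : ℝ≥0 → X →L[ℂ] X} {T : ℝ≥0 → Y →L[ℂ] Y}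
    (L : X →L[ℂ] Y) (h : ∀ t z, L (S t z) = T t (L z)) {z z' : X}
    (hz : (z, z') ∈ generatorGraph S) : (L z, L z') ∈ generatorGraph T :=
  ((L.continuous.tendsto z').comp hz).congr fun t => by
    simp only [Function.comp_apply, map_smul, map_sub, h]

theorem inv_coe_smul_eq {X : Type*} [SeminormedAddCommGroup X] [NormedSpace ℂ X] (r : ℝ) (x : X) :
    (r : ℂ)⁻¹ • x = r⁻¹ • x := by
  rw [← Complex.ofReal_inv, Complex.coe_smul]

theorem mem_generatorGraph_exp [CompleteSpace K] (G : K →L[ℂ] K) (z : K) :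
    (z, G z) ∈ generatorGraph fun t : ℝ≥0 => NormedSpace.exp ((t : ℝ) • G) := by
  have hcoe : Tendsto (fun t : ℝ≥0 => (t : ℝ)) (𝓝[≠] 0) (𝓝[≠] 0) :=
    tendsto_nhdsWithin_of_tendsto_nhds_of_eventually_within _
      ((NNReal.continuous_coe.tendsto' 0 0 rfl).mono_left nhdsWithin_le_nhds)
      (eventually_nhdsWithin_of_forall fun t ht => NNReal.coe_ne_zero.2 ht)
  have hslope := (hasDerivAt_iff_tendsto_slope.1 (hasDerivAt_exp_apply G z 0)).comp hcoe
  rw [exp_zero_apply] at hslope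
  refine hslope.congr fun t => ?_
  simp only [Function.comp_apply, slope_def_module, exp_zero_apply, sub_zero, inv_coe_smul_eq]

theorem mem_generatorGraph_of_forall_norm_le {z z' : K}
    (h : ∀ ε > 0, ∀ᶠ t : ℝ≥0 in 𝓝 0, ‖S t z - z - (t : ℝ) • z'‖ ≤ ε * t) :
    (z, z') ∈ generatorGraph S := by
  change Tendsto (fun t : ℝ≥0 => ((t : ℝ) : ℂ)⁻¹ • (S t z - z)) (𝓝[≠] 0) (𝓝 z')
  refine Metric.tendsto_nhds.2 fun ε hε => ?_
  filter_upwards [nhdsWithin_le_nhds (h (ε / 2) (half_pos hε)), self_mem_nhdsWithin] with t ht ht0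
  have htpos : 0 < (t : ℝ) := NNReal.coe_pos.2 (pos_iff_ne_zero.2 ht0)
  calc dist (((t : ℝ) : ℂ)⁻¹ • (S t z - z)) z'
      = ‖(t : ℝ)⁻¹ • (S t z - z - (t : ℝ) • z')‖ := by
        rw [dist_eq_norm, inv_coe_smul_eq, smul_sub _ _ ((t : ℝ) • z'), inv_smul_smul₀ htpos.ne']
    _ ≤ (t : ℝ)⁻¹ * (ε / 2 * t) := by
        rw [norm_smul, Real.norm_of_nonneg (inv_nonneg.2 htpos.le)]
        gcongr
    _ = ε / 2 := by field_simp
    _ < ε := half_lt_self hε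

namespace IsC0Semigroup

theorem add_apply (hS : IsC0Semigroup S) (s t : ℝ≥0) (z : K) : S (s + t) z = S s (S t z) :=
  congr($(hS.add s t) z)

theorem apply_mem_generatorGraph (hS : IsC0Semigroup S) {z z' : K}
    (h : (z, z') ∈ generatorGraph S) (t : ℝ≥0) : (S t z, S t z') ∈ generatorGraph S :=
  map_mem_generatorGraph (S t) (fun s w => by rw [← hS.add_apply, add_comm, hS.add_apply]) h

theorem hasDerivWithinAt (hS : IsC0Semigroup S) {z z' : K}
    (h : (z, z') ∈ generatorGraph S) {t : ℝ} (ht : 0 ≤ t) :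
    HasDerivWithinAt (fun s : ℝ => S s.toNNReal z) (S t.toNNReal z') (Set.Ici t) t := by
  rw [hasDerivWithinAt_iff_tendsto_slope, Set.Ici_sdiff_left]
  have hshift : Tendsto (fun s : ℝ => (s - t).toNNReal) (𝓝[>] t) (𝓝[≠] 0) := by
    refine tendsto_nhdsWithin_of_tendsto_nhds_of_eventually_within _ ?_
      (eventually_nhdsWithin_of_forall fun s hs => (Real.toNNReal_pos.2 (sub_pos.2 hs)).ne')
    have hcont : Continuous fun s : ℝ => (s - t).toNNReal := by fun_prop
    exact (hcont.tendsto' t 0 (by simp)).mono_left nhdsWithin_le_nhds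
  refine ((hS.apply_mem_generatorGraph h t.toNNReal).comp hshift).congr' ?_
  filter_upwards [self_mem_nhdsWithin] with s hs
  have hst : 0 ≤ s - t := sub_nonneg.2 (le_of_lt hs)
  rw [slope_def_module, Function.comp_apply, Real.coe_toNNReal _ hst, ← hS.add_apply,
    ← Real.toNNReal_add hst ht, sub_add_cancel, inv_coe_smul_eq]

theorem norm_apply_sub_apply_le (hS : IsC0Semigroup S) {C : ℝ} {s t : ℝ≥0} (hs : ‖S s‖ ≤ C)
    (ht : ‖S t‖ ≤ C) (z : K) : ‖S s z - S t z‖ ≤ C * ‖S (nndist s t) z - z‖ := by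
  wlog hst : t ≤ s generalizing s t
  · rw [norm_sub_rev, nndist_comm]
    exact this ht hs (le_of_not_ge hst)
  have hdist : s = t + nndist s t := by
    rw [NNReal.nndist_eq, tsub_eq_zero_of_le hst, max_eq_left zero_le, add_tsub_cancel_of_le hst]
  calc ‖S s z - S t z‖ = ‖S t (S (nndist s t) z - z)‖ := by
        rw [map_sub, ← hS.add_apply, ← hdist]
    _ ≤ C * ‖S (nndist s t) z - z‖ := (S t).le_of_opNorm_le ht _

theorem exists_bound_nat_mul (hS : IsC0Semigroup S) {δ : ℝ≥0} {C₀ : ℝ}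
    (hC₀ : ∀ t ≤ δ, ‖S t‖ ≤ C₀) (k : ℕ) : ∃ C : ℝ, ∀ t ≤ k * δ, ‖S t‖ ≤ C := by
  induction k with
  | zero => exact ⟨C₀, fun t ht => hC₀ t (ht.trans (by simp))⟩
  | succ k ih =>
    obtain ⟨C, hC⟩ := ih
    refine ⟨max C (C₀ * C), fun t ht => ?_⟩
    rcases le_total t (k * δ) with hle | hge
    · exact (hC t hle).trans (le_max_left _ _)
    · have hrest : t - k * δ ≤ δ := by
        rw [tsub_le_iff_left]
        exact ht.trans_eq (by push_cast; ring)
      calc ‖S t‖ = ‖(S (t - k * δ)).comp (S (k * δ))‖ := by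
            rw [← hS.add, tsub_add_cancel_of_le hge]
        _ ≤ ‖S (t - k * δ)‖ * ‖S (k * δ)‖ := ContinuousLinearMap.opNorm_comp_le _ _
        _ ≤ C₀ * C := mul_le_mul (hC₀ _ hrest) (hC _ le_rfl) (norm_nonneg _)
            ((norm_nonneg _).trans (hC₀ _ hrest))
        _ ≤ max C (C₀ * C) := le_max_right _ _

variable [CompleteSpace K]

theorem exists_bound_near_zero (hS : IsC0Semigroup S) :
    ∃ δ : ℝ≥0, 0 < δ ∧ ∃ C : ℝ, ∀ t ≤ δ, ‖S t‖ ≤ C := by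
  by_contra! hunbdd
  choose t ht hlarge using fun k : ℕ => hunbdd (1 / ((k : ℝ≥0) + 1)) (by positivity) k
  have hlim : Tendsto t atTop (𝓝 0) :=
    tendsto_of_tendsto_of_tendsto_of_le_of_le tendsto_const_nhds
      tendsto_one_div_add_atTop_nhds_zero_nat (fun _ => zero_le) ht
  obtain ⟨C, hC⟩ := banach_steinhaus (g := fun k => S (t k)) fun z =>
    ((hS.tendsto z).comp hlim).norm.bddAbove_range.imp fun C hC k => hC ⟨k, rfl⟩
  obtain ⟨k, hk⟩ := exists_nat_gt C
  exact (hk.trans (hlarge k)).not_ge (hC k)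

theorem exists_bound (hS : IsC0Semigroup S) (T : ℝ≥0) : ∃ C : ℝ, ∀ t ≤ T, ‖S t‖ ≤ C := by
  obtain ⟨δ, hδ, C₀, hC₀⟩ := hS.exists_bound_near_zero
  obtain ⟨k, hk⟩ := exists_nat_ge (T / δ)
  obtain ⟨C, hC⟩ := hS.exists_bound_nat_mul hC₀ k
  exact ⟨C, fun t ht => hC t (ht.trans ((div_le_iff₀ hδ).1 hk))⟩

theorem continuous (hS : IsC0Semigroup S) (z : K) : Continuous fun t => S t z := by
  refine continuous_iff_continuousAt.2 fun t => tendsto_iff_norm_sub_tendsto_zero.2 ?_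
  obtain ⟨C, hC⟩ := hS.exists_bound (t + 1)
  have hdist : Tendsto (fun s => nndist s t) (𝓝 t) (𝓝 0) :=
    (continuous_id.nndist continuous_const).tendsto' t 0 (nndist_self t)
  have hlim : Tendsto (fun s => C * ‖S (nndist s t) z - z‖) (𝓝 t) (𝓝 0) := by
    simpa using (((hS.tendsto z).comp hdist).sub_const z).norm.const_mul C
  refine squeeze_zero' (Eventually.of_forall fun s => norm_nonneg _) ?_ hlim
  filter_upwards [Iic_mem_nhds (lt_add_one t)] with s hs
  exact hS.norm_apply_sub_apply_le (hC s hs) (hC t le_self_add) z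

theorem map_apply_eq_exp_apply (hS : IsC0Semigroup S) {X : Type*} [NormedAddCommGroup X]
    [NormedSpace ℂ X] [CompleteSpace X] {L : K →L[ℂ] X} {G : X →L[ℂ] X}
    (hLG : ∀ z z', (z, z') ∈ generatorGraph S → L z' = G (L z)) {z z' : K}
    (hz : (z, z') ∈ generatorGraph S) (t : ℝ≥0) :
    L (S t z) = NormedSpace.exp ((t : ℝ) • G) (L z) := by
  have hcont : Continuous fun s : ℝ => L (S s.toNNReal z) :=
    L.continuous.comp ((hS.continuous z).comp continuous_real_toNNReal)
  have hderiv : ∀ s ∈ Set.Ico 0 (t : ℝ), HasDerivWithinAt (fun s : ℝ => L (S s.toNNReal z))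
      (G (L (S s.toNNReal z))) (Set.Ici s) s := fun s hs => by
    rw [← hLG _ _ (hS.apply_mem_generatorGraph hz s.toNNReal)]
    exact (L.restrictScalars ℝ).hasFDerivAt.comp_hasDerivWithinAt s (hS.hasDerivWithinAt hz hs.1)
  have hderiv' : ∀ s ∈ Set.Ico 0 (t : ℝ), HasDerivWithinAt
      (fun s : ℝ => NormedSpace.exp (s • G) (L z)) (G (NormedSpace.exp (s • G) (L z)))
      (Set.Ici s) s := fun s _ => by
    rw [← exp_apply_comm]
    exact (hasDerivAt_exp_apply G (L z) s).hasDerivWithinAt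
  have heq := ODE_solution_unique (v := fun _ => G) (fun _ => G.lipschitz) hcont.continuousOn hderiv
    (continuous_exp_apply G (L z)).continuousOn hderiv'
    (by rw [exp_zero_apply, Real.toNNReal_zero, hS.zero, ContinuousLinearMap.id_apply])
    (Set.right_mem_Icc.2 t.coe_nonneg)
  simpa only [Real.toNNReal_coe] using heq

end IsC0Semigroup

end Semigroup

/-! ### Limits of bounded dissipative operators -/

section Approximation

variable {K : Type*} [NormedAddCommGroup K] [InnerProductSpace ℂ K]

/-- Bounded dissipative operators `G n` on an increasing sequence of projections `P n` that
converges strongly to the identity, each `G n` being the part of the later ones on the range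
of `P n`. They determine an unbounded generator with graph `{(z, z') | ∀ n, G n z = P n z'}`. -/
structure DissipativeApprox (P G : ℕ → K →L[ℂ] K) : Prop where
  tendsto : ∀ z, Tendsto (fun n => P n z) atTop (𝓝 z)
  norm_le : ∀ n z, ‖P n z‖ ≤ ‖z‖
  mul_proj : ∀ m n, m ≤ n → P n * P m = P m
  gen_mul_proj : ∀ m n, m ≤ n → G n * P m = G m
  proj_mul_gen : ∀ m n, m ≤ n → P m * G n = G m
  dissipative : ∀ n z, (⟪z, G n z⟫_ℂ).re ≤ 0

namespace DissipativeApprox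

variable {P G : ℕ → K →L[ℂ] K}

theorem eq_of_proj_eq (h : DissipativeApprox P G) {z z' : K} (he : ∀ n, P n z = P n z') :
    z = z' :=
  tendsto_nhds_unique (h.tendsto z) ((h.tendsto z').congr fun n => (he n).symm)

theorem gen_proj (h : DissipativeApprox P G) (n : ℕ) (z : K) : G n (P n z) = G n z :=
  congr($(h.gen_mul_proj n n le_rfl) z)

theorem gen_mul_proj_comm (h : DissipativeApprox P G) (m n : ℕ) : G m * P n = P m * G n := by
  rcases le_total m n with hmn | hmn
  · rw [h.proj_mul_gen m n hmn, ← h.proj_mul_gen m n hmn, mul_assoc, h.gen_mul_proj n n le_rfl]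
  · rw [h.gen_mul_proj n m hmn, ← h.proj_mul_gen n m hmn, ← mul_assoc, h.mul_proj n m hmn]

variable [CompleteSpace K]

theorem proj_exp (h : DissipativeApprox P G) {m n : ℕ} (hmn : m ≤ n) (t : ℝ) (z : K) :
    P m (NormedSpace.exp (t • G n) z) = NormedSpace.exp (t • G m) (P m z) :=
  exp_apply_of_semiconj ((h.proj_mul_gen m n hmn).trans (h.gen_mul_proj m m le_rfl).symm) t z

theorem exp_proj (h : DissipativeApprox P G) {m n : ℕ} (hmn : m ≤ n) (t : ℝ) (z : K) :
    NormedSpace.exp (t • G n) (P m z) = NormedSpace.exp (t • G m) (P m z) := by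
  rw [← h.proj_exp le_rfl]
  exact (exp_apply_of_semiconj ((h.proj_mul_gen m m le_rfl).trans
    (h.gen_mul_proj m n hmn).symm) t z).symm

theorem norm_exp_sub_exp_proj_le (h : DissipativeApprox P G) {m n : ℕ} (hmn : m ≤ n) (t : ℝ≥0)
    (z : K) :
    ‖NormedSpace.exp ((t : ℝ) • G n) z - NormedSpace.exp ((t : ℝ) • G m) (P m z)‖
      ≤ ‖z - P m z‖ := by
  rw [← h.exp_proj hmn, ← map_sub]
  exact norm_exp_apply_le (h.dissipative n) t.coe_nonneg _

theorem exists_tendsto_exp (h : DissipativeApprox P G) (t : ℝ≥0) (z : K) :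
    ∃ y, Tendsto (fun n => NormedSpace.exp ((t : ℝ) • G n) z) atTop (𝓝 y) := by
  refine cauchySeq_tendsto_of_complete (cauchySeq_of_le_tendsto_0
    (fun m => ‖z - P m z‖ + ‖z - P m z‖) (fun k l m hk hl => ?_) ?_)
  · exact (dist_triangle_right _ _ (NormedSpace.exp ((t : ℝ) • G m) (P m z))).trans (add_le_add
      ((dist_eq_norm _ _).trans_le (h.norm_exp_sub_exp_proj_le hk t z))
      ((dist_eq_norm _ _).trans_le (h.norm_exp_sub_exp_proj_le hl t z)))
  · have hlim := ((h.tendsto z).const_sub z).norm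
    simpa using hlim.add hlim

/-- The semigroup `lim exp (t G n)` generated by a dissipative approximation. -/
def semigroup (h : DissipativeApprox P G) (t : ℝ≥0) : K →L[ℂ] K :=
  continuousLinearMapOfTendsto (fun n => NormedSpace.exp ((t : ℝ) • G n))
    (tendsto_pi_nhds.2 fun z => (h.exists_tendsto_exp t z).choose_spec)

theorem tendsto_exp (h : DissipativeApprox P G) (t : ℝ≥0) (z : K) :
    Tendsto (fun n => NormedSpace.exp ((t : ℝ) • G n) z) atTop (𝓝 (h.semigroup t z)) :=
  (h.exists_tendsto_exp t z).choose_spec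

theorem proj_semigroup (h : DissipativeApprox P G) (n : ℕ) (t : ℝ≥0) (z : K) :
    P n (h.semigroup t z) = NormedSpace.exp ((t : ℝ) • G n) (P n z) := by
  refine tendsto_nhds_unique (((P n).continuous.tendsto _).comp (h.tendsto_exp t z))
    (tendsto_const_nhds.congr' ?_)
  filter_upwards [eventually_ge_atTop n] with m hm
  exact (h.proj_exp hm t z).symm

theorem norm_semigroup_sub_exp_proj_le (h : DissipativeApprox P G) (n : ℕ) (t : ℝ≥0) (z : K) :
    ‖h.semigroup t z - NormedSpace.exp ((t : ℝ) • G n) (P n z)‖ ≤ ‖z - P n z‖ := by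
  refine le_of_tendsto ((h.tendsto_exp t z).sub_const _).norm ?_
  filter_upwards [eventually_ge_atTop n] with m hm
  exact h.norm_exp_sub_exp_proj_le hm t z

theorem norm_semigroup_le (h : DissipativeApprox P G) (t : ℝ≥0) (z : K) :
    ‖h.semigroup t z‖ ≤ ‖z‖ :=
  le_of_tendsto' (h.tendsto_exp t z).norm fun n =>
    norm_exp_apply_le (h.dissipative n) t.coe_nonneg z

theorem continuous_semigroup (h : DissipativeApprox P G) (z : K) :
    Continuous fun t => h.semigroup t z := by
  have hunif : TendstoUniformly
      (fun n (t : ℝ≥0) => NormedSpace.exp ((t : ℝ) • G n) (P n z)) (fun t => h.semigroup t z)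
      atTop := by
    refine Metric.tendstoUniformly_iff.2 fun ε hε => ?_
    filter_upwards [Metric.tendsto_nhds.1 (h.tendsto z) ε hε] with n hn t
    rw [dist_comm, dist_eq_norm] at hn
    exact (dist_eq_norm _ _).trans_lt ((h.norm_semigroup_sub_exp_proj_le n t z).trans_lt hn)
  exact hunif.continuous (Frequently.of_forall fun n =>
    (continuous_exp_apply (G n) (P n z)).comp NNReal.continuous_coe)

theorem isC0Semigroup_semigroup (h : DissipativeApprox P G) : IsC0Semigroup h.semigroup := by
  have hzero : h.semigroup 0 = ContinuousLinearMap.id ℂ K := by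
    refine ContinuousLinearMap.ext fun z => h.eq_of_proj_eq fun n => ?_
    rw [h.proj_semigroup, NNReal.coe_zero, exp_zero_apply, ContinuousLinearMap.id_apply]
  refine ⟨hzero, fun s t => ContinuousLinearMap.ext fun z => h.eq_of_proj_eq fun n => ?_,
    fun z => (h.continuous_semigroup z).tendsto' 0 z congr($hzero z)⟩
  rw [ContinuousLinearMap.comp_apply, h.proj_semigroup, h.proj_semigroup, h.proj_semigroup,
    NNReal.coe_add, exp_add_apply]

theorem norm_semigroup_sub_sub_le (h : DissipativeApprox P G) {z z' : K}
    (hz : ∀ n, G n z = P n z') {ε : ℝ} {t : ℝ≥0}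
    (hε : ∀ τ < t, ‖h.semigroup τ z' - z'‖ ≤ ε) :
    ‖h.semigroup t z - z - (t : ℝ) • z'‖ ≤ ε * t := by
  refine le_of_tendsto' (h.tendsto (h.semigroup t z - z - (t : ℝ) • z')).norm fun n => ?_
  have hGP : G n (P n z) = P n z' := (h.gen_proj n z).trans (hz n)
  have hbound : ∀ τ ∈ Set.Ico 0 (t : ℝ),
      ‖NormedSpace.exp (τ • G n) (G n (P n z)) - G n (P n z)‖ ≤ ε := fun τ hτ => by
    lift τ to ℝ≥0 using hτ.1
    rw [hGP, ← h.proj_semigroup, ← map_sub]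
    exact (h.norm_le n _).trans (hε τ (NNReal.coe_lt_coe.1 hτ.2))
  have hle := norm_exp_apply_sub_sub_le t.coe_nonneg hbound
  rwa [hGP, ← h.proj_semigroup, ← map_sub,
    ← ContinuousLinearMap.map_smul_of_tower, ← map_sub] at hle

theorem generatorGraph_semigroup (h : DissipativeApprox P G) :
    generatorGraph h.semigroup = {p | ∀ n, G n p.1 = P n p.2} := by
  refine Set.Subset.antisymm ?_ ?_
  · rintro ⟨z, z'⟩ hz n
    have hlim := map_mem_generatorGraph (P n) (fun t w => h.proj_semigroup n t w) hz
    exact (h.gen_proj n z).symm.trans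
      (tendsto_nhds_unique (mem_generatorGraph_exp (G n) (P n z)) hlim)
  · rintro ⟨z, z'⟩ hz
    refine mem_generatorGraph_of_forall_norm_le fun ε hε => ?_
    have hcont := h.isC0Semigroup_semigroup.tendsto z'
    obtain ⟨δ, hδ, hball⟩ := Metric.eventually_nhds_iff.1 (Metric.tendsto_nhds.1 hcont ε hε)
    filter_upwards [Metric.ball_mem_nhds 0 hδ] with t ht
    refine h.norm_semigroup_sub_sub_le hz fun τ hτ => ?_
    rw [← dist_eq_norm]
    refine (hball ?_).le
    rw [Metric.mem_ball, NNReal.dist_eq, NNReal.coe_zero, sub_zero, NNReal.abs_eq] at ht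
    rw [NNReal.dist_eq, NNReal.coe_zero, sub_zero, NNReal.abs_eq]
    exact (NNReal.coe_lt_coe.2 hτ).trans ht

theorem proj_apply_eq_exp (h : DissipativeApprox P G) {S : ℝ≥0 → K →L[ℂ] K} (hS : IsC0Semigroup S)
    (hgen : generatorGraph S = {p | ∀ n, G n p.1 = P n p.2}) (n : ℕ) (t : ℝ≥0) (z : K) :
    P n (S t z) = NormedSpace.exp ((t : ℝ) • G n) (P n z) := by
  have hmem : ∀ {z z'}, (z, z') ∈ generatorGraph S ↔ ∀ n, G n z = P n z' := by
    simp [hgen]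
  have hdense : ∀ m, P n (S t (P m z)) = NormedSpace.exp ((t : ℝ) • G n) (P n (P m z)) := fun m =>
    hS.map_apply_eq_exp_apply (fun w w' hw => by rw [h.gen_proj, hmem.1 hw])
      (hmem.2 fun k => congr($(h.gen_mul_proj_comm k m) z)) t
  have hlim : ∀ T : K →L[ℂ] K, Tendsto (fun m => T (P m z)) atTop (𝓝 (T z)) := fun T =>
    (T.continuous.tendsto z).comp (h.tendsto z)
  exact tendsto_nhds_unique (hlim (P n * S t))
    ((hlim (NormedSpace.exp ((t : ℝ) • G n) * P n)).congr fun m => (hdense m).symm)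

end DissipativeApprox

end Approximation

/-! ### The wave operator in the coordinates `(A^{1/2} u, v)` -/

section Blocks

theorem withLp_prod_ext {p : ℝ≥0∞} {X Y : Type*} {z z' : WithLp p (X × Y)} (h₁ : z.fst = z'.fst)
    (h₂ : z.snd = z'.snd) : z = z' :=
  WithLp.ofLp_injective p (Prod.ext h₁ h₂)

variable {H : Type*} [NormedAddCommGroup H] [InnerProductSpace ℂ H]

/-- An operator on `H × H` viewed on the Hilbert space direct sum. -/
def blockOp (T : H × H →L[ℂ] H × H) : WithLp 2 (H × H) →L[ℂ] WithLp 2 (H × H) :=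
  ((WithLp.prodContinuousLinearEquiv 2 ℂ H H).symm : H × H →L[ℂ] WithLp 2 (H × H)) ∘L T ∘L
    ((WithLp.prodContinuousLinearEquiv 2 ℂ H H) : WithLp 2 (H × H) →L[ℂ] H × H)

/-- The operator `(x, y) ↦ (Q x, Q y)`. -/
def diagOp (Q : H →L[ℂ] H) : WithLp 2 (H × H) →L[ℂ] WithLp 2 (H × H) := blockOp (Q.prodMap Q)

/-- The operator `(x, y) ↦ (a y, - a x - F y)`: the wave operator `(u, v) ↦ (v, - a² u - F v)` after
the substitution `x = a u`, `y = v`. -/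
def waveOp (a F : H →L[ℂ] H) : WithLp 2 (H × H) →L[ℂ] WithLp 2 (H × H) :=
  blockOp ((a ∘L ContinuousLinearMap.snd ℂ H H).prod
    (-(a ∘L ContinuousLinearMap.fst ℂ H H) - F ∘L ContinuousLinearMap.snd ℂ H H))

theorem diagOp_apply_fst (Q : H →L[ℂ] H) (z : WithLp 2 (H × H)) : (diagOp Q z).fst = Q z.fst := rfl

theorem diagOp_apply_snd (Q : H →L[ℂ] H) (z : WithLp 2 (H × H)) : (diagOp Q z).snd = Q z.snd := rfl

theorem waveOp_apply_fst (a F : H →L[ℂ] H) (z : WithLp 2 (H × H)) :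
    (waveOp a F z).fst = a z.snd := rfl

theorem waveOp_apply_snd (a F : H →L[ℂ] H) (z : WithLp 2 (H × H)) :
    (waveOp a F z).snd = -a z.fst - F z.snd := rfl

theorem norm_diagOp_le {Q : H →L[ℂ] H} (hQ : ∀ x, ‖Q x‖ ≤ ‖x‖) (z : WithLp 2 (H × H)) :
    ‖diagOp Q z‖ ≤ ‖z‖ := by
  refine le_of_sq_le_sq ?_ (norm_nonneg _)
  rw [WithLp.prod_norm_sq_eq_of_L2, WithLp.prod_norm_sq_eq_of_L2]
  exact add_le_add (pow_le_pow_left₀ (norm_nonneg _) (hQ _) 2)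
    (pow_le_pow_left₀ (norm_nonneg _) (hQ _) 2)

theorem tendsto_diagOp {Q : ℕ → H →L[ℂ] H} (hQ : ∀ x, Tendsto (fun n => Q n x) atTop (𝓝 x))
    (z : WithLp 2 (H × H)) : Tendsto (fun n => diagOp (Q n) z) atTop (𝓝 z) :=
  ((WithLp.prodContinuousLinearEquiv 2 ℂ H H).symm.continuous.tendsto _).comp
    ((hQ z.fst).prodMk_nhds (hQ z.snd))

-- The conservative part of the wave operator is skew-symmetric.
theorem re_inner_waveOp_self {a : H →L[ℂ] H} (ha : (a : H →ₗ[ℂ] H).IsSymmetric) (F : H →L[ℂ] H)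
    (z : WithLp 2 (H × H)) : (⟪z, waveOp a F z⟫_ℂ).re = -(⟪z.snd, F z.snd⟫_ℂ).re := by
  have hskew : (⟪z.fst, a z.snd⟫_ℂ).re = (⟪z.snd, a z.fst⟫_ℂ).re :=
    (congrArg Complex.re (ha z.fst z.snd)).symm.trans (inner_re_symm (𝕜 := ℂ) _ _)
  rw [WithLp.prod_inner_apply]
  change (⟪z.fst, a z.snd⟫_ℂ + ⟪z.snd, -a z.fst - F z.snd⟫_ℂ).re = _
  rw [inner_sub_right, inner_neg_right, Complex.add_re, Complex.sub_re, Complex.neg_re, hskew]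
  ring

end Blocks

section Multipliers

open SpectralMeasure

theorem star_indicator_ofReal {α : Type*} (f : α → ℝ) (ω : Set α) :
    star (ω.indicator fun s => (f s : ℂ)) = ω.indicator fun s => (f s : ℂ) := by
  ext s
  by_cases hs : s ∈ ω <;> simp [hs]

variable {α : Type*} [MeasurableSpace α] {H : Type*} [NormedAddCommGroup H]
  [InnerProductSpace ℂ H] [CompleteSpace H] {E : SpectralMeasure α H} {a f : α → ℝ}

/-- The bounded operator `∫_ω f dE`, for a real function `f` that is bounded on `ω`. -/
def partOp (E : SpectralMeasure α H) (f : α → ℝ) (ω : Set α) : H →L[ℂ] H :=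
  E.bcalc (ω.indicator fun s => (f s : ℂ))

theorem isSymmetric_partOp {ω : Set α} (h : BddMeas (ω.indicator fun s => (f s : ℂ))) :
    (partOp E f ω : H →ₗ[ℂ] H).IsSymmetric :=
  inner_bcalc_left_of_real h (star_indicator_ofReal f ω)

theorem inner_partOp_self {ω : Set α} (hω : MeasurableSet ω)
    (h : BddMeas (ω.indicator fun s => (f s : ℂ))) (x : H) :
    ⟪x, partOp E f ω x⟫_ℂ = ((∫ s in ω, f s ∂(E.diag x) : ℝ) : ℂ) := by
  rw [partOp, inner_bcalc_self h, integral_indicator hω, integral_complex_ofReal]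

variable {ω : ℕ → Set α}

theorem partOp_toFun (h : BddExhaustion (fun s => (f s : ℂ)) ω) {m n : ℕ} (hmn : m ≤ n) (x : H) :
    partOp E f (ω n) (E.toFun (ω m) x) = partOp E f (ω m) x :=
  bcalc_indicator_toFun (h.measurableSet m) (h.bddMeas n) (h.mono hmn) x

theorem toFun_partOp (h : BddExhaustion (fun s => (f s : ℂ)) ω) {m n : ℕ} (hmn : m ≤ n) (x : H) :
    E.toFun (ω m) (partOp E f (ω n) x) = partOp E f (ω m) x :=
  toFun_bcalc_indicator (h.measurableSet m) (h.bddMeas n) (h.mono hmn) x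

theorem dissipativeApprox_waveOp (ha : BddExhaustion (fun s => (a s : ℂ)) ω)
    (hf : BddExhaustion (fun s => (f s : ℂ)) ω) (hf0 : ∀ s, 0 ≤ f s) :
    DissipativeApprox (fun n => diagOp (E.toFun (ω n)))
      (fun n => waveOp (partOp E a (ω n)) (partOp E f (ω n))) where
  tendsto := tendsto_diagOp (tendsto_toFun ha.toIsExhaustion)
  norm_le n := norm_diagOp_le (norm_toFun_le (ω n))
  mul_proj m n hmn := by
    have hproj := toFun_toFun_of_subset (E := E) (ha.measurableSet m) (ha.measurableSet n)
      (ha.mono hmn)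
    ext z
    exact withLp_prod_ext (hproj _) (hproj _)
  gen_mul_proj m n hmn := by
    ext z
    refine withLp_prod_ext (partOp_toFun ha hmn _) ?_
    simp only [mul_apply_eq_comp, waveOp_apply_snd, diagOp_apply_fst, diagOp_apply_snd,
      partOp_toFun ha hmn, partOp_toFun hf hmn]
  proj_mul_gen m n hmn := by
    ext z
    refine withLp_prod_ext (toFun_partOp ha hmn _) ?_
    simp only [mul_apply_eq_comp, waveOp_apply_snd, diagOp_apply_snd, map_sub, map_neg,
      toFun_partOp ha hmn, toFun_partOp hf hmn]
  dissipative n z := by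
    rw [re_inner_waveOp_self (isSymmetric_partOp (ha.bddMeas n)),
      inner_partOp_self (hf.measurableSet n) (hf.bddMeas n), Complex.ofReal_re]
    exact neg_nonpos.2 (integral_nonneg hf0)

variable {A F : H →ₗ.[ℂ] H} {u v h : H}

theorem partOp_add_partOp_of_forall_inner_add (ha : BddExhaustion (fun s => (a s : ℂ)) ω)
    (hf : BddExhaustion (fun s => (f s : ℂ)) ω) (hA : E.IsIntegral (fun s => (a s : ℂ)) A)
    (hF : E.IsIntegral (fun s => (f s : ℂ)) F)
    (hweak : ∀ (w : H) (hw : w ∈ A.domain) (hw' : w ∈ F.domain),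
      ⟪A ⟨w, hw⟩, u⟫_ℂ + ⟪F ⟨w, hw'⟩, v⟫_ℂ = ⟪w, h⟫_ℂ) (n : ℕ) :
    partOp E a (ω n) u + partOp E f (ω n) v = E.toFun (ω n) h := by
  refine ext_inner_left ℂ fun w => ?_
  have hw := hweak _ (hA.toFun_mem_domain ha n w) (hF.toFun_mem_domain hf n w)
  rw [hA.apply_toFun ha, hF.apply_toFun hf, E.inner_toFun_left (ha.measurableSet n)] at hw
  rw [inner_add_right, ← hw]
  exact congrArg₂ _ (isSymmetric_partOp (ha.bddMeas n) w u).symm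
    (isSymmetric_partOp (hf.bddMeas n) w v).symm

theorem forall_inner_add_of_partOp_add_partOp (ha : BddExhaustion (fun s => (a s : ℂ)) ω)
    (hf : BddExhaustion (fun s => (f s : ℂ)) ω) (hA : E.IsIntegral (fun s => (a s : ℂ)) A)
    (hF : E.IsIntegral (fun s => (f s : ℂ)) F)
    (hpart : ∀ n, partOp E a (ω n) u + partOp E f (ω n) v = E.toFun (ω n) h)
    (w : H) (hw : w ∈ A.domain) (hw' : w ∈ F.domain) :
    ⟪A ⟨w, hw⟩, u⟫_ℂ + ⟪F ⟨w, hw'⟩, v⟫_ℂ = ⟪w, h⟫_ℂ := by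
  have hlim : ∀ x, Tendsto (fun n => E.toFun (ω n) x) atTop (𝓝 x) :=
    tendsto_toFun ha.toIsExhaustion
  refine tendsto_nhds_unique
    (((hlim (A ⟨w, hw⟩)).inner (𝕜 := ℂ) (tendsto_const_nhds (x := u))).add
      ((hlim (F ⟨w, hw'⟩)).inner (𝕜 := ℂ) (tendsto_const_nhds (x := v))))
    ((tendsto_const_nhds.inner (𝕜 := ℂ) (hlim h)).congr fun n => ?_)
  rw [hA.toFun_apply ha, hF.toFun_apply hf, ← hpart n, inner_add_right]
  exact congrArg₂ _ (isSymmetric_partOp (ha.bddMeas n) w u).symm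
    (isSymmetric_partOp (hf.bddMeas n) w v).symm

end Multipliers

section Wave

open SpectralMeasure

variable {σ : Set ℝ} {f : σ → ℝ}

/-- The sets `{s ∈ σ : s ≤ n, f(s) ≤ n}`, on which both the multiplier `s` and the damping `f` are
bounded. -/
def sublevel (f : σ → ℝ) (n : ℕ) : Set σ := {s | (s : ℝ) ≤ n} ∩ {s | f s ≤ n}

theorem bddExhaustion_sublevel {g : σ → ℝ} (hf : Measurable f) (hg : Measurable g)
    (hg0 : ∀ s, 0 ≤ g s) {C : ℕ → ℝ} (hC : ∀ n, ∀ s ∈ sublevel f n, g s ≤ C n) :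
    BddExhaustion (fun s => (g s : ℂ)) (sublevel f) where
  toIsExhaustion := (isExhaustion_sublevel measurable_subtype_coe).inter (isExhaustion_sublevel hf)
  measurable := by fun_prop
  bdd n := ⟨C n, fun s hs => by
    rw [Complex.norm_real, Real.norm_of_nonneg (hg0 s)]
    exact hC n s hs⟩

theorem bddExhaustion_sublevel_sqrt (hf : Measurable f) :
    BddExhaustion (fun s : σ => ((√(s : ℝ) : ℝ) : ℂ)) (sublevel f) :=
  bddExhaustion_sublevel hf measurable_subtype_coe.sqrt (fun _ => Real.sqrt_nonneg _)
    fun _ _ hs => Real.sqrt_le_sqrt hs.1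

theorem bddExhaustion_sublevel_self (hf : Measurable f) (hf0 : ∀ s, 0 ≤ f s) :
    BddExhaustion (fun s => (f s : ℂ)) (sublevel f) :=
  bddExhaustion_sublevel hf hf hf0 fun _ _ hs => hs.2

/-- The function `s ↦ s^{-1/2}` on `σ ⊆ (0, ∞)`. -/
def invSqrt (s : σ) : ℂ := (((√(s : ℝ))⁻¹ : ℝ) : ℂ)

theorem measurable_invSqrt : Measurable (invSqrt : σ → ℂ) :=
  Complex.measurable_ofReal.comp measurable_subtype_coe.sqrt.inv

theorem star_invSqrt : star (invSqrt : σ → ℂ) = invSqrt := by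
  ext s
  simp [invSqrt]

variable {c : ℝ}

theorem bddExhaustion_sublevel_coe (hc0 : 0 ≤ c) (hc : ∀ s : σ, c ≤ s) (hf : Measurable f) :
    BddExhaustion (fun s : σ => ((s : ℝ) : ℂ)) (sublevel f) :=
  bddExhaustion_sublevel hf measurable_subtype_coe (fun s => hc0.trans (hc s)) fun _ _ hs => hs.1

theorem norm_invSqrt_le (hc0 : 0 < c) (hc : ∀ s : σ, c ≤ s) (s : σ) :
    ‖invSqrt s‖ ≤ (√c)⁻¹ := by
  rw [invSqrt, Complex.norm_real, Real.norm_of_nonneg (by positivity)]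
  exact inv_anti₀ (Real.sqrt_pos.2 hc0) (Real.sqrt_le_sqrt (hc s))

theorem bddMeas_invSqrt (hc0 : 0 < c) (hc : ∀ s : σ, c ≤ s) : BddMeas (invSqrt : σ → ℂ) :=
  ⟨measurable_invSqrt, _, norm_invSqrt_le hc0 hc⟩

theorem invSqrt_mul_sqrt (hc0 : 0 < c) (hc : ∀ s : σ, c ≤ s) (s : σ) :
    invSqrt s * ((√(s : ℝ) : ℝ) : ℂ) = 1 := by
  have hs : √(s : ℝ) ≠ 0 := (Real.sqrt_pos.2 (hc0.trans_le (hc s))).ne'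
  rw [invSqrt, ← Complex.ofReal_mul, inv_mul_cancel₀ hs, Complex.ofReal_one]

theorem coe_mul_invSqrt (hc0 : 0 < c) (hc : ∀ s : σ, c ≤ s) (s : σ) :
    ((s : ℝ) : ℂ) * invSqrt s = ((√(s : ℝ) : ℝ) : ℂ) := by
  have hsq : ((s : ℝ) : ℂ) = ((√(s : ℝ) : ℝ) : ℂ) * ((√(s : ℝ) : ℝ) : ℂ) := by
    rw [← Complex.ofReal_mul, Real.mul_self_sqrt (hc0.le.trans (hc s))]
  rw [hsq, mul_assoc, mul_comm _ (invSqrt s), invSqrt_mul_sqrt hc0 hc, mul_one]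

variable {H : Type*} [NormedAddCommGroup H] [InnerProductSpace ℂ H] [CompleteSpace H]
  {E : SpectralMeasure σ H}

theorem bcalc_invSqrt_partOp_sqrt (hc0 : 0 < c) (hc : ∀ s : σ, c ≤ s) (hf : Measurable f)
    (n : ℕ) (x : H) :
    E.bcalc invSqrt (partOp E (fun s => √(s : ℝ)) (sublevel f n) x) =
      E.toFun (sublevel f n) x := by
  have h := bddExhaustion_sublevel_sqrt hf
  rw [partOp, bcalc_bcalc (bddMeas_invSqrt hc0 hc) (h.bddMeas n),
    ← bcalc_indicator_one (h.measurableSet n)]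
  congr 2
  ext s
  by_cases hs : s ∈ sublevel f n <;> simp [hs, invSqrt_mul_sqrt hc0 hc s]

theorem partOp_sqrt_bcalc_invSqrt (hc0 : 0 < c) (hc : ∀ s : σ, c ≤ s) (hf : Measurable f)
    (n : ℕ) (x : H) :
    partOp E (fun s => √(s : ℝ)) (sublevel f n) (E.bcalc invSqrt x) =
      E.toFun (sublevel f n) x := by
  have h := bddExhaustion_sublevel_sqrt hf
  rw [← bcalc_invSqrt_partOp_sqrt hc0 hc hf, partOp,
    bcalc_bcalc (bddMeas_invSqrt hc0 hc) (h.bddMeas n),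
    bcalc_bcalc (h.bddMeas n) (bddMeas_invSqrt hc0 hc), mul_comm]

theorem partOp_coe_bcalc_invSqrt (hc0 : 0 < c) (hc : ∀ s : σ, c ≤ s) (hf : Measurable f)
    (n : ℕ) (x : H) :
    partOp E (fun s => (s : ℝ)) (sublevel f n) (E.bcalc invSqrt x) =
      partOp E (fun s => √(s : ℝ)) (sublevel f n) x := by
  rw [partOp, partOp, bcalc_bcalc ((bddExhaustion_sublevel_coe hc0.le hc hf).bddMeas n)
    (bddMeas_invSqrt hc0 hc)]
  congr 2
  ext s
  by_cases hs : s ∈ sublevel f n <;> simp [hs, coe_mul_invSqrt hc0 hc s]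

theorem bcalc_invSqrt_eq_iff (hc0 : 0 < c) (hc : ∀ s : σ, c ≤ s) (hf : Measurable f) {x y : H} :
    E.bcalc invSqrt x = y ↔
      ∀ n, partOp E (fun s => √(s : ℝ)) (sublevel f n) y = E.toFun (sublevel f n) x := by
  constructor
  · rintro rfl n
    exact partOp_sqrt_bcalc_invSqrt hc0 hc hf n x
  · intro h
    have hex := (bddExhaustion_sublevel_sqrt hf).toIsExhaustion
    refine eq_of_toFun_eq (E := E) hex fun n => ?_
    rw [toFun_comm_bcalc (hex.measurableSet n) (bddMeas_invSqrt hc0 hc), ← h n,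
      bcalc_invSqrt_partOp_sqrt hc0 hc hf]

/-- The generator in the coordinates `(A^{1/2} u, v)`, cut off to `sublevel f n`. -/
def waveGen (E : SpectralMeasure σ H) (f : σ → ℝ) (n : ℕ) :
    WithLp 2 (H × H) →L[ℂ] WithLp 2 (H × H) :=
  waveOp (partOp E (fun s => √(s : ℝ)) (sublevel f n)) (partOp E f (sublevel f n))

/-- The spectral projection onto `sublevel f n`, in both components. -/
def waveProj (E : SpectralMeasure σ H) (f : σ → ℝ) (n : ℕ) :
    WithLp 2 (H × H) →L[ℂ] WithLp 2 (H × H) :=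
  diagOp (E.toFun (sublevel f n))

theorem dissipativeApprox_wave (hf : Measurable f) (hf0 : ∀ s, 0 ≤ f s) :
    DissipativeApprox (waveProj E f) (waveGen E f) :=
  dissipativeApprox_waveOp (bddExhaustion_sublevel_sqrt hf) (bddExhaustion_sublevel_self hf hf0) hf0

theorem waveGen_eq_waveProj_iff (n : ℕ) (z z' : WithLp 2 (H × H)) :
    waveGen E f n z = waveProj E f n z' ↔
      partOp E (fun s => √(s : ℝ)) (sublevel f n) z.snd = E.toFun (sublevel f n) z'.fst ∧
        partOp E (fun s => √(s : ℝ)) (sublevel f n) z.fst + partOp E f (sublevel f n) z.snd =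
          E.toFun (sublevel f n) (-z'.snd) := by
  rw [map_neg, ← neg_eq_iff_eq_neg, neg_add, ← sub_eq_add_neg]
  exact ⟨fun h => ⟨congrArg (fun w => w.fst) h, congrArg (fun w => w.snd) h⟩,
    fun h => withLp_prod_ext h.1 h.2⟩

end Wave

/-! ### The phase space -/

section PhaseSpace

open SpectralMeasure

variable {H : Type*} [NormedAddCommGroup H] [InnerProductSpace ℂ H] [CompleteSpace H]
  {A : H →ₗ.[ℂ] H}

theorem exists_spectralMeasure_funCalc [Nontrivial H] (hA : IsSelfAdjoint A)
    (hpos : StrictlyPositive A) : ∃ E : SpectralMeasure (spec A) H, IsSpectralMeasureOf A E ∧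
      ∀ φ, funCalc A φ = E.integral φ := by
  have h := exists_isSpectralMeasureOf hA hpos
  exact ⟨h.choose, h.choose_spec, fun φ => dif_pos h⟩

variable {E : SpectralMeasure (spec A) H} {c : ℝ} {f : spec A → ℝ}

theorem mem_graph_sqrtOp_iff (hE : ∀ φ, funCalc A φ = E.integral φ) (hc0 : 0 < c)
    (hc : ∀ s : spec A, c ≤ s) {u x : H} :
    (u, x) ∈ (sqrtOp A).graph ↔ E.bcalc invSqrt x = u := by
  have hmeas : Measurable fun s : spec A => ((√(s : ℝ) : ℝ) : ℂ) := by fun_prop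
  rw [sqrtOp, hE]
  exact (isIntegral_integral hmeas).mem_graph_iff_of_inv hmeas (bddMeas_invSqrt hc0 hc)
    (invSqrt_mul_sqrt hc0 hc)

theorem bcalc_invSqrt_sqrtMap (hE : ∀ φ, funCalc A φ = E.integral φ) (hc0 : 0 < c)
    (hc : ∀ s : spec A, c ≤ s) (u : HOne A) :
    E.bcalc invSqrt (HOne.sqrtMap A u) = HOne.incl A u :=
  (mem_graph_sqrtOp_iff hE hc0 hc).1 ((sqrtOp A).mem_graph u)

theorem bijective_sqrtMap (hE : ∀ φ, funCalc A φ = E.integral φ) (hc0 : 0 < c)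
    (hc : ∀ s : spec A, c ≤ s) : Function.Bijective (HOne.sqrtMap A) := by
  constructor
  · intro u v huv
    refine Subtype.ext (?_ : HOne.incl A u = HOne.incl A v)
    rw [← bcalc_invSqrt_sqrtMap hE hc0 hc, ← bcalc_invSqrt_sqrtMap hE hc0 hc, huv]
  · intro x
    obtain ⟨u, -, hu⟩ := (sqrtOp A).mem_graph_iff.1
      ((mem_graph_sqrtOp_iff hE hc0 hc (x := x)).2 rfl)
    exact ⟨u, hu⟩

/-- The isometric isomorphism `(u, v) ↦ (A^{1/2} u, v)` from the phase space onto `H ⊕ H`. -/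
def phaseEquiv (h : Function.Bijective (HOne.sqrtMap A)) : Phase A ≃ₗᵢ[ℂ] WithLp 2 (H × H) where
  toLinearEquiv := (WithLp.linearEquiv 2 ℂ (HOne A × H)).trans
    (((LinearEquiv.ofBijective (HOne.sqrtMap A) h).prodCongr (LinearEquiv.refl ℂ H)).trans
      (WithLp.linearEquiv 2 ℂ (H × H)).symm)
  norm_map' z := by
    rw [← sq_eq_sq₀ (norm_nonneg _) (norm_nonneg _), Phase.norm_sq, WithLp.prod_norm_sq_eq_of_L2]
    rfl

theorem phaseEquiv_apply_fst (h : Function.Bijective (HOne.sqrtMap A)) (z : Phase A) :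
    (phaseEquiv h z).fst = HOne.sqrtMap A z.fst := rfl

theorem phaseEquiv_apply_snd (h : Function.Bijective (HOne.sqrtMap A)) (z : Phase A) :
    (phaseEquiv h z).snd = z.snd := rfl

theorem mem_evolutionGraph_iff (hA : IsSpectralMeasureOf A E)
    (hE : ∀ φ, funCalc A φ = E.integral φ) (hc0 : 0 < c) (hc : ∀ s : spec A, c ≤ s)
    (hf : Measurable f) (hf0 : ∀ s, 0 ≤ f s) (h : Function.Bijective (HOne.sqrtMap A))
    (p : Phase A × Phase A) :
    p ∈ evolutionGraph A f ↔
      ∀ n, waveGen E f n (phaseEquiv h p.1) = waveProj E f n (phaseEquiv h p.2) := by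
  have hcoe := bddExhaustion_sublevel_coe hc0.le hc hf
  have hself := bddExhaustion_sublevel_self hf hf0
  have hF : E.IsIntegral (fun s => (f s : ℂ)) (funCalc A fun s => (f s : ℂ)) := by
    rw [hE]
    exact isIntegral_integral hself.measurable
  simp only [waveGen_eq_waveProj_iff, forall_and, phaseEquiv_apply_fst, phaseEquiv_apply_snd,
    ← bcalc_invSqrt_eq_iff hc0 hc hf]
  simp only [← partOp_coe_bcalc_invSqrt hc0 hc hf, bcalc_invSqrt_sqrtMap hE hc0 hc]
  exact and_congr Iff.rfl ⟨partOp_add_partOp_of_forall_inner_add hcoe hself hA hF,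
    forall_inner_add_of_partOp_add_partOp hcoe hself hA hF⟩

end PhaseSpace

section Transport

variable {X Y : Type*} [SeminormedAddCommGroup X] [NormedSpace ℂ X] [SeminormedAddCommGroup Y]
  [NormedSpace ℂ Y]

/-- The operator `J⁻¹ T J`. -/
def conjOp (J : X ≃ₗᵢ[ℂ] Y) (T : Y →L[ℂ] Y) : X →L[ℂ] X :=
  (J.symm.toContinuousLinearEquiv : Y →L[ℂ] X) ∘L T ∘L (J.toContinuousLinearEquiv : X →L[ℂ] Y)

theorem conjOp_apply (J : X ≃ₗᵢ[ℂ] Y) (T : Y →L[ℂ] Y) (x : X) : conjOp J T x = J.symm (T (J x)) :=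
  rfl

theorem apply_conjOp (J : X ≃ₗᵢ[ℂ] Y) (T : Y →L[ℂ] Y) (x : X) : J (conjOp J T x) = T (J x) :=
  J.apply_symm_apply _

theorem conjOp_symm_conjOp (J : X ≃ₗᵢ[ℂ] Y) (T : Y →L[ℂ] Y) : conjOp J.symm (conjOp J T) = T := by
  ext y
  simp [conjOp_apply]

variable {S : ℝ≥0 → Y →L[ℂ] Y}

theorem IsC0Semigroup.conjOp (hS : IsC0Semigroup S) (J : X ≃ₗᵢ[ℂ] Y) :
    IsC0Semigroup fun t => conjOp J (S t) where
  zero := by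
    ext x
    rw [conjOp_apply, hS.zero]
    exact J.symm_apply_apply x
  add s t := by
    ext x
    rw [ContinuousLinearMap.comp_apply, conjOp_apply, conjOp_apply, apply_conjOp, hS.add,
      ContinuousLinearMap.comp_apply]
  tendsto x := by
    have h := (J.symm.continuous.tendsto (J x)).comp (hS.tendsto (J x))
    rwa [J.symm_apply_apply] at h

theorem mem_generatorGraph_conjOp (J : X ≃ₗᵢ[ℂ] Y) (p : X × X) :
    p ∈ generatorGraph (fun t => conjOp J (S t)) ↔ (J p.1, J p.2) ∈ generatorGraph S := by
  constructor
  · exact map_mem_generatorGraph (J.toContinuousLinearEquiv : X →L[ℂ] Y)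
      fun t x => apply_conjOp J (S t) x
  · intro h
    have hsymm := map_mem_generatorGraph (T := fun t => DampedEvolution.conjOp J (S t))
      (J.symm.toContinuousLinearEquiv : Y →L[ℂ] X)
      (fun t y => by simp [conjOp_apply]) h
    simpa using hsymm

theorem ExponentiallyStable.conjOp (hS : ExponentiallyStable S) (J : X ≃ₗᵢ[ℂ] Y) :
    ExponentiallyStable fun t => conjOp J (S t) := by
  obtain ⟨κ, hκ, M, hM, h⟩ := hS
  refine ⟨κ, hκ, M, hM, fun t x => ?_⟩
  rw [conjOp_apply, J.symm.norm_map, ← J.norm_map x]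
  exact h t (J x)

theorem exponentiallyStable_conjOp_iff (J : X ≃ₗᵢ[ℂ] Y) :
    ExponentiallyStable (fun t => conjOp J (S t)) ↔ ExponentiallyStable S := by
  refine ⟨fun h => ?_, fun h => h.conjOp J⟩
  simpa only [conjOp_symm_conjOp] using h.conjOp J.symm

end Transport

/-! ### Decay of bounded semigroups -/

section Decay

theorem le_exp_mul_of_hasDerivAt_le {v v' : ℝ → ℝ} {κ : ℝ} (hv : ∀ t, HasDerivAt v (v' t) t)
    (h : ∀ t, v' t ≤ -κ * v t) {t : ℝ} (ht : 0 ≤ t) : v t ≤ Real.exp (-κ * t) * v 0 := by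
  have hderiv : ∀ s, HasDerivAt (fun s => Real.exp (κ * s) * v s)
      (Real.exp (κ * s) * κ * v s + Real.exp (κ * s) * v' s) s := fun s =>
    (hasDerivAt_const_mul κ).exp.mul (hv s)
  have hanti : Antitone fun s => Real.exp (κ * s) * v s := by
    refine antitone_of_hasDerivAt_nonpos hderiv fun s => ?_
    have := mul_le_mul_of_nonneg_left (h s) (Real.exp_pos (κ * s)).le
    simp only [Pi.zero_apply]
    linarith
  have hle : Real.exp (κ * t) * v t ≤ v 0 := by simpa using hanti ht
  rwa [neg_mul, Real.exp_neg, ← div_eq_inv_mul, le_div_iff₀' (Real.exp_pos _)]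

variable {K : Type*} [NormedAddCommGroup K] [InnerProductSpace ℂ K] [CompleteSpace K]

theorem norm_exp_smul_exp_apply_sub_le {G : K →L[ℂ] K} (hG : ∀ z, (⟪z, G z⟫_ℂ).re ≤ 0) (μ : ℂ)
    (z : K) {T : ℝ} (hT : 0 ≤ T) :
    ‖Complex.exp (-(T * μ)) • NormedSpace.exp (T • G) z - z‖ ≤
      Real.exp (T * ‖μ‖) * ‖G z - μ • z‖ * T := by
  have hderiv : ∀ t : ℝ, HasDerivAt
      (fun t : ℝ => Complex.exp (-(t * μ)) • NormedSpace.exp (t • G) z)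
      (Complex.exp (-(t * μ)) • NormedSpace.exp (t • G) (G z - μ • z)) t := fun t => by
    have hlin : HasDerivAt (fun t : ℝ => -((t : ℂ) * μ)) (-μ) t := by
      have h := ((hasDerivAt_id t).ofReal_comp.mul_const μ).neg
      rwa [Complex.ofReal_one, one_mul] at h
    refine (hlin.cexp.smul (hasDerivAt_exp_apply G z t)).congr_deriv ?_
    rw [map_sub, map_smul, smul_sub, smul_smul, mul_neg, neg_smul, sub_eq_add_neg]
  have hbound : ∀ t ∈ Set.Ico 0 T,
      ‖Complex.exp (-(t * μ)) • NormedSpace.exp (t • G) (G z - μ • z)‖ ≤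
        Real.exp (T * ‖μ‖) * ‖G z - μ • z‖ := fun t ht => by
    have hre : (-((t : ℂ) * μ)).re ≤ T * ‖μ‖ :=
      calc (-((t : ℂ) * μ)).re ≤ ‖-((t : ℂ) * μ)‖ := Complex.re_le_norm _
        _ = t * ‖μ‖ := by rw [norm_neg, norm_mul, Complex.norm_real, Real.norm_of_nonneg ht.1]
        _ ≤ T * ‖μ‖ := mul_le_mul_of_nonneg_right ht.2.le (norm_nonneg _)
    rw [norm_smul, Complex.norm_exp]
    exact mul_le_mul (Real.exp_le_exp.2 hre) (norm_exp_apply_le hG ht.1 _) (norm_nonneg _)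
      (Real.exp_pos _).le
  simpa [exp_zero_apply] using norm_image_sub_le_of_norm_deriv_le_segment'
    (fun t _ => (hderiv t).hasDerivWithinAt) hbound T ⟨hT, le_rfl⟩

-- At a late time `T`, `exp (T G) z` is close to `exp (T μ) z` and small compared with it. The
-- tolerance `δ` depends on `T` but not on `G`, so that it serves all the truncations at once.
theorem exists_pos_forall_eq_zero_of_norm_sub_smul_le {κ M : ℝ} {μ : ℂ} (hμ : -κ < μ.re) :
    ∃ δ : ℝ, 0 < δ ∧ ∀ (G : K →L[ℂ] K), (∀ z, (⟪z, G z⟫_ℂ).re ≤ 0) → ∀ z : K,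
      (∀ t : ℝ, 0 ≤ t → ‖NormedSpace.exp (t • G) z‖ ≤ M * Real.exp (-κ * t) * ‖z‖) →
      ‖G z - μ • z‖ ≤ δ * ‖z‖ → z = 0 := by
  have hlim : Tendsto (fun t : ℝ => M * Real.exp (-((κ + μ.re) * t))) atTop (𝓝 (M * 0)) :=
    (Real.tendsto_exp_neg_atTop_nhds_zero.comp
      (tendsto_id.const_mul_atTop (by linarith))).const_mul M
  rw [mul_zero] at hlim
  obtain ⟨T, hT, hT0⟩ := ((hlim.eventually (gt_mem_nhds one_half_pos)).and
    (eventually_gt_atTop 0)).exists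
  refine ⟨(1 / 2) / (Real.exp (T * ‖μ‖) * T), by positivity, fun G hG z hz hδ => ?_⟩
  by_contra hz0
  set w := Complex.exp (-(T * μ)) • NormedSpace.exp (T • G) z
  have hclose : ‖w - z‖ ≤ 1 / 2 * ‖z‖ :=
    calc ‖w - z‖ ≤ Real.exp (T * ‖μ‖) * ‖G z - μ • z‖ * T :=
          norm_exp_smul_exp_apply_sub_le hG μ z hT0.le
      _ ≤ Real.exp (T * ‖μ‖) * ((1 / 2) / (Real.exp (T * ‖μ‖) * T) * ‖z‖) * T := by gcongr
      _ = 1 / 2 * ‖z‖ := by field_simp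
  have hsmall : ‖w‖ < 1 / 2 * ‖z‖ :=
    calc ‖w‖ ≤ Real.exp (-(T * μ)).re * (M * Real.exp (-κ * T) * ‖z‖) := by
          rw [norm_smul, Complex.norm_exp]
          exact mul_le_mul_of_nonneg_left (hz T hT0.le) (Real.exp_pos _).le
      _ = M * (Real.exp (-(T * μ)).re * Real.exp (-κ * T)) * ‖z‖ := by ring
      _ = M * Real.exp (-((κ + μ.re) * T)) * ‖z‖ := by
          rw [← Real.exp_add, Complex.neg_re, Complex.re_ofReal_mul]
          ring_nf
      _ < 1 / 2 * ‖z‖ := mul_lt_mul_of_pos_right hT (norm_pos_iff.2 hz0)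
  have htri : ‖z‖ ≤ ‖w‖ + ‖w - z‖ := by simpa using norm_sub_le w (w - z)
  linarith

end Decay

/-! ### Sufficiency: a Lyapunov functional -/

section Lyapunov

variable {H : Type*} [NormedAddCommGroup H] [InnerProductSpace ℂ H]
  {Q a F R : H →L[ℂ] H} {m C r ε : ℝ}

/-- The Lyapunov functional `½ ‖(x, y)‖² + ε Re ⟨R x, y⟩`; with `R = A^{-1/2}` and `x = A^{1/2} u`
the cross term is `ε Re ⟨u, v⟩`. -/
def lyapunov (R : H →L[ℂ] H) (ε : ℝ) (z : WithLp 2 (H × H)) : ℝ :=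
  1 / 2 * ‖z‖ ^ 2 + ε * (⟪R z.fst, z.snd⟫_ℂ).re

/-- The damping bounds behind the Lyapunov argument: on the range of the projection `Q` the
operator `a` is inverted by `R`, and `F` is bounded below by `m` and above by `C a²`. -/
structure IsDamped (Q a F R : H →L[ℂ] H) (m C r : ℝ) : Prop where
  isSymmetric_freq : (a : H →ₗ[ℂ] H).IsSymmetric
  isSymmetric_inv : (R : H →ₗ[ℂ] H).IsSymmetric
  inv_freq : ∀ x, R (a x) = Q x
  norm_inv_le : ∀ x, ‖R x‖ ≤ r * ‖x‖
  le_damping : ∀ y, Q y = y → m * ‖y‖ ^ 2 ≤ (⟪y, F y⟫_ℂ).re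
  norm_sq_inv_damping_le : ∀ y, ‖R (F y)‖ ^ 2 ≤ C * (⟪y, F y⟫_ℂ).re

theorem abs_cross_term_le (hR : ∀ x, ‖R x‖ ≤ r * ‖x‖) (hε : 0 ≤ ε) (hεr : ε * r ≤ 1 / 2)
    (z : WithLp 2 (H × H)) : |ε * (⟪R z.fst, z.snd⟫_ℂ).re| ≤ 1 / 4 * ‖z‖ ^ 2 :=
  calc |ε * (⟪R z.fst, z.snd⟫_ℂ).re| = ε * |(⟪R z.fst, z.snd⟫_ℂ).re| := by
        rw [abs_mul, abs_of_nonneg hε]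
    _ ≤ ε * (r * ‖z.fst‖ * ‖z.snd‖) := by
        have hCS := (Complex.abs_re_le_norm _).trans (norm_inner_le_norm (𝕜 := ℂ) (R z.fst) z.snd)
        exact mul_le_mul_of_nonneg_left
          (hCS.trans (mul_le_mul_of_nonneg_right (hR _) (norm_nonneg _))) hε
    _ = ε * r * (‖z.fst‖ * ‖z.snd‖) := by ring
    _ ≤ 1 / 2 * (‖z.fst‖ * ‖z.snd‖) := mul_le_mul_of_nonneg_right hεr (by positivity)
    _ ≤ 1 / 4 * ‖z‖ ^ 2 := by
        rw [WithLp.prod_norm_sq_eq_of_L2]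
        linarith [two_mul_le_add_sq ‖z.fst‖ ‖z.snd‖]

theorem norm_sq_le_lyapunov (hR : ∀ x, ‖R x‖ ≤ r * ‖x‖) (hε : 0 ≤ ε) (hεr : ε * r ≤ 1 / 2)
    (z : WithLp 2 (H × H)) : 1 / 4 * ‖z‖ ^ 2 ≤ lyapunov R ε z := by
  rw [lyapunov]
  linarith [neg_le_of_abs_le (abs_cross_term_le hR hε hεr z)]

theorem lyapunov_le_norm_sq (hR : ∀ x, ‖R x‖ ≤ r * ‖x‖) (hε : 0 ≤ ε) (hεr : ε * r ≤ 1 / 2)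
    (z : WithLp 2 (H × H)) : lyapunov R ε z ≤ ‖z‖ ^ 2 := by
  rw [lyapunov]
  linarith [le_of_abs_le (abs_cross_term_le hR hε hεr z), sq_nonneg ‖z‖]

theorem hasDerivAt_lyapunov {z : ℝ → WithLp 2 (H × H)} {z' : WithLp 2 (H × H)} {t : ℝ}
    (hz : HasDerivAt z z' t) :
    HasDerivAt (fun t => lyapunov R ε (z t))
      ((⟪z t, z'⟫_ℂ).re + ε * (⟪R (z t).fst, z'.snd⟫_ℂ + ⟪R z'.fst, (z t).snd⟫_ℂ).re) t := by
  have hfst : HasDerivAt (fun t => R (z t).fst) (R z'.fst) t :=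
    ((R ∘L WithLp.fstL 2 ℂ H H).restrictScalars ℝ).hasFDerivAt.comp_hasDerivAt t hz
  have hsnd : HasDerivAt (fun t => (z t).snd) z'.snd t :=
    ((WithLp.sndL 2 ℂ H H).restrictScalars ℝ).hasFDerivAt.comp_hasDerivAt t hz
  refine (((hasDerivAt_norm_sq hz).const_mul (1 / 2)).add
    ((Complex.reCLM.hasFDerivAt.comp_hasDerivAt t (hfst.inner ℂ hsnd)).const_mul ε)).congr_deriv ?_
  rw [← mul_assoc, one_div, inv_mul_cancel₀ two_ne_zero, one_mul]
  rfl

namespace IsDamped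

theorem lyapunov_deriv_eq (h : IsDamped Q a F R m C r) (ε : ℝ) {z : WithLp 2 (H × H)}
    (hz : diagOp Q z = z) :
    (⟪z, waveOp a F z⟫_ℂ).re +
        ε * (⟪R z.fst, (waveOp a F z).snd⟫_ℂ + ⟪R (waveOp a F z).fst, z.snd⟫_ℂ).re =
      -(⟪z.snd, F z.snd⟫_ℂ).re +
        ε * (‖z.snd‖ ^ 2 - ‖z.fst‖ ^ 2 - (⟪z.fst, R (F z.snd)⟫_ℂ).re) := by
  have hQfst : Q z.fst = z.fst := congrArg (fun w => w.fst) hz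
  have hQsnd : Q z.snd = z.snd := congrArg (fun w => w.snd) hz
  have hfst : ⟪R z.fst, a z.fst⟫_ℂ = ((‖z.fst‖ ^ 2 : ℝ) : ℂ) := by
    have hsymm : ⟪R z.fst, a z.fst⟫_ℂ = ⟪z.fst, R (a z.fst)⟫_ℂ := h.isSymmetric_inv _ _
    rw [hsymm, h.inv_freq, hQfst, inner_self_eq_norm_sq_to_K]
    norm_cast
  have hsnd : ⟪R (a z.snd), z.snd⟫_ℂ = ((‖z.snd‖ ^ 2 : ℝ) : ℂ) := by
    rw [h.inv_freq, hQsnd, inner_self_eq_norm_sq_to_K]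
    norm_cast
  have hmixed : ⟪R z.fst, F z.snd⟫_ℂ = ⟪z.fst, R (F z.snd)⟫_ℂ := h.isSymmetric_inv _ _
  rw [re_inner_waveOp_self h.isSymmetric_freq, waveOp_apply_fst, waveOp_apply_snd, inner_sub_right,
    inner_neg_right, hfst, hsnd, hmixed]
  simp only [Complex.add_re, Complex.sub_re, Complex.neg_re, Complex.ofReal_re]
  ring

theorem neg_re_inner_le (h : IsDamped Q a F R m C r) (x y : H) :
    -(⟪x, R (F y)⟫_ℂ).re ≤ 1 / 2 * ‖x‖ ^ 2 + 1 / 2 * (C * (⟪y, F y⟫_ℂ).re) :=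
  calc -(⟪x, R (F y)⟫_ℂ).re ≤ ‖x‖ * ‖R (F y)‖ := (neg_le_abs _).trans
        ((Complex.abs_re_le_norm _).trans (norm_inner_le_norm _ _))
    _ ≤ 1 / 2 * ‖x‖ ^ 2 + 1 / 2 * ‖R (F y)‖ ^ 2 := by
        linarith [two_mul_le_add_sq ‖x‖ ‖R (F y)‖]
    _ ≤ 1 / 2 * ‖x‖ ^ 2 + 1 / 2 * (C * (⟪y, F y⟫_ℂ).re) := by
        linarith [h.norm_sq_inv_damping_le y]

theorem lyapunov_deriv_le (h : IsDamped Q a F R m C r) (hε : 0 ≤ ε) (hεC : ε * C ≤ 1)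
    (hεm : ε ≤ m / 4) (hεr : ε * r ≤ 1 / 2) {z : WithLp 2 (H × H)} (hz : diagOp Q z = z) :
    (⟪z, waveOp a F z⟫_ℂ).re +
        ε * (⟪R z.fst, (waveOp a F z).snd⟫_ℂ + ⟪R (waveOp a F z).fst, z.snd⟫_ℂ).re ≤
      -(ε / 2) * lyapunov R ε z := by
  set I := (⟪z.snd, F z.snd⟫_ℂ).re
  have hI : m * ‖z.snd‖ ^ 2 ≤ I := h.le_damping _ (congrArg (fun w => w.snd) hz)
  have hεI : ε * C * I ≤ I := mul_le_of_le_one_left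
    (le_trans (mul_nonneg (by linarith) (sq_nonneg _)) hI) hεC
  have hεy := mul_le_mul_of_nonneg_right hεm (sq_nonneg ‖z.snd‖)
  have hmixed := mul_le_mul_of_nonneg_left (h.neg_re_inner_le z.fst z.snd) hε
  have hV := mul_le_mul_of_nonneg_left (lyapunov_le_norm_sq h.norm_inv_le hε hεr z) hε
  rw [WithLp.prod_norm_sq_eq_of_L2] at hV
  rw [h.lyapunov_deriv_eq ε hz]
  linarith [mul_nonneg hε (sq_nonneg ‖z.snd‖)]

theorem norm_le_of_hasDerivAt (h : IsDamped Q a F R m C r) (hε : 0 ≤ ε) (hεC : ε * C ≤ 1)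
    (hεm : ε ≤ m / 4) (hεr : ε * r ≤ 1 / 2) {z : ℝ → WithLp 2 (H × H)}
    (hz : ∀ t, HasDerivAt z (waveOp a F (z t)) t) (hQ : ∀ t, diagOp Q (z t) = z t) {t : ℝ}
    (ht : 0 ≤ t) : ‖z t‖ ≤ 2 * Real.exp (-(ε / 4) * t) * ‖z 0‖ := by
  have hexp : Real.exp (-(ε / 4) * t) ^ 2 = Real.exp (-(ε / 2) * t) := by
    rw [← Real.exp_nat_mul]
    congr 1
    push_cast
    ring
  have hV : lyapunov R ε (z t) ≤ Real.exp (-(ε / 2) * t) * lyapunov R ε (z 0) :=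
    le_exp_mul_of_hasDerivAt_le (fun t => hasDerivAt_lyapunov (hz t))
      (fun t => h.lyapunov_deriv_le hε hεC hεm hεr (hQ t)) ht
  have hsq : 1 / 4 * ‖z t‖ ^ 2 ≤ Real.exp (-(ε / 2) * t) * ‖z 0‖ ^ 2 :=
    calc 1 / 4 * ‖z t‖ ^ 2 ≤ lyapunov R ε (z t) := norm_sq_le_lyapunov h.norm_inv_le hε hεr _
      _ ≤ Real.exp (-(ε / 2) * t) * lyapunov R ε (z 0) := hV
      _ ≤ Real.exp (-(ε / 2) * t) * ‖z 0‖ ^ 2 := mul_le_mul_of_nonneg_left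
          (lyapunov_le_norm_sq h.norm_inv_le hε hεr _) (Real.exp_pos _).le
  refine le_of_sq_le_sq ?_ (by positivity)
  rw [mul_pow, mul_pow, hexp]
  linarith

end IsDamped

theorem exists_pos_mul_le (C : ℝ) (r : ℝ) (hm : 0 < m) :
    ∃ ε : ℝ, 0 < ε ∧ ε * C ≤ 1 ∧ ε ≤ m / 4 ∧ ε * r ≤ 1 / 2 := by
  have hlim : ∀ b : ℝ, Tendsto (fun ε : ℝ => ε * b) (𝓝[>] 0) (𝓝 0) := fun b =>
    ((continuous_mul_const b).tendsto' 0 0 (zero_mul b)).mono_left nhdsWithin_le_nhds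
  have hid : Tendsto (fun ε : ℝ => ε) (𝓝[>] 0) (𝓝 0) := tendsto_id.mono_left nhdsWithin_le_nhds
  obtain ⟨ε, ⟨hεC, hεm⟩, hεr, hε⟩ := (((hlim C).eventually_le_const one_pos).and
    (hid.eventually_le_const (by positivity : 0 < m / 4))).and
      (((hlim r).eventually_le_const one_half_pos).and self_mem_nhdsWithin) |>.exists
  exact ⟨ε, hε, hεC, hεm, hεr⟩

end Lyapunov

section Sufficiency

open SpectralMeasure

variable {H : Type*} [NormedAddCommGroup H] [InnerProductSpace ℂ H] [CompleteSpace H]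

section Estimates

variable {α : Type*} [MeasurableSpace α] {E : SpectralMeasure α H} {f : α → ℝ} {ω : Set α}

theorem mul_norm_sq_le_re_inner_partOp (hω : MeasurableSet ω)
    (hf : BddMeas (ω.indicator fun s => (f s : ℂ))) {m : ℝ} (hm : ∀ s ∈ ω, m ≤ f s) {y : H}
    (hy : E.toFun ω y = y) : m * ‖y‖ ^ 2 ≤ (⟪y, partOp E f ω y⟫_ℂ).re := by
  have hint : IntegrableOn f ω (E.diag y) :=
    ((integrable_indicator_iff hω).1 (hf.integrable (E.diag y))).re
  have hle := setIntegral_mono_on (integrableOn_const (measure_ne_top (E.diag y) ω)) hint hω hm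
  rwa [setIntegral_const, smul_eq_mul, E.diag_real y hω, hy, mul_comm, ← Complex.ofReal_re
    (∫ s in ω, f s ∂(E.diag y)), ← inner_partOp_self hω hf] at hle

theorem norm_sq_bcalc_partOp_le (hω : MeasurableSet ω)
    (hf : BddMeas (ω.indicator fun s => (f s : ℂ))) (hf0 : ∀ s, 0 ≤ f s) {φ : α → ℂ}
    (hφ : BddMeas φ) {C : ℝ} (hC : ∀ s, ‖φ s‖ ^ 2 * f s ≤ C) (y : H) :
    ‖E.bcalc φ (partOp E f ω y)‖ ^ 2 ≤ C * (⟪y, partOp E f ω y⟫_ℂ).re := by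
  have hφf := hφ.mul hf
  have hint : Integrable (fun s => ‖(φ * ω.indicator fun s => (f s : ℂ)) s‖ ^ 2) (E.diag y) :=
    ((hφf.mul hφf).integrable (E.diag y)).norm.congr
      (Eventually.of_forall fun s => by simp [sq])
  have hint' : Integrable (fun s => C * ω.indicator f s) (E.diag y) :=
    ((integrable_indicator_iff hω).2
      ((integrable_indicator_iff hω).1 (hf.integrable (E.diag y))).re).const_mul C
  rw [inner_partOp_self hω hf, Complex.ofReal_re, partOp, bcalc_bcalc hφ hf, norm_sq_bcalc hφf,
    ← integral_indicator hω, ← integral_const_mul]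
  refine integral_mono hint hint' fun s => ?_
  by_cases hs : s ∈ ω
  · have hle := mul_le_mul_of_nonneg_right (hC s) (hf0 s)
    simpa [hs, mul_pow, mul_assoc, sq (f s)] using hle
  · simp [hs]

end Estimates

variable {σ : Set ℝ} {E : SpectralMeasure σ H} {f : σ → ℝ} {c m C : ℝ}

theorem isDamped_wave (hc0 : 0 < c) (hc : ∀ s : σ, c ≤ s) (hf : Measurable f)
    (hf0 : ∀ s, 0 ≤ f s) (hm : ∀ s, m ≤ f s) (hC : ∀ s : σ, f s / s ≤ C) (n : ℕ) :
    IsDamped (E.toFun (sublevel f n)) (partOp E (fun s => √(s : ℝ)) (sublevel f n))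
      (partOp E f (sublevel f n)) (E.bcalc invSqrt) m C (√c)⁻¹ where
  isSymmetric_freq := isSymmetric_partOp ((bddExhaustion_sublevel_sqrt hf).bddMeas n)
  isSymmetric_inv := inner_bcalc_left_of_real (bddMeas_invSqrt hc0 hc) star_invSqrt
  inv_freq := bcalc_invSqrt_partOp_sqrt hc0 hc hf n
  norm_inv_le := norm_bcalc_le measurable_invSqrt (by positivity) (norm_invSqrt_le hc0 hc)
  le_damping _ := mul_norm_sq_le_re_inner_partOp
    ((bddExhaustion_sublevel_self hf hf0).measurableSet n)
    ((bddExhaustion_sublevel_self hf hf0).bddMeas n) fun s _ => hm s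
  norm_sq_inv_damping_le := by
    refine norm_sq_bcalc_partOp_le ((bddExhaustion_sublevel_self hf hf0).measurableSet n)
      ((bddExhaustion_sublevel_self hf hf0).bddMeas n) hf0 (bddMeas_invSqrt hc0 hc) fun s => ?_
    rw [invSqrt, Complex.norm_real, Real.norm_eq_abs, sq_abs, inv_pow,
      Real.sq_sqrt (hc0.le.trans (hc s)), ← div_eq_inv_mul]
    exact hC s

theorem exists_norm_exp_waveGen_le (hc0 : 0 < c) (hc : ∀ s : σ, c ≤ s) (hf : Measurable f)
    (hm0 : 0 < m) (hm : ∀ s, m ≤ f s) (hC : ∀ s : σ, f s / s ≤ C) :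
    ∃ κ : ℝ, 0 < κ ∧ ∀ (n : ℕ) (z : WithLp 2 (H × H)) (t : ℝ), 0 ≤ t →
      ‖NormedSpace.exp (t • waveGen E f n) (waveProj E f n z)‖ ≤
        2 * Real.exp (-κ * t) * ‖z‖ := by
  have hf0 : ∀ s, 0 ≤ f s := fun s => hm0.le.trans (hm s)
  have hD := dissipativeApprox_wave (E := E) hf hf0
  obtain ⟨ε, hε, hεC, hεm, hεr⟩ := exists_pos_mul_le C (√c)⁻¹ hm0
  refine ⟨ε / 4, by positivity, fun n z t ht => ?_⟩
  have hidem : waveProj E f n (waveProj E f n z) = waveProj E f n z :=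
    congrArg (fun T : WithLp 2 (H × H) →L[ℂ] WithLp 2 (H × H) => T z) (hD.mul_proj n n le_rfl)
  have hproj : ∀ t : ℝ,
      waveProj E f n (NormedSpace.exp (t • waveGen E f n) (waveProj E f n z)) =
        NormedSpace.exp (t • waveGen E f n) (waveProj E f n z) := fun t => by
    rw [hD.proj_exp le_rfl, hidem]
  have hdecay := (isDamped_wave (E := E) hc0 hc hf hf0 hm hC n).norm_le_of_hasDerivAt hε.le hεC hεm
    hεr (fun t => (hasDerivAt_exp_apply (waveGen E f n) (waveProj E f n z) t).congr_deriv
      (exp_apply_comm _ _ t)) hproj ht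
  rw [exp_zero_apply] at hdecay
  exact hdecay.trans (mul_le_mul_of_nonneg_left (hD.norm_le n z) (by positivity))

end Sufficiency

/-! ### Necessity: approximate eigenvectors -/

section ApproxEigenvectors

open SpectralMeasure

theorem norm_le_norm_fst_add_norm_snd {X Y : Type*} [SeminormedAddCommGroup X]
    [SeminormedAddCommGroup Y] (z : WithLp 2 (X × Y)) : ‖z‖ ≤ ‖z.fst‖ + ‖z.snd‖ := by
  refine le_of_sq_le_sq ?_ (by positivity)
  rw [WithLp.prod_norm_sq_eq_of_L2, add_sq']
  linarith [mul_nonneg (norm_nonneg z.fst) (norm_nonneg z.snd)]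

variable {H : Type*} [NormedAddCommGroup H] [InnerProductSpace ℂ H]

theorem norm_waveOp_sub_smul_le {a F : H →L[ℂ] H} {r b η : ℝ} (hr : 0 ≤ r) {μ : ℂ}
    (hμ : μ ^ 2 + b * μ + r ^ 2 = 0) {w : H} (ha : ‖a w - (r : ℂ) • w‖ ≤ η * ‖w‖)
    (hF : ‖F w - (b : ℂ) • w‖ ≤ η * ‖w‖) {z : WithLp 2 (H × H)}
    (hz : z = WithLp.toLp 2 ((r : ℂ) • w, μ • w)) :
    ‖waveOp a F z - μ • z‖ ≤ (2 * ‖μ‖ + r) * η * ‖w‖ := by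
  set p := a w - (r : ℂ) • w with hp
  set q := F w - (b : ℂ) • w with hq
  have hfst : (waveOp a F z - μ • z).fst = μ • p := by
    subst hz
    change a (μ • w) - μ • (r : ℂ) • w = μ • p
    rw [map_smul, smul_sub]
  have hsnd : (waveOp a F z - μ • z).snd = -((r : ℂ) • p) - μ • q := by
    subst hz
    change -a ((r : ℂ) • w) - F (μ • w) - μ • μ • w = -((r : ℂ) • p) - μ • q
    have hroot : (μ ^ 2 + b * μ + r ^ 2) • w = 0 := by rw [hμ, zero_smul]
    rw [map_smul, map_smul, hp, hq]
    linear_combination (norm := module) -hroot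
  calc ‖waveOp a F z - μ • z‖ ≤ ‖μ • p‖ + ‖-((r : ℂ) • p) - μ • q‖ := by
        rw [← hfst, ← hsnd]
        exact norm_le_norm_fst_add_norm_snd _
    _ ≤ ‖μ‖ * ‖p‖ + (r * ‖p‖ + ‖μ‖ * ‖q‖) := by
        refine add_le_add (norm_smul μ p).le ((norm_sub_le _ _).trans_eq ?_)
        rw [norm_neg, norm_smul, norm_smul, Complex.norm_real, Real.norm_of_nonneg hr]
    _ ≤ ‖μ‖ * (η * ‖w‖) + (r * (η * ‖w‖) + ‖μ‖ * (η * ‖w‖)) := by gcongr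
    _ = (2 * ‖μ‖ + r) * η * ‖w‖ := by ring

theorem exists_measurableSet_mem_nhds_subset_sublevel {σ : Set ℝ} {f : σ → ℝ} (hf : Continuous f)
    (s₀ : σ) {η : ℝ} (hη : 0 < η) :
    ∃ (n : ℕ) (U : Set σ), MeasurableSet U ∧ U ∈ 𝓝 s₀ ∧ U ⊆ sublevel f n ∧
      (∀ s ∈ U, |√(s : ℝ) - √(s₀ : ℝ)| ≤ η) ∧ ∀ s ∈ U, |f s - f s₀| ≤ η := by
  obtain ⟨n, hn⟩ := exists_nat_gt (max (s₀ : ℝ) (f s₀))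
  let V : Set σ := {s | (s : ℝ) < n} ∩ {s | f s < n}
  let W : Set σ := {s | |√(s : ℝ) - √(s₀ : ℝ)| < η} ∩ {s | |f s - f s₀| < η}
  have hopen : IsOpen (V ∩ W) :=
    ((isOpen_lt (by fun_prop) continuous_const).inter (isOpen_lt hf continuous_const)).inter
      ((isOpen_lt (by fun_prop) continuous_const).inter (isOpen_lt (by fun_prop) continuous_const))
  have hmem : s₀ ∈ V ∩ W :=
    ⟨⟨(le_max_left _ _).trans_lt hn, (le_max_right _ _).trans_lt hn⟩, by simp [W, hη]⟩
  exact ⟨n, V ∩ W, hopen.measurableSet, hopen.mem_nhds hmem,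
    fun s hs => ⟨(le_of_lt hs.1.1 : (s : ℝ) ≤ n), (le_of_lt hs.1.2 : f s ≤ n)⟩,
    fun _ hs => le_of_lt hs.2.1, fun _ hs => le_of_lt hs.2.2⟩

variable [CompleteSpace H]

theorem norm_partOp_sub_smul_le {α : Type*} [MeasurableSpace α] {E : SpectralMeasure α H}
    {a : α → ℝ} {U ω : Set α} (h : BddMeas (ω.indicator fun s => (a s : ℂ)))
    (hU : MeasurableSet U) (hUω : U ⊆ ω) {a₀ η : ℝ} (hη : 0 ≤ η) (ha : ∀ s ∈ U, |a s - a₀| ≤ η)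
    {w : H} (hw : E.toFun U w = w) : ‖partOp E a ω w - (a₀ : ℂ) • w‖ ≤ η * ‖w‖ := by
  have hone : BddMeas (U.indicator 1 : α → ℂ) := BddMeas.indicator_one hU
  have haU : BddMeas (U.indicator fun s => (a s : ℂ)) := by
    rw [← Set.inter_eq_self_of_subset_left hUω, ← Set.indicator_indicator]
    exact BddMeas.indicator h.1 hU fun s _ => h.2.choose_spec s
  have hcalc : partOp E a ω w - (a₀ : ℂ) • w =
      E.bcalc ((U.indicator fun s => (a s : ℂ)) - (a₀ : ℂ) • U.indicator 1) w := by
    rw [bcalc_sub haU (hone.smul _), bcalc_smul _ hone, bcalc_indicator_one hU, _root_.sub_apply,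
      _root_.smul_apply, hw, ← bcalc_indicator_toFun hU h hUω w, hw, partOp]
  rw [hcalc]
  refine norm_bcalc_le (haU.sub (hone.smul _)).1 hη (fun s => ?_) w
  by_cases hs : s ∈ U
  · simpa [hs, ← Complex.ofReal_sub, Complex.norm_real] using ha s hs
  · simpa [hs] using hη

variable {A : H →ₗ.[ℂ] H} {E : SpectralMeasure (spec A) H} {c : ℝ} {f : spec A → ℝ}

-- Near `s₀` the symbol of `waveGen` is close to `[[0, √s₀], [-√s₀, -f s₀]]`, which has the
-- eigenvector `(√s₀, μ)`.
theorem exists_approx_eigenvector (hA : IsSelfAdjoint A) (hE : IsSpectralMeasureOf A E)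
    (hf : Continuous f) (hf0 : ∀ s, 0 ≤ f s) {s₀ : spec A} (hs₀ : 0 < (s₀ : ℝ)) {μ : ℂ}
    (hμ : μ ^ 2 + f s₀ * μ + (s₀ : ℝ) = 0) {δ : ℝ} (hδ : 0 < δ) :
    ∃ (n : ℕ) (z : WithLp 2 (H × H)), z ≠ 0 ∧ waveProj E f n z = z ∧
      ‖waveGen E f n z - μ • z‖ ≤ δ * ‖z‖ := by
  have hr0 : 0 < √(s₀ : ℝ) := Real.sqrt_pos.2 hs₀
  set r := √(s₀ : ℝ)
  have hμr : μ ^ 2 + f s₀ * μ + (r : ℂ) ^ 2 = 0 := by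
    rw [← Complex.ofReal_pow, Real.sq_sqrt hs₀.le, hμ]
  set η := δ * r / (2 * ‖μ‖ + r) with hη
  have hη0 : 0 < η := by positivity
  obtain ⟨n, U, hU, hUs₀, hUn, hUsqrt, hUf⟩ :=
    exists_measurableSet_mem_nhds_subset_sublevel hf s₀ hη0
  obtain ⟨w₀, hw₀⟩ := exists_toFun_ne_zero hA hE s₀ hU hUs₀
  set w := E.toFun U w₀
  have hself := bddExhaustion_sublevel_self hf.measurable hf0
  have hw : E.toFun U w = w := E.toFun_toFun hU w₀
  have hwn : E.toFun (sublevel f n) w = w :=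
    E.toFun_toFun_of_subset hU (hself.measurableSet n) hUn w₀
  let z : WithLp 2 (H × H) := WithLp.toLp 2 ((r : ℂ) • w, μ • w)
  have hrz : r * ‖w‖ ≤ ‖z‖ := by
    have hle : ‖(r : ℂ) • w‖ ≤ ‖z‖ := WithLp.norm_fst_le H z
    rwa [norm_smul, Complex.norm_real, Real.norm_of_nonneg hr0.le] at hle
  refine ⟨n, z, norm_pos_iff.1 ((mul_pos hr0 (norm_pos_iff.2 hw₀)).trans_le hrz), ?_, ?_⟩
  · exact withLp_prod_ext ((map_smul _ _ w).trans (congrArg _ hwn))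
      ((map_smul _ _ w).trans (congrArg _ hwn))
  calc ‖waveGen E f n z - μ • z‖ ≤ (2 * ‖μ‖ + r) * η * ‖w‖ :=
        norm_waveOp_sub_smul_le hr0.le hμr
          (norm_partOp_sub_smul_le ((bddExhaustion_sublevel_sqrt hf.measurable).bddMeas n) hU hUn
            hη0.le hUsqrt hw)
          (norm_partOp_sub_smul_le (hself.bddMeas n) hU hUn hη0.le hUf hw) rfl
    _ = δ * (r * ‖w‖) := by rw [hη]; field_simp
    _ ≤ δ * ‖z‖ := mul_le_mul_of_nonneg_left hrz hδ.le

end ApproxEigenvectors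

section Necessity

theorem two_mul_le_and_mul_le_of_roots {b s κ : ℝ} (hκ : 0 ≤ κ) (hs : 0 ≤ s)
    (h : ∀ μ : ℂ, μ ^ 2 + b * μ + s = 0 → μ.re ≤ -κ) : 2 * κ ≤ b ∧ κ * b ≤ 2 * s := by
  obtain ⟨d, hd⟩ := IsAlgClosed.exists_pow_nat_eq ((b : ℂ) ^ 2 - 4 * s) two_pos
  set μ₁ : ℂ := (-b + d) / 2 with hμ₁
  set μ₂ : ℂ := (-b - d) / 2 with hμ₂
  have hsum : μ₁ + μ₂ = -b := by rw [hμ₁, hμ₂]; ring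
  have hprod : μ₁ * μ₂ = s := by rw [hμ₁, hμ₂]; linear_combination -1 / 4 * hd
  have hre₁ : μ₁.re ≤ -κ := h μ₁ (by linear_combination μ₁ * hsum - hprod)
  have hre₂ : μ₂.re ≤ -κ := h μ₂ (by linear_combination μ₂ * hsum - hprod)
  have hre : μ₁.re + μ₂.re = -b := by simpa using congrArg Complex.re hsum
  have hnorm : ‖μ₁‖ * ‖μ₂‖ = s := by
    rw [← norm_mul, hprod, Complex.norm_real, Real.norm_of_nonneg hs]
  have hb₁ : -μ₁.re ≤ ‖μ₁‖ := (neg_le_abs _).trans (Complex.abs_re_le_norm μ₁)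
  have hb₂ : -μ₂.re ≤ ‖μ₂‖ := (neg_le_abs _).trans (Complex.abs_re_le_norm μ₂)
  have hκ₁ : κ ≤ ‖μ₁‖ := by linarith
  have hκ₂ : κ ≤ ‖μ₂‖ := by linarith
  refine ⟨by linarith, ?_⟩
  calc κ * b ≤ κ * (‖μ₁‖ + ‖μ₂‖) := mul_le_mul_of_nonneg_left (by linarith) hκ
    _ = κ * ‖μ₁‖ + κ * ‖μ₂‖ := mul_add _ _ _
    _ ≤ ‖μ₂‖ * ‖μ₁‖ + ‖μ₁‖ * ‖μ₂‖ := by gcongr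
    _ = 2 * s := by rw [← hnorm]; ring

variable {H : Type*} [NormedAddCommGroup H] [InnerProductSpace ℂ H] [CompleteSpace H]
  {A : H →ₗ.[ℂ] H} {E : SpectralMeasure (spec A) H} {f : spec A → ℝ}

theorem bounds_of_norm_exp_waveGen_le (hA : IsSelfAdjoint A) (hE : IsSpectralMeasureOf A E)
    (hf : Continuous f) (hf0 : ∀ s, 0 ≤ f s) {κ M : ℝ} (hκ : 0 ≤ κ)
    (h : ∀ (n : ℕ) (z : WithLp 2 (H × H)) (t : ℝ), 0 ≤ t →
      ‖NormedSpace.exp (t • waveGen E f n) (waveProj E f n z)‖ ≤ M * Real.exp (-κ * t) * ‖z‖)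
    {s : spec A} (hs : 0 < (s : ℝ)) : 2 * κ ≤ f s ∧ κ * f s ≤ 2 * s := by
  refine two_mul_le_and_mul_le_of_roots hκ hs.le fun μ hμ => ?_
  by_contra! hlt
  obtain ⟨δ, hδ, heq_zero⟩ := exists_pos_forall_eq_zero_of_norm_sub_smul_le
    (K := WithLp 2 (H × H)) (M := M) hlt
  obtain ⟨n, z, hz0, hz, hle⟩ := exists_approx_eigenvector hA hE hf hf0 hs hμ hδ
  refine hz0 (heq_zero _ ((dissipativeApprox_wave hf.measurable hf0).dissipative n) z
    (fun t ht => ?_) hle)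
  have hdecay := h n z t ht
  rwa [hz] at hdecay

end Necessity

/-! ### The stability criterion -/

section Criterion

variable {H : Type*} [NormedAddCommGroup H] [InnerProductSpace ℂ H] [CompleteSpace H]

theorem SpectralMeasure.nonempty {α : Type*} [MeasurableSpace α] [Nontrivial H]
    (E : SpectralMeasure α H) : Nonempty α := by
  by_contra hα
  have hone := E.univ
  rw [Set.univ_eq_empty_iff.2 (not_nonempty_iff.1 hα), E.empty] at hone
  exact zero_ne_one hone

variable {A : H →ₗ.[ℂ] H} {E : SpectralMeasure (spec A) H} {f : spec A → ℝ} {c : ℝ}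
  {S : ℝ≥0 → WithLp 2 (H × H) →L[ℂ] WithLp 2 (H × H)}

theorem bounds_of_exponentiallyStable [Nontrivial H] (hA : IsSelfAdjoint A)
    (hE : IsSpectralMeasureOf A E) (hpos : ∀ s : spec A, 0 < (s : ℝ)) (hf : Continuous f)
    (hf0 : ∀ s, 0 ≤ f s) (hS : IsC0Semigroup S)
    (hgen : generatorGraph S = {p | ∀ n, waveGen E f n p.1 = waveProj E f n p.2})
    (hstable : ExponentiallyStable S) :
    (0 < ⨅ s : spec A, f s) ∧ BddAbove (Set.range fun s : spec A => f s / (s : ℝ)) := by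
  have hD := dissipativeApprox_wave (E := E) hf.measurable hf0
  obtain ⟨κ, hκ, M, -, hM⟩ := hstable
  have hdecay : ∀ (n : ℕ) (z : WithLp 2 (H × H)) (t : ℝ), 0 ≤ t →
      ‖NormedSpace.exp (t • waveGen E f n) (waveProj E f n z)‖ ≤ M * Real.exp (-κ * t) * ‖z‖ :=
    fun n z t ht => by
      lift t to ℝ≥0 using ht
      rw [← hD.proj_apply_eq_exp hS hgen]
      exact (hD.norm_le n _).trans (hM t z)
  have hbounds := fun s => bounds_of_norm_exp_waveGen_le hA hE hf hf0 hκ.le hdecay (hpos s)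
  have := E.nonempty
  refine ⟨(mul_pos two_pos hκ).trans_le (le_ciInf fun s => (hbounds s).1), 2 / κ, ?_⟩
  rintro _ ⟨s, rfl⟩
  exact (div_le_div_iff₀ (hpos s) hκ).2 ((mul_comm _ _).trans_le (hbounds s).2)

theorem exponentiallyStable_of_bounds (hc0 : 0 < c) (hc : ∀ s : spec A, c ≤ s)
    (hf : Measurable f) (hf0 : ∀ s, 0 ≤ f s) (hS : IsC0Semigroup S)
    (hgen : generatorGraph S = {p | ∀ n, waveGen E f n p.1 = waveProj E f n p.2})
    (hinf : 0 < ⨅ s : spec A, f s) (hsup : BddAbove (Set.range fun s : spec A => f s / (s : ℝ))) :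
    ExponentiallyStable S := by
  have hD := dissipativeApprox_wave (E := E) hf hf0
  obtain ⟨C, hC⟩ := hsup
  have hbdd : BddBelow (Set.range f) := ⟨0, Set.forall_mem_range.2 hf0⟩
  obtain ⟨κ, hκ, hdecay⟩ := exists_norm_exp_waveGen_le (E := E) hc0 hc hf hinf
    (fun s => ciInf_le hbdd s) fun s => hC ⟨s, rfl⟩
  refine ⟨κ, hκ, 2, one_le_two, fun t z => ?_⟩
  refine le_of_tendsto (hD.tendsto (S t z)).norm (Eventually.of_forall fun n => ?_)
  rw [hD.proj_apply_eq_exp hS hgen]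
  exact hdecay n z t t.coe_nonneg

end Criterion

end DampedEvolution

end

open DampedEvolution in
theorem mainTheorem2_general {H : Type*} [NormedAddCommGroup H] [InnerProductSpace ℂ H]
    [CompleteSpace H] [Nontrivial H]
    (A : H →ₗ.[ℂ] H) (hA : IsSelfAdjoint A) (hpos : StrictlyPositive A)
    (f : spec A → ℝ) (hf : Continuous f) (hf0 : ∀ s, 0 ≤ f s) :
    (∃ S : ℝ≥0 → Phase A →L[ℂ] Phase A, IsC0Semigroup S ∧ (∀ t z, ‖S t z‖ ≤ ‖z‖) ∧
        generatorGraph S = evolutionGraph A f) ∧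
      ∀ S : ℝ≥0 → Phase A →L[ℂ] Phase A, IsC0Semigroup S →
        generatorGraph S = evolutionGraph A f →
          (ExponentiallyStable S ↔
            (0 < ⨅ s : spec A, f s) ∧
              BddAbove (Set.range fun s : spec A => f s / (s : ℝ))) := by
  obtain ⟨E, hE, hcalc⟩ := exists_spectralMeasure_funCalc hA hpos
  obtain ⟨c, hc0, hAc⟩ := hpos
  have hc : ∀ s : spec A, c ≤ s := le_of_mem_spec hA hAc
  have hbij := bijective_sqrtMap hcalc hc0 hc
  let J := phaseEquiv hbij
  have hgraph := mem_evolutionGraph_iff hE hcalc hc0 hc hf.measurable hf0 hbij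
  have hD := dissipativeApprox_wave (E := E) hf.measurable hf0
  refine ⟨⟨fun t => conjOp J (hD.semigroup t), hD.isC0Semigroup_semigroup.conjOp J,
    fun t z => ?_, ?_⟩, fun S hS hgen => ?_⟩
  · rw [conjOp_apply, J.symm.norm_map, ← J.norm_map z]
    exact hD.norm_semigroup_le t (J z)
  · ext p
    rw [mem_generatorGraph_conjOp, hD.generatorGraph_semigroup, hgraph, Set.mem_ofPred]
  · have hS' := hS.conjOp J.symm
    have hgen' : generatorGraph (fun t => conjOp J.symm (S t)) =
        {p | ∀ n, waveGen E f n p.1 = waveProj E f n p.2} := by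
      ext p
      rw [mem_generatorGraph_conjOp, hgen, hgraph, J.apply_symm_apply, J.apply_symm_apply,
        Set.mem_ofPred]
    rw [← exponentiallyStable_conjOp_iff J.symm]
    exact ⟨bounds_of_exponentiallyStable hA hE (fun s => hc0.trans_le (hc s)) hf hf0 hS' hgen',
      fun h => exponentiallyStable_of_bounds hc0 hc hf.measurable hf0 hS' hgen' h.1 h.2⟩

open DampedEvolution in
theorem mainTheorem2 {H : Type*} [NormedAddCommGroup H] [InnerProductSpace ℂ H] [CompleteSpace H]
    [TopologicalSpace.SeparableSpace H] [Nontrivial H]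
    (A : H →ₗ.[ℂ] H) (hA : IsSelfAdjoint A) (hpos : StrictlyPositive A)
    (f : spec A → ℝ) (hf : Continuous f) (hf0 : ∀ s, 0 ≤ f s) :
    (∃ S : ℝ≥0 → Phase A →L[ℂ] Phase A, IsC0Semigroup S ∧ (∀ t z, ‖S t z‖ ≤ ‖z‖) ∧
        generatorGraph S = evolutionGraph A f) ∧
      ∀ S : ℝ≥0 → Phase A →L[ℂ] Phase A, IsC0Semigroup S →
        generatorGraph S = evolutionGraph A f →
          (ExponentiallyStable S ↔
            (0 < ⨅ s : spec A, f s) ∧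
              BddAbove (Set.range fun s : spec A => f s / (s : ℝ))) :=
  mainTheorem2_general A hA hpos f hf hf0
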